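/- **Setting.** Let $\mathbb G_1,\mathbb G_2$ be cyclic groups of prime order $p$ and let $e:\mathbb G_1\times\mathbb G_1\to\mathbb G_2$ be a cryptographic pairing: $e(x^a,y^b)=e(x,y)^{ab}$ for all $x,y\in\mathbb G_1$, $a,b\in\mathbb Z$, and $e(g,g)$ generates $\mathbb G_2$ whenever $g$ generates $\mathbb G_1$. Algorithms are programs for probabilistic multitape machines that work on bits, on elements of $\mathbb Z_p$, $\mathbb G_1$, $\mathbb G_2$, and on arbitrary fixed-length binary representations of group elements (so they need not be generic). Each elementary operation has its own cost; operations on bits, copying, comparing, moving a tape head and testing a bit cost $1$. The running time of an algorithm is the number of steps, weighted by cost, plus the length of its program; an algorithm that exceeds its time bound is regarded as having failed. Let $T\ge 1$ be the time for an exponentiation in $\mathbb G_1$, and suppose that an operation in $\mathbb Z_p$ (arithmetic or random sampling), a multiplication in $\mathbb G_1$ and an evaluation of $e$ each take time at most $\kappa T$. **Assumption.** The $(t',q',\epsilon')$-Strong Diffie-Hellman assumption holds in $\mathbb G_1$ if no algorithm running in time $t'$ which is given $(g,g^x,g^{(x^2)},\dots,g^{(x^{q'})})$, for a uniformly random generator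 $g$ of $\mathbb G_1$ and a uniformly random $x\in\mathbb Z_p^*$, outputs with probability at least $\epsilon'$ a pair $(c,g^{1/(x+c)})$ with $c\in\mathbb Z_p$, $c\ne -x$. **Protocol.** The common input is a uniformly random generator $g$ of $\mathbb G_1$. *Key generation:* pick uniformly random $x,y\in\mathbb Z_p^*$; the private key is $(x,y)$ and the public key is $(u,v,z)=(g^x,g^y,e(g,g))$. *Interaction:* (1) the verifier sends a uniformly random $m\in\mathbb Z_p^*$; (2) the prover picks a random $r\in\mathbb Z_p^*$ and, if $x+m+yr=0$, replaces it by a random different element of $\mathbb Z_p^*$, then sends $(\sigma,r)$ with $\sigma=g^{1/(x+m+yr)}$; (3) the verifier accepts if and only if $e(\sigma,u\,g^m\,v^r)=z$. **Definition.** The protocol is a $(t,q,\epsilon)$-identification scheme if the honest prover and the honest verifier run in time at most $t$ and the following two conditions hold. *Viability:* for every common input, if both parties follow the protocol, then the verifier accepts with probability $1$. *Security:* for every cheating verifier $\mathcal B$ and every cheating prover $\mathcal A$ with total running time at most $t$, if $\mathcal B$ is given the public key (with $g$), interacts successively $q$ times with the honest prover, and passes its output to $\mathcal A$, who is also given the public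 key and then interacts once with the honest verifier, then the verifier accepts with probability less than $\epsilon$ (over $g$, the keys and all coin tosses). **Theorem.** For every $\kappa$ there is a constant $c$, depending only on $\kappa$, such that the following holds for all groups and pairings as above. Suppose that the $(t',q',\epsilon')$-Strong Diffie-Hellman assumption holds in $\mathbb G_1$. Then the protocol is a $(t,q,\epsilon)$-identification scheme, provided that $$q<q',\qquad q<p,\qquad \epsilon\ \ge\ 2\epsilon'\cdot\frac{p}{p-q}+\frac{2q}{p-q},\qquad t\ \le\ t'-c\,q'^2\,T,$$ and that $t$ is at least the running time of the honest prover and of the honest verifier. Moreover, key generation takes a fixed number of elementary operations (two samplings from $\mathbb Z_p^*$, two exponentiations in $\mathbb G_1$ and one evaluation of $e$). -/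

import Mathlib

/-! ## Pairing platforms -/

/-- `g` generates the group `G`. -/
def IsGenerator {G : Type} [Group G] (g : G) : Prop :=
  ∀ x : G, x ∈ Subgroup.zpowers g

/-- A concrete implementation of a cryptographic pairing `G₁ × G₁ → G₂`: the pairing itself,
fixed-length binary representations of the group elements (arbitrary injective maps), and the
time taken by each elementary operation. -/
structure Platform (p : ℕ) (G₁ G₂ : Type) [CommGroup G₁] [CommGroup G₂] where
  /-- the pairing -/
  pairing : G₁ → G₁ → G₂
  bilinear : ∀ (x y : G₁) (a b : ℤ), pairing (x ^ a) (y ^ b) = pairing x y ^ (a * b)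
  nondegenerate : ∀ g : G₁, IsGenerator g → IsGenerator (pairing g g)
  /-- length of the binary representation of elements of `G₁` -/
  len₁ : ℕ
  /-- length of the binary representation of elements of `G₂` -/
  len₂ : ℕ
  /-- binary representation of elements of `G₁` -/
  enc₁ : G₁ ↪ (Fin len₁ → Bool)
  /-- binary representation of elements of `G₂` -/
  enc₂ : G₂ ↪ (Fin len₂ → Bool)
  /-- time for an arithmetic operation in `ℤ/p`, or for sampling from it -/
  scalarTime : ℕ
  /-- time for a multiplication in `G₁` -/
  mulTime₁ : ℕ
  /-- time for an exponentiation in `G₁` -/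
  expTime₁ : ℕ
  /-- time for a multiplication in `G₂` -/
  mulTime₂ : ℕ
  /-- time for an exponentiation in `G₂` -/
  expTime₂ : ℕ
  /-- time for an evaluation of the pairing -/
  pairTime : ℕ

/-- Uniform distribution on a finite nonempty set `S` (and the point mass at `d` otherwise). -/
noncomputable def uniformOn {α : Type} (S : Set α) (d : α) : PMF α :=
  open Classical in
  if h : S.Finite ∧ S.Nonempty then
    PMF.uniformOfFinset h.1.toFinset (h.1.toFinset_nonempty.2 h.2)
  else PMF.pure d

/-! ## Probabilistic multitape machines

The machines have infinitely many tapes for each of four kinds of symbols: bits, scalars (elements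
of `ℤ/p`), elements of `G₁` and elements of `G₂`.  Instructions act on the cells under the heads of
the tapes, so that a tape whose head does not move serves as a register. Group elements and scalars
can be converted to and from their binary representations, and these can be processed bitwise:
machines are not restricted to generic group algorithms. -/

/-- The kinds of symbols. -/
inductive Kind where
  | bit | scalar | src | tgt
  deriving DecidableEq

section Machine

variable {p : ℕ} {G₁ G₂ : Type}

/-- The symbols of each kind. -/
abbrev Symb (p : ℕ) (G₁ G₂ : Type) : Kind → Type
  | .bit => Bool
  | .scalar => ZMod p
  | .src => G₁
  | .tgt => G₂

variable [CommGroup G₁] [CommGroup G₂]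

/-- The blank symbol of each kind. -/
def blankSymb (p : ℕ) (G₁ G₂ : Type) [CommGroup G₁] [CommGroup G₂] :
    (k : Kind) → Symb p G₁ G₂ k
  | .bit => false
  | .scalar => (0 : ZMod p)
  | .src => (1 : G₁)
  | .tgt => (1 : G₂)

instance symbInhabited (k : Kind) : Inhabited (Symb p G₁ G₂ k) := ⟨blankSymb p G₁ G₂ k⟩

/-- The memory of a machine: tape number `i` of kind `k`, for all `k` and `i`. -/
abbrev Store (p : ℕ) (G₁ G₂ : Type) [CommGroup G₁] [CommGroup G₂] : Type :=
  (k : Kind) → ℕ → Turing.Tape (Symb p G₁ G₂ k)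

/-- The blank memory. -/
def Store.blank : Store p G₁ G₂ := fun _ _ => Turing.Tape.mk₁ []

/-- The symbol under the head of tape `i` of kind `k`. -/
def Store.get (σ : Store p G₁ G₂) (k : Kind) (i : ℕ) : Symb p G₁ G₂ k := (σ k i).head

/-- Replace tape `i` of kind `k`. -/
def Store.setTape (σ : Store p G₁ G₂) (k : Kind) (i : ℕ)
    (T : Turing.Tape (Symb p G₁ G₂ k)) : Store p G₁ G₂ :=
  Function.update σ k (Function.update (σ k) i T)

/-- Overwrite the symbol under the head of tape `i` of kind `k`. -/
def Store.set (σ : Store p G₁ G₂) (k : Kind) (i : ℕ) (v : Symb p G₁ G₂ k) : Store p G₁ G₂ :=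
  σ.setTape k i ((σ k i).write v)

/-- Transmission of a message: the symbols under the heads of the listed tapes of `σ` are written
to the same tapes of `τ`. -/
def Store.receive (regs : List (Kind × ℕ)) (σ τ : Store p G₁ G₂) : Store p G₁ G₂ :=
  regs.foldl (fun ρ r => ρ.set r.1 r.2 (σ.get r.1 r.2)) τ

/-- Elementary instructions. The first tape number is that of the destination. -/
inductive Instr (p : ℕ) (G₁ G₂ : Type) where
  /-- write a constant -/
  | const (k : Kind) (d : ℕ) (a : Symb p G₁ G₂ k)
  /-- copy a symbol -/
  | copy (k : Kind) (d i : ℕ)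
  /-- move the head of a tape -/
  | move (k : Kind) (d : ℕ) (dir : Turing.Dir)
  /-- compare two symbols, writing the answer to a bit tape -/
  | eq (k : Kind) (d i j : ℕ)
  /-- write the binary representation of a symbol to a bit tape -/
  | encode (k : Kind) (d i : ℕ)
  /-- read a symbol from its binary representation on a bit tape -/
  | decode (k : Kind) (d i : ℕ)
  /-- negated conjunction of two bits -/
  | nand (d i j : ℕ)
  /-- toss a fair coin -/
  | coin (d : ℕ)
  /-- scalar arithmetic -/
  | add (d i j : ℕ)
  | neg (d i : ℕ)
  | mul (d i j : ℕ)
  | inv (d i : ℕ)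
  /-- uniformly random scalar -/
  | rand (d : ℕ)
  /-- uniformly random nonzero scalar -/
  | randUnit (d : ℕ)
  /-- uniformly random nonzero scalar different from the scalar `i` -/
  | randUnitNe (d i : ℕ)
  /-- group operations in `G₁`; in `exp₁ d i j` the exponent is the scalar `j` -/
  | mul₁ (d i j : ℕ)
  | exp₁ (d i j : ℕ)
  /-- group operations in `G₂` -/
  | mul₂ (d i j : ℕ)
  | exp₂ (d i j : ℕ)
  /-- evaluate the pairing -/
  | pair (d i j : ℕ)

/-- Programs: instructions, conditional execution and loops controlled by the bit under the head
of a bit tape. -/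
inductive Prog (p : ℕ) (G₁ G₂ : Type) where
  | skip
  | op (i : Instr p G₁ G₂)
  | seq (c d : Prog p G₁ G₂)
  | ite (b : ℕ) (c d : Prog p G₁ G₂)
  | loop (b : ℕ) (c : Prog p G₁ G₂)

/-- The length of a program. -/
def Prog.size : Prog p G₁ G₂ → ℕ
  | .skip => 0
  | .op _ => 1
  | .seq c d => c.size + d.size
  | .ite _ c d => c.size + d.size + 1
  | .loop _ c => c.size + 1

/-- Straight-line programs. -/
def Prog.ofList : List (Instr p G₁ G₂) → Prog p G₁ G₂
  | [] => .skip
  | i :: l => .seq (.op i) (Prog.ofList l)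

/-- Write bits to a tape from its head rightwards; the head ends up to the right of them. -/
def writeBits (l : List Bool) (T : Turing.Tape (Symb p G₁ G₂ .bit)) :
    Turing.Tape (Symb p G₁ G₂ .bit) :=
  l.foldl (fun T b => (T.write b).move Turing.Dir.right) T

namespace Platform

variable (𝓟 : Platform p G₁ G₂)

/-- Binary representations of symbols; scalars are represented in binary notation. -/
def encodeSymb : (k : Kind) → Symb p G₁ G₂ k → List Bool
  | .bit, b => [b]
  | .scalar, (a : ZMod p) => (List.range p.size).map fun i => a.val.testBit i
  | .src, g => List.ofFn (𝓟.enc₁ g)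
  | .tgt, h => List.ofFn (𝓟.enc₂ h)

/-- The length of the binary representations. -/
def encodeLen : Kind → ℕ
  | .bit => 1
  | .scalar => p.size
  | .src => 𝓟.len₁
  | .tgt => 𝓟.len₂

/-- The symbol with a given binary representation (blank if there is none). -/
noncomputable def decodeSymb (k : Kind) (l : List Bool) : Symb p G₁ G₂ k :=
  open Classical in
  if h : ∃ v : Symb p G₁ G₂ k, 𝓟.encodeSymb k v = l then h.choose else blankSymb p G₁ G₂ k

/-- The time taken by each instruction. -/
def cost : Instr p G₁ G₂ → ℕ
  | .const .. | .copy .. | .move .. | .eq .. | .nand .. | .coin .. => 1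
  | .encode k .. | .decode k .. => 𝓟.encodeLen k
  | .add .. | .neg .. | .mul .. | .inv .. | .rand .. | .randUnit .. | .randUnitNe .. =>
    𝓟.scalarTime
  | .mul₁ .. => 𝓟.mulTime₁
  | .exp₁ .. => 𝓟.expTime₁
  | .mul₂ .. => 𝓟.mulTime₂
  | .exp₂ .. => 𝓟.expTime₂
  | .pair .. => 𝓟.pairTime

/-- The (random) effect of each instruction on the memory. -/
noncomputable def effect (σ : Store p G₁ G₂) : Instr p G₁ G₂ → PMF (Store p G₁ G₂)
  | .const k d a => PMF.pure (σ.set k d a)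
  | .copy k d i => PMF.pure (σ.set k d (σ.get k i))
  | .move k d dir => PMF.pure (σ.setTape k d ((σ k d).move dir))
  | .eq k d i j => open Classical in
    PMF.pure (σ.set .bit d (decide (σ.get k i = σ.get k j)))
  | .encode k d i =>
    PMF.pure (σ.setTape .bit d (writeBits (𝓟.encodeSymb k (σ.get k i)) (σ .bit d)))
  | .decode k d i =>
    PMF.pure (σ.set k d (𝓟.decodeSymb k
      ((List.range (𝓟.encodeLen k)).map fun n => (σ .bit i).nth n)))
  | .nand d i j => PMF.pure (σ.set .bit d (!((σ.get .bit i : Bool) && (σ.get .bit j : Bool))))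
  | .coin d => (PMF.uniformOfFintype Bool).map fun b => σ.set .bit d b
  | .add d i j => PMF.pure (σ.set .scalar d ((σ.get .scalar i + σ.get .scalar j : ZMod p)))
  | .neg d i => PMF.pure (σ.set .scalar d ((-σ.get .scalar i : ZMod p)))
  | .mul d i j => PMF.pure (σ.set .scalar d ((σ.get .scalar i * σ.get .scalar j : ZMod p)))
  | .inv d i => PMF.pure (σ.set .scalar d (((σ.get .scalar i : ZMod p)⁻¹ : ZMod p)))
  | .rand d => (uniformOn (Set.univ : Set (ZMod p)) 0).map fun a => σ.set .scalar d a
  | .randUnit d => (uniformOn {a : ZMod p | a ≠ 0} 0).map fun a => σ.set .scalar d a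
  | .randUnitNe d i =>
    (uniformOn {a : ZMod p | a ≠ 0 ∧ a ≠ σ.get .scalar i} 0).map fun a => σ.set .scalar d a
  | .mul₁ d i j => PMF.pure (σ.set .src d ((σ.get .src i * σ.get .src j : G₁)))
  | .exp₁ d i j =>
    PMF.pure (σ.set .src d (((σ.get .src i : G₁) ^ (σ.get .scalar j : ZMod p).val : G₁)))
  | .mul₂ d i j => PMF.pure (σ.set .tgt d ((σ.get .tgt i * σ.get .tgt j : G₂)))
  | .exp₂ d i j =>
    PMF.pure (σ.set .tgt d (((σ.get .tgt i : G₂) ^ (σ.get .scalar j : ZMod p).val : G₂)))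
  | .pair d i j => PMF.pure (σ.set .tgt d (𝓟.pairing (σ.get .src i) (σ.get .src j)))

/-- `iterate body b f n σ`: repeat `body` as long as the bit `b` is set, making at most `f`
tests. Each test takes time 1. -/
noncomputable def iterate
    (body : ℕ → Store p G₁ G₂ → OptionT PMF (ℕ × Store p G₁ G₂)) (b : ℕ) :
    ℕ → ℕ → Store p G₁ G₂ → OptionT PMF (ℕ × Store p G₁ G₂)
  | f + 1, n + 1, σ =>
    if (σ.get .bit b : Bool) = true then do
      let (m, τ) ← body n σ
      iterate body b f m τ
    else pure (n, σ)
  | _, _, _ => failure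

/-- Execution of a program with a time budget `n` on the memory `σ`. The result is the remaining
budget and the final memory, or failure if the budget is exceeded. A loop with budget `n` makes
at most `n` tests. -/
noncomputable def exec :
    Prog p G₁ G₂ → ℕ → Store p G₁ G₂ → OptionT PMF (ℕ × Store p G₁ G₂)
  | .skip, n, σ => pure (n, σ)
  | .op i, n, σ =>
    if 𝓟.cost i ≤ n then do
      let τ ← (OptionT.lift (𝓟.effect σ i) : OptionT PMF (Store p G₁ G₂))
      pure (n - 𝓟.cost i, τ)
    else failure
  | .seq c d, n, σ => do
    let (m, τ) ← exec c n σ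
    exec d m τ
  | .ite _ _ _, 0, _ => failure
  | .ite b c d, n + 1, σ => if (σ.get .bit b : Bool) = true then exec c n σ else exec d n σ
  | .loop b c, n, σ => iterate (exec c) b n n σ

/-- Execution in time at most `t`; as usual for concrete security, time comprises the length of
the program. -/
noncomputable def run (t : ℕ) (c : Prog p G₁ G₂) (σ : Store p G₁ G₂) :
    OptionT PMF (Store p G₁ G₂) :=
  if c.size ≤ t then Prod.snd <$> 𝓟.exec c (t - c.size) σ else failure

/-- The program `c` runs in time at most `t`, whatever the memory and the coin tosses. -/
def RunsIn (c : Prog p G₁ G₂) (t : ℕ) : Prop :=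
  ∀ σ : Store p G₁ G₂, (OptionT.run (𝓟.run t c σ)) none = 0

/-- The probability that a random experiment ends with the answer `true`. -/
noncomputable def prob (e : OptionT PMF Bool) : ℝ := ((OptionT.run e) (some true)).toReal

/-! ## The Strong Diffie-Hellman assumption -/

/-- A uniformly random generator of `G₁`. -/
noncomputable def randomGenerator (G₁ : Type) [CommGroup G₁] : PMF G₁ :=
  uniformOn {g : G₁ | IsGenerator g} 1

/-- The input `(g, g^x, g^(x^2), …, g^(x^q))`, on the tapes `0, …, q` of kind `src`. -/
def sdhInput (q : ℕ) (g : G₁) (x : ZMod p) : Store p G₁ G₂ :=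
  (List.range (q + 1)).foldl (fun σ i => σ.set .src i (g ^ (x ^ i).val)) Store.blank

/-- The `q`-SDH experiment: `C`, run for time at most `t`, has to write a pair
`(c, g^(1/(x+c)))` to the first scalar tape and the first `src` tape. -/
noncomputable def sdhExperiment (q t : ℕ) (C : Prog p G₁ G₂) : OptionT PMF Bool := do
  let g ← (OptionT.lift (randomGenerator G₁) : OptionT PMF G₁)
  let x ← (OptionT.lift (uniformOn {a : ZMod p | a ≠ 0} 0) : OptionT PMF (ZMod p))
  let τ ← 𝓟.run t C (sdhInput q g x)
  let c : ZMod p := τ.get .scalar 0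
  let h : G₁ := τ.get .src 0
  pure (open Classical in decide (x + c ≠ 0 ∧ h = g ^ ((x + c)⁻¹).val))

/-- The `(t, q, ε)`-Strong Diffie-Hellman assumption in `G₁`: no algorithm that runs in time `t`
has advantage `ε` in solving the `q`-SDH problem. -/
def SDHAssumption (t q : ℕ) (ε : ℝ) : Prop :=
  ¬ ∃ C : Prog p G₁ G₂, ε ≤ prob (𝓟.sdhExperiment q t C)

end Platform

/-! ## Identification schemes -/

/-- A (challenge-response) identification scheme: common input, key generation, and an interactive
protocol in which the verifier sends a challenge, the prover sends a response, and the verifier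
accepts or rejects. -/
structure IdScheme (p : ℕ) (G₁ G₂ : Type) [CommGroup G₁] [CommGroup G₂] where
  /-- common input, on which key generation is run -/
  params : PMF (Store p G₁ G₂)
  /-- key generation -/
  keygen : Prog p G₁ G₂
  /-- tapes that hold the public key (with the common input) -/
  pub : List (Kind × ℕ)
  /-- tapes that hold the private key -/
  priv : List (Kind × ℕ)
  /-- first part of the verifier's program: choice of the challenge -/
  challenge : Prog p G₁ G₂
  /-- tapes that hold the challenge -/
  chal : List (Kind × ℕ)
  /-- the prover's program -/
  prover : Prog p G₁ G₂
  /-- tapes that hold the response -/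
  resp : List (Kind × ℕ)
  /-- second part of the verifier's program: verification of the response -/
  verify : Prog p G₁ G₂
  /-- bit tape that holds the verifier's output -/
  out : ℕ

namespace IdScheme

variable (S : IdScheme p G₁ G₂) (𝓟 : Platform p G₁ G₂)

/-- The memory of the prover at the beginning, given the memory `K` after key generation. -/
def proverStore (K : Store p G₁ G₂) : Store p G₁ G₂ :=
  Store.receive (S.pub ++ S.priv) K Store.blank

/-- The memory of a party that is given the public key only. -/
def publicStore (K : Store p G₁ G₂) : Store p G₁ G₂ :=
  Store.receive S.pub K Store.blank

/-- Key generation (in time `s`) on the common input `α`, followed by the honest execution of the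
protocol, with prover and verifier running for time at most `t` at each activation. -/
noncomputable def honest (s t : ℕ) (α : Store p G₁ G₂) : OptionT PMF Bool := do
  let K ← 𝓟.run s S.keygen α
  let ν ← 𝓟.run t S.challenge (S.publicStore K)
  let π ← 𝓟.run t S.prover (Store.receive S.chal ν (S.proverStore K))
  let ν' ← 𝓟.run t S.verify (Store.receive S.resp π ν)
  pure (ν'.get .bit S.out : Bool)

/-- `k` interactions of the cheating verifier `B` (with memory `β` and time budget `n`) with the
honest prover. `B` keeps its memory; at each activation it is run from the beginning of its
program, and its next challenge is on its challenge tapes when it stops. At the last activation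
it finishes its computations. The result is the remaining budget and the final memory. -/
noncomputable def interact (t : ℕ) (B : Prog p G₁ G₂) (K : Store p G₁ G₂) :
    ℕ → ℕ → Store p G₁ G₂ → OptionT PMF (ℕ × Store p G₁ G₂)
  | 0, n, β => 𝓟.exec B n β
  | k + 1, n, β => do
    let (m, β') ← 𝓟.exec B n β
    let π ← 𝓟.run t S.prover (Store.receive S.chal β' (S.proverStore K))
    interact t B K k m (Store.receive S.resp π β')

/-- The active attack: after `q` interactions with the honest prover, the cheating verifier `B`
passes what it has found (its memory) to the cheating prover `A`, who is also given the public key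
and interacts with the honest verifier. The total time of `A` and `B`, with the length of their
programs, is limited to `t`; attacks that take longer fail. -/
noncomputable def attack (s t q : ℕ) (A B : Prog p G₁ G₂) : OptionT PMF Bool :=
  if A.size + B.size ≤ t then do
    let α ← (OptionT.lift S.params : OptionT PMF (Store p G₁ G₂))
    let K ← 𝓟.run s S.keygen α
    let (n, β) ← S.interact 𝓟 t B K q (t - (A.size + B.size)) (S.publicStore K)
    let ν ← 𝓟.run t S.challenge (S.publicStore K)
    let (_, α') ← 𝓟.exec A n (Store.receive S.chal ν (Store.receive S.pub K β))
    let ν' ← 𝓟.run t S.verify (Store.receive S.resp α' ν)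
    pure (ν'.get .bit S.out : Bool)
  else failure

/-- `S` is a `(t, q, ε)`-identification scheme, with key generation in time `s`. -/
structure IsIdentificationScheme (s t q : ℕ) (ε : ℝ) : Prop where
  keygen_time : 𝓟.RunsIn S.keygen s
  prover_time : 𝓟.RunsIn S.prover t
  verifier_time : ∃ t₁ t₂ : ℕ, t₁ + t₂ ≤ t ∧ 𝓟.RunsIn S.challenge t₁ ∧ 𝓟.RunsIn S.verify t₂
  viability : ∀ α ∈ S.params.support, Platform.prob (S.honest 𝓟 s t α) = 1
  security : ∀ A B : Prog p G₁ G₂, Platform.prob (S.attack 𝓟 s t q A B) < ε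

end IdScheme

/-! ## The identification scheme based on the Boneh-Boyen signature scheme -/

/-- The common input is a random generator `g` (tape `src 0`). The public key is `u` (`src 1`),
`v` (`src 2`) and `z` (`tgt 0`); the private key is `x` (`scalar 0`) and `y` (`scalar 1`).
The challenge is `m` (`scalar 2`), and the response is `σ` (`src 3`) and `r` (`scalar 3`). -/
noncomputable def sdhScheme (p : ℕ) (G₁ G₂ : Type) [CommGroup G₁] [CommGroup G₂] :
    IdScheme p G₁ G₂ where
  params := (Platform.randomGenerator G₁).map fun g => Store.blank.set .src 0 g
  -- `x, y ← (ℤ/p)ˣ`, `u = g ^ x`, `v = g ^ y`, `z = e(g, g)`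
  keygen := Prog.ofList [.randUnit 0, .randUnit 1, .exp₁ 1 0 0, .exp₁ 2 0 1, .pair 0 0 0]
  pub := [(.src, 0), (.src, 1), (.src, 2), (.tgt, 0)]
  priv := [(.scalar, 0), (.scalar, 1)]
  -- `m ← (ℤ/p)ˣ`
  challenge := .op (.randUnit 2)
  chal := [(.scalar, 2)]
  -- `σ = g ^ (1 / (x + m + y r))`
  prover :=
    .seq (Prog.ofList [.randUnit 3, .mul 4 1 3, .add 4 2 4, .add 4 0 4,
      .const .scalar 5 (0 : ZMod p), .eq .scalar 0 4 5])
    (.seq (.ite 0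
      (Prog.ofList [.randUnitNe 3 3, .mul 4 1 3, .add 4 2 4, .add 4 0 4])
      .skip)
    (Prog.ofList [.inv 4 4, .exp₁ 3 0 4]))
  resp := [(.src, 3), (.scalar, 3)]
  -- accept if `e(σ, u * g ^ m * v ^ r) = z`
  verify := Prog.ofList [.exp₁ 4 0 2, .mul₁ 4 1 4, .exp₁ 5 2 3, .mul₁ 4 4 5, .pair 1 3 4,
    .eq .tgt 0 1 0]
  out := 0

namespace Platform

variable (𝓟 : Platform p G₁ G₂)

/-- Running time of key generation in `sdhScheme`. -/
def sdhKeygenTime : ℕ := 2 * 𝓟.scalarTime + 2 * 𝓟.expTime₁ + 𝓟.pairTime + 5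

/-- Running time of the prover in `sdhScheme` (13 is the length of the program, 3 the time for the
assignment of a constant and the two tests). -/
def sdhProverTime : ℕ := 9 * 𝓟.scalarTime + 𝓟.expTime₁ + 16

/-- Running time of the verifier in `sdhScheme`. -/
def sdhVerifierTime : ℕ :=
  𝓟.scalarTime + 2 * 𝓟.expTime₁ + 2 * 𝓟.mulTime₁ + 𝓟.pairTime + 8

end Platform

end Machine

open scoped ENNReal

set_option linter.unusedSectionVars false

/-! ## Expectations -/

section Expectation

variable {α β : Type}

/-- The expectation of `f` with respect to `μ`. -/
noncomputable def pexp (μ : PMF α) (f : α → ℝ≥0∞) : ℝ≥0∞ := ∑' a, μ a * f a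

theorem pexp_pure (a : α) (f : α → ℝ≥0∞) : pexp (PMF.pure a) f = f a := by
  classical
  unfold pexp
  rw [tsum_eq_single a]
  · simp
  · intro b hb; simp [PMF.pure_apply, hb]

theorem pexp_bind (μ : PMF α) (k : α → PMF β) (f : β → ℝ≥0∞) :
    pexp (μ.bind k) f = pexp μ (fun a => pexp (k a) f) := by
  unfold pexp
  simp only [PMF.bind_apply, ← ENNReal.tsum_mul_right, ← ENNReal.tsum_mul_left]
  rw [ENNReal.tsum_comm]
  simp only [mul_assoc]

theorem pexp_map (μ : PMF α) (g : α → β) (f : β → ℝ≥0∞) :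
    pexp (μ.map g) f = pexp μ (fun a => f (g a)) := by
  rw [← PMF.bind_pure_comp, pexp_bind]
  simp [pexp_pure]

theorem pexp_mono {μ : PMF α} {f g : α → ℝ≥0∞} (h : ∀ a, f a ≤ g a) : pexp μ f ≤ pexp μ g :=
  ENNReal.tsum_le_tsum fun a => mul_le_mul_right (h a) _

theorem pexp_const (μ : PMF α) (c : ℝ≥0∞) : pexp μ (fun _ => c) = c := by
  simp [pexp, ENNReal.tsum_mul_right]

theorem pexp_add (μ : PMF α) (f g : α → ℝ≥0∞) :
    pexp μ (fun a => f a + g a) = pexp μ f + pexp μ g := by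
  simp [pexp, mul_add, ENNReal.tsum_add]

theorem pexp_const_mul (μ : PMF α) (c : ℝ≥0∞) (f : α → ℝ≥0∞) :
    pexp μ (fun a => c * f a) = c * pexp μ f := by
  simp only [pexp, ← ENNReal.tsum_mul_left]
  exact tsum_congr fun a => by ring

theorem pexp_sum (μ : PMF α) {ι : Type} (s : Finset ι) (f : ι → α → ℝ≥0∞) :
    pexp μ (fun a => ∑ i ∈ s, f i a) = ∑ i ∈ s, pexp μ (f i) := by
  classical
  induction s using Finset.induction_on with
  | empty => simp [pexp]
  | insert i s hi ih => simp only [Finset.sum_insert hi, pexp_add, ih]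

theorem pexp_uniformOn {S : Set α} (d : α) [DecidableEq α] (s : Finset α)
    (hs : ∀ a, a ∈ s ↔ a ∈ S) (hne : s.Nonempty) (f : α → ℝ≥0∞) :
    pexp (uniformOn S d) f = (s.card : ℝ≥0∞)⁻¹ * ∑ a ∈ s, f a := by
  have hS : S = ↑s := by ext a; simp [hs]
  subst hS
  have h : (↑s : Set α).Finite ∧ (↑s : Set α).Nonempty := ⟨s.finite_toSet, by simpa using hne⟩
  rw [uniformOn, dif_pos h, pexp, tsum_eq_sum (s := s), Finset.mul_sum]
  · refine Finset.sum_congr rfl fun a ha => ?_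
    rw [PMF.uniformOfFinset_apply]
    simp [ha]
  · intro a ha
    rw [PMF.uniformOfFinset_apply]
    simp [ha]

/-- The expectation of `f` at the result of `e`, where failure counts as `0`. -/
noncomputable def expect (e : OptionT PMF α) (f : α → ℝ≥0∞) : ℝ≥0∞ :=
  pexp (OptionT.run e) fun o => o.elim 0 f

theorem expect_pure (a : α) (f : α → ℝ≥0∞) : expect (pure a) f = f a := by
  simp only [expect, OptionT.run_pure]
  exact pexp_pure _ _

theorem expect_failure (f : α → ℝ≥0∞) : expect failure f = 0 := by
  simp only [expect, OptionT.run_failure]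
  exact pexp_pure _ _

theorem expect_bind (e : OptionT PMF α) (k : α → OptionT PMF β) (f : β → ℝ≥0∞) :
    expect (e >>= k) f = expect e fun a => expect (k a) f := by
  simp only [expect, OptionT.run_bind, Option.elimM]
  refine (pexp_bind _ _ _).trans ?_
  unfold pexp
  refine tsum_congr fun o => ?_
  cases o with
  | none =>
    simp only [Option.elim]
    congr 1
    exact pexp_pure _ _
  | some a => rfl

theorem expect_lift (μ : PMF α) (f : α → ℝ≥0∞) :
    expect (OptionT.lift μ) f = pexp μ f := by
  simp only [expect, OptionT.run_lift]
  refine (pexp_bind _ _ _).trans ?_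
  congr 1
  ext a
  exact pexp_pure _ _

theorem expect_map (e : OptionT PMF α) (g : α → β) (f : β → ℝ≥0∞) :
    expect (g <$> e) f = expect e fun a => f (g a) := by
  rw [← bind_pure_comp, expect_bind]
  simp [expect_pure]

theorem expect_mono {e : OptionT PMF α} {f g : α → ℝ≥0∞} (h : ∀ a, f a ≤ g a) :
    expect e f ≤ expect e g :=
  pexp_mono fun o => by cases o <;> simp [h]

theorem expect_add (e : OptionT PMF α) (f g : α → ℝ≥0∞) :
    expect e (fun a => f a + g a) = expect e f + expect e g := by
  unfold expect
  rw [← pexp_add]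
  congr 1
  ext o
  cases o <;> simp

theorem expect_const_mul (e : OptionT PMF α) (c : ℝ≥0∞) (f : α → ℝ≥0∞) :
    expect e (fun a => c * f a) = c * expect e f := by
  unfold expect
  rw [← pexp_const_mul]
  congr 1
  ext o
  cases o <;> simp

theorem expect_zero (e : OptionT PMF α) : expect e (fun _ => 0) = 0 := by
  simpa using expect_const_mul e 0 fun _ => 0

theorem expect_sum (e : OptionT PMF α) {ι : Type} (s : Finset ι) (f : ι → α → ℝ≥0∞) :
    expect e (fun a => ∑ i ∈ s, f i a) = ∑ i ∈ s, expect e (f i) := by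
  classical
  induction s using Finset.induction_on with
  | empty => simp [expect_zero]
  | insert i s hi ih => simp only [Finset.sum_insert hi, expect_add, ih]

theorem expect_le_const {e : OptionT PMF α} {f : α → ℝ≥0∞} {c : ℝ≥0∞} (h : ∀ a, f a ≤ c) :
    expect e f ≤ c := by
  refine le_trans (pexp_mono (g := fun _ => c) fun o => ?_) (pexp_const _ _).le
  cases o <;> simp [h]

theorem run_none_eq_zero {e : OptionT PMF α} (h : expect e (fun _ => 1) = 1) :
    (OptionT.run e) none = 0 := by
  classical
  have h1 := (OptionT.run e).tsum_coe
  have h2 : ∑' o, (OptionT.run e) o * (if o = none then 1 else 0 : ℝ≥0∞) +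
      expect e (fun _ => 1) = 1 := by
    unfold expect pexp
    rw [← ENNReal.tsum_add, ← h1]
    refine tsum_congr fun o => ?_
    cases o <;> simp
  rw [tsum_eq_single none (by intro o ho; simp [ho]), h] at h2
  simp only [if_true, mul_one] at h2
  have h3 : (OptionT.run e) none + 1 = 0 + 1 := by rw [h2, zero_add]
  exact (ENNReal.add_left_inj ENNReal.one_ne_top).1 h3

/-- The indicator of a proposition. -/
noncomputable def indic (P : Prop) : ℝ≥0∞ :=
  open Classical in if P then 1 else 0

theorem indic_le_one (P : Prop) : indic P ≤ 1 := by
  unfold indic; split <;> simp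

theorem indic_of {P : Prop} (h : P) : indic P = 1 := if_pos h

theorem indic_of_not {P : Prop} (h : ¬P) : indic P = 0 := if_neg h

theorem prob_eq (e : OptionT PMF Bool) :
    Platform.prob e = (expect e fun b => indic (b = true)).toReal := by
  unfold Platform.prob expect pexp
  congr 1
  rw [tsum_eq_single (some true)]
  · simp [indic]
  · intro o ho
    rcases o with _ | _ | _
    · simp
    · simp [indic]
    · simp at ho

end Expectation

/-! ## Execution of programs -/

section Execution

variable {p : ℕ} {G₁ G₂ : Type} [CommGroup G₁] [CommGroup G₂]

namespace Platform

variable (𝓟 : Platform p G₁ G₂)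

theorem expect_exec_skip (n : ℕ) (σ : Store p G₁ G₂) (F : ℕ × Store p G₁ G₂ → ℝ≥0∞) :
    expect (𝓟.exec .skip n σ) F = F (n, σ) := by
  rw [exec, expect_pure]

theorem expect_exec_op (i : Instr p G₁ G₂) (n : ℕ) (σ : Store p G₁ G₂)
    (F : ℕ × Store p G₁ G₂ → ℝ≥0∞) :
    expect (𝓟.exec (.op i) n σ) F =
      if 𝓟.cost i ≤ n then pexp (𝓟.effect σ i) fun τ => F (n - 𝓟.cost i, τ) else 0 := by
  rw [exec]
  split
  · rw [expect_bind, expect_lift]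
    simp only [expect_pure]
  · rw [expect_failure]

theorem expect_exec_seq (c d : Prog p G₁ G₂) (n : ℕ) (σ : Store p G₁ G₂)
    (F : ℕ × Store p G₁ G₂ → ℝ≥0∞) :
    expect (𝓟.exec (.seq c d) n σ) F =
      expect (𝓟.exec c n σ) fun r => expect (𝓟.exec d r.1 r.2) F := by
  rw [exec, expect_bind]

theorem expect_exec_ite (b : ℕ) (c d : Prog p G₁ G₂) (n : ℕ) (σ : Store p G₁ G₂)
    (F : ℕ × Store p G₁ G₂ → ℝ≥0∞) :
    expect (𝓟.exec (.ite b c d) (n + 1) σ) F =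
      if (σ.get .bit b : Bool) = true then expect (𝓟.exec c n σ) F
      else expect (𝓟.exec d n σ) F := by
  rw [exec]; split <;> rfl

theorem expect_iterate_succ (body : ℕ → Store p G₁ G₂ → OptionT PMF (ℕ × Store p G₁ G₂))
    (b f n : ℕ) (σ : Store p G₁ G₂) (F : ℕ × Store p G₁ G₂ → ℝ≥0∞) :
    expect (iterate body b (f + 1) (n + 1) σ) F =
      if (σ.get .bit b : Bool) = true then
        expect (body n σ) fun r => expect (iterate body b f r.1 r.2) F
      else F (n, σ) := by
  rw [iterate]
  split
  · rw [expect_bind]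
  · rw [expect_pure]

theorem expect_iterate_zero (body : ℕ → Store p G₁ G₂ → OptionT PMF (ℕ × Store p G₁ G₂))
    (b f : ℕ) (σ : Store p G₁ G₂) (F : ℕ × Store p G₁ G₂ → ℝ≥0∞) :
    expect (iterate body b f 0 σ) F = 0 := by
  cases f <;> rw [iterate, expect_failure] <;> simp

theorem expect_iterate_fuel_zero (body : ℕ → Store p G₁ G₂ → OptionT PMF (ℕ × Store p G₁ G₂))
    (b n : ℕ) (σ : Store p G₁ G₂) (F : ℕ × Store p G₁ G₂ → ℝ≥0∞) :
    expect (iterate body b 0 n σ) F = 0 := by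
  rw [iterate, expect_failure]; simp

theorem expect_run (t : ℕ) (c : Prog p G₁ G₂) (σ : Store p G₁ G₂)
    (F : Store p G₁ G₂ → ℝ≥0∞) :
    expect (𝓟.run t c σ) F =
      if c.size ≤ t then expect (𝓟.exec c (t - c.size) σ) fun r => F r.2 else 0 := by
  rw [run]
  split
  · rw [expect_map]
  · rw [expect_failure]

/-- A larger time budget does not decrease the probability of success. -/
theorem expect_exec_budget (c : Prog p G₁ G₂) (d : ℕ) :
    ∀ (n : ℕ) (σ : Store p G₁ G₂) (F F' : ℕ × Store p G₁ G₂ → ℝ≥0∞),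
      (∀ m τ, F (m, τ) ≤ F' (m + d, τ)) →
      expect (𝓟.exec c n σ) F ≤ expect (𝓟.exec c (n + d) σ) F' := by
  induction c with
  | skip => intro n σ F F' h; simpa only [expect_exec_skip] using h n σ
  | op i =>
    intro n σ F F' h
    simp only [expect_exec_op]
    split_ifs with h1 h2
    · refine pexp_mono fun τ => ?_
      have : n + d - 𝓟.cost i = n - 𝓟.cost i + d := by omega
      rw [this]
      exact h _ _
    · omega
    · exact zero_le
    · exact zero_le
  | seq c₁ c₂ h₁ h₂ =>
    intro n σ F F' h
    simp only [expect_exec_seq]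
    exact h₁ n σ _ _ fun m τ => h₂ m τ _ _ h
  | ite b c₁ c₂ h₁ h₂ =>
    intro n σ F F' h
    cases n with
    | zero => rw [exec, expect_failure]; exact zero_le
    | succ n =>
      rw [show n + 1 + d = n + d + 1 by omega]
      simp only [expect_exec_ite]
      split
      · exact h₁ n σ _ _ h
      · exact h₂ n σ _ _ h
  | loop b c hc =>
    intro n σ F F' h
    have key : ∀ f n σ, expect (iterate (𝓟.exec c) b f n σ) F ≤
        expect (iterate (𝓟.exec c) b (f + d) (n + d) σ) F' := by
      intro f
      induction f with
      | zero => intro n σ; rw [expect_iterate_fuel_zero]; exact zero_le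
      | succ f ih =>
        intro n σ
        cases n with
        | zero => rw [expect_iterate_zero]; exact zero_le
        | succ n =>
          rw [show n + 1 + d = n + d + 1 by omega, show f + 1 + d = f + d + 1 by omega]
          simp only [expect_iterate_succ]
          split
          · exact hc n σ _ _ fun m τ => ih m τ
          · exact h n σ
    simpa only [exec] using key n n σ

/-- Expected value after the execution of a program without loops, regardless of time. -/
noncomputable def wp : Prog p G₁ G₂ → Store p G₁ G₂ → (Store p G₁ G₂ → ℝ≥0∞) → ℝ≥0∞
  | .skip, σ, H => H σ
  | .op i, σ, H => pexp (𝓟.effect σ i) H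
  | .seq c d, σ, H => wp c σ fun τ => wp d τ H
  | .ite b c d, σ, H => open Classical in
    if (σ.get .bit b : Bool) = true then wp c σ H else wp d σ H
  | .loop _ _, _, _ => 0

/-- Upper bound for the running time of a program without loops. -/
def worstTime : Prog p G₁ G₂ → ℕ
  | .skip => 0
  | .op i => 𝓟.cost i
  | .seq c d => worstTime c + worstTime d
  | .ite _ c d => 1 + max (worstTime c) (worstTime d)
  | .loop _ c => worstTime c

/-- A program without loops. -/
def _root_.Prog.LoopFree : Prog p G₁ G₂ → Prop
  | .skip => True
  | .op _ => True
  | .seq c d => c.LoopFree ∧ d.LoopFree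
  | .ite _ c d => c.LoopFree ∧ d.LoopFree
  | .loop _ _ => False

theorem wp_le_expect (c : Prog p G₁ G₂) (hc : c.LoopFree) :
    ∀ (n : ℕ) (σ : Store p G₁ G₂) (F : ℕ × Store p G₁ G₂ → ℝ≥0∞) (H : Store p G₁ G₂ → ℝ≥0∞),
      𝓟.worstTime c ≤ n → (∀ m τ, n ≤ m + 𝓟.worstTime c → H τ ≤ F (m, τ)) →
      𝓟.wp c σ H ≤ expect (𝓟.exec c n σ) F := by
  induction c with
  | skip => intro n σ F H hn h; simpa only [expect_exec_skip, wp] using h n σ (by omega)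
  | op i =>
    intro n σ F H hn h
    simp only [worstTime] at hn h
    rw [expect_exec_op, if_pos hn, wp]
    exact pexp_mono fun τ => h _ τ (by omega)
  | seq c₁ c₂ h₁ h₂ =>
    intro n σ F H hn h
    simp only [worstTime] at hn h
    rw [expect_exec_seq, wp]
    exact h₁ hc.1 n σ _ _ (by omega) fun m τ hm =>
      h₂ hc.2 m τ _ _ (by omega) fun m' τ' hm' => h m' τ' (by omega)
  | ite b c₁ c₂ h₁ h₂ =>
    intro n σ F H hn h
    simp only [worstTime] at hn h
    obtain ⟨n, rfl⟩ : ∃ k, n = k + 1 := ⟨n - 1, by omega⟩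
    rw [expect_exec_ite, wp]
    split
    · exact h₁ hc.1 n σ _ _ (by omega) fun m τ hm => h m τ (by omega)
    · exact h₂ hc.2 n σ _ _ (by omega) fun m τ hm => h m τ (by omega)
  | loop b c ih => exact hc.elim

theorem expect_eq_wp (c : Prog p G₁ G₂) (hc : c.LoopFree) :
    ∀ (n : ℕ) (σ : Store p G₁ G₂) (F : ℕ × Store p G₁ G₂ → ℝ≥0∞) (H : Store p G₁ G₂ → ℝ≥0∞),
      𝓟.worstTime c ≤ n → (∀ m τ, n ≤ m + 𝓟.worstTime c → F (m, τ) = H τ) →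
      expect (𝓟.exec c n σ) F = 𝓟.wp c σ H := by
  induction c with
  | skip => intro n σ F H hn h; simpa only [expect_exec_skip, wp] using h n σ (by omega)
  | op i =>
    intro n σ F H hn h
    simp only [worstTime] at hn h
    rw [expect_exec_op, if_pos hn, wp]
    exact congrArg _ (funext fun τ => h _ τ (by omega))
  | seq c₁ c₂ h₁ h₂ =>
    intro n σ F H hn h
    simp only [worstTime] at hn h
    rw [expect_exec_seq, wp]
    exact h₁ hc.1 n σ _ _ (by omega) fun m τ hm =>
      h₂ hc.2 m τ _ _ (by omega) fun m' τ' hm' => h m' τ' (by omega)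
  | ite b c₁ c₂ h₁ h₂ =>
    intro n σ F H hn h
    simp only [worstTime] at hn h
    obtain ⟨n, rfl⟩ : ∃ k, n = k + 1 := ⟨n - 1, by omega⟩
    rw [expect_exec_ite, wp]
    split
    · exact h₁ hc.1 n σ _ _ (by omega) fun m τ hm => h m τ (by omega)
    · exact h₂ hc.2 n σ _ _ (by omega) fun m τ hm => h m τ (by omega)
  | loop b c ih => exact hc.elim

theorem wp_const (c : Prog p G₁ G₂) (hc : c.LoopFree) (a : ℝ≥0∞) :
    ∀ σ : Store p G₁ G₂, 𝓟.wp c σ (fun _ => a) = a := by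
  induction c with
  | skip => intro σ; rfl
  | op i => intro σ; exact pexp_const _ _
  | seq c₁ c₂ h₁ h₂ => intro σ; simp only [wp, h₂ hc.2, h₁ hc.1]
  | ite b c₁ c₂ h₁ h₂ => intro σ; simp only [wp, h₂ hc.2, h₁ hc.1, ite_self]
  | loop b c ih => exact hc.elim

theorem expect_run_eq_wp {c : Prog p G₁ G₂} (hc : c.LoopFree) {t : ℕ}
    (ht : c.size + 𝓟.worstTime c ≤ t) (σ : Store p G₁ G₂) (H : Store p G₁ G₂ → ℝ≥0∞) :
    expect (𝓟.run t c σ) H = 𝓟.wp c σ H := by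
  rw [expect_run, if_pos (by omega)]
  exact 𝓟.expect_eq_wp c hc _ σ _ _ (by omega) fun _ _ _ => rfl

theorem runsIn_of_loopFree {c : Prog p G₁ G₂} (hc : c.LoopFree) {t : ℕ}
    (ht : c.size + 𝓟.worstTime c ≤ t) : 𝓟.RunsIn c t := fun σ =>
  run_none_eq_zero (by rw [𝓟.expect_run_eq_wp hc ht, 𝓟.wp_const c hc])

end Platform

end Execution

/-! ## Memory -/

section Memory

variable {p : ℕ} {G₁ G₂ : Type} [CommGroup G₁] [CommGroup G₂]

namespace Store

theorem setTape_same (σ : Store p G₁ G₂) (k : Kind) (i : ℕ) (T : Turing.Tape (Symb p G₁ G₂ k)) :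
    σ.setTape k i T k i = T := by
  simp [setTape]

theorem setTape_ne (σ : Store p G₁ G₂) {k k' : Kind} {i i' : ℕ}
    (T : Turing.Tape (Symb p G₁ G₂ k)) (h : (k', i') ≠ (k, i)) :
    σ.setTape k i T k' i' = σ k' i' := by
  unfold setTape
  by_cases hk : k' = k
  · subst hk
    rw [Function.update_self, Function.update_of_ne (by rintro rfl; exact h rfl)]
  · rw [Function.update_of_ne hk]

theorem set_same (σ : Store p G₁ G₂) (k : Kind) (i : ℕ) (v : Symb p G₁ G₂ k) :
    σ.set k i v k i = (σ k i).write v :=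
  setTape_same _ _ _ _

theorem set_ne (σ : Store p G₁ G₂) {k k' : Kind} {i i' : ℕ} (v : Symb p G₁ G₂ k)
    (h : (k', i') ≠ (k, i)) : σ.set k i v k' i' = σ k' i' :=
  setTape_ne _ _ h

theorem get_set_same (σ : Store p G₁ G₂) (k : Kind) (i : ℕ) (v : Symb p G₁ G₂ k) :
    (σ.set k i v).get k i = v := by
  rw [get, set_same]; rfl

theorem get_set_ne (σ : Store p G₁ G₂) {k k' : Kind} {i i' : ℕ} (v : Symb p G₁ G₂ k)
    (h : (k', i') ≠ (k, i)) : (σ.set k i v).get k' i' = σ.get k' i' := by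
  rw [get, set_ne _ _ h]; rfl

theorem get_setTape_same (σ : Store p G₁ G₂) (k : Kind) (i : ℕ)
    (T : Turing.Tape (Symb p G₁ G₂ k)) : (σ.setTape k i T).get k i = T.head := by
  rw [get, setTape_same]

theorem get_setTape_ne (σ : Store p G₁ G₂) {k k' : Kind} {i i' : ℕ}
    (T : Turing.Tape (Symb p G₁ G₂ k)) (h : (k', i') ≠ (k, i)) :
    (σ.setTape k i T).get k' i' = σ.get k' i' := by
  rw [get, setTape_ne _ _ h]; rfl

theorem receive_cons (r : Kind × ℕ) (l : List (Kind × ℕ)) (σ τ : Store p G₁ G₂) :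
    receive (r :: l) σ τ = receive l σ (τ.set r.1 r.2 (σ.get r.1 r.2)) := rfl

theorem receive_nil (σ τ : Store p G₁ G₂) : receive [] σ τ = τ := rfl

end Store

end Memory

/-! ## Exponents modulo `p` -/

section Exponents

variable {p : ℕ} [Fact p.Prime] {G : Type} [CommGroup G]

/-- Exponentiation with exponents in `ℤ/p`. -/
def zp (g : G) (a : ZMod p) : G := g ^ a.val

theorem zp_add (hG : Nat.card G = p) (g : G) (a b : ZMod p) : zp g (a + b) = zp g a * zp g b := by
  subst hG
  rw [zp, zp, zp, ZMod.val_add, pow_mod_natCard, pow_add]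

theorem zp_mul (hG : Nat.card G = p) (g : G) (a b : ZMod p) : zp (zp g a) b = zp g (a * b) := by
  subst hG
  rw [zp, zp, zp, ZMod.val_mul, pow_mod_natCard, pow_mul]

theorem zp_zero (g : G) : zp g (0 : ZMod p) = 1 := by simp [zp]

theorem zp_one (g : G) : zp g (1 : ZMod p) = g := by
  have : Fact (1 < p) := ⟨(Fact.out : p.Prime).one_lt⟩
  rw [zp, ZMod.val_one, pow_one]

theorem isGenerator_iff (hG : Nat.card G = p) (g : G) : IsGenerator g ↔ g ≠ 1 := by
  constructor
  · rintro h rfl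
    have h1 : ∀ x : G, x = 1 := fun x => by simpa [Subgroup.zpowers_one_eq_bot] using h x
    have : Subsingleton G := ⟨fun x y => (h1 x).trans (h1 y).symm⟩
    rw [Nat.card_of_subsingleton (1 : G)] at hG
    exact (Fact.out : p.Prime).one_lt.ne hG
  · intro h x
    exact mem_zpowers_of_prime_card hG h

theorem zp_eq_zp_iff (hG : Nat.card G = p) {g : G} (hg : IsGenerator g) {a b : ZMod p} :
    zp g a = zp g b ↔ a = b := by
  refine ⟨fun h => ?_, fun h => by rw [h]⟩
  have ho : orderOf g = p := by rw [← hG]; exact orderOf_eq_card_of_forall_mem_zpowers hg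
  have hlt : ∀ c : ZMod p, c.val < orderOf g := fun c => ho ▸ ZMod.val_lt c
  exact ZMod.val_injective p (pow_injOn_Iio_orderOf (hlt a) (hlt b) h)

theorem exists_zp_eq (hG : Nat.card G = p) {g : G} (hg : IsGenerator g) (x : G) :
    ∃ a : ZMod p, zp g a = x := by
  have : Finite G := Nat.finite_of_card_ne_zero (by rw [hG]; exact (Fact.out : p.Prime).ne_zero)
  obtain ⟨n, rfl⟩ := (mem_powers_iff_mem_zpowers (x := g)).2 (hg x)
  refine ⟨(n : ZMod p), ?_⟩
  subst hG
  rw [zp, ZMod.val_natCast, pow_mod_natCard]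

theorem isGenerator_zp (hG : Nat.card G = p) {g : G} (hg : IsGenerator g) {a : ZMod p}
    (ha : a ≠ 0) : IsGenerator (zp g a) := by
  rw [isGenerator_iff hG, ← zp_zero (p := p) g, Ne, zp_eq_zp_iff hG hg]
  exact ha

variable {G₂ : Type} [CommGroup G₂]

theorem pairing_zp (hG₂ : Nat.card G₂ = p) (𝓟 : Platform p G G₂) (g : G) (a b : ZMod p) :
    𝓟.pairing (zp g a) (zp g b) = zp (𝓟.pairing g g) (a * b) := by
  have h := 𝓟.bilinear g g a.val b.val
  rw [← zp_mul hG₂, zp, zp, zp, zp, ← zpow_natCast g, ← zpow_natCast g, h, zpow_mul,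
    zpow_natCast, zpow_natCast]

theorem pairing_eq_iff (hG : Nat.card G = p) (hG₂ : Nat.card G₂ = p) (𝓟 : Platform p G G₂)
    {g : G} (hg : IsGenerator g) (s : G) (b : ZMod p) :
    𝓟.pairing s (zp g b) = 𝓟.pairing g g ↔ b ≠ 0 ∧ s = zp g b⁻¹ := by
  obtain ⟨a, rfl⟩ := exists_zp_eq hG hg s
  rw [pairing_zp hG₂, zp_eq_zp_iff hG hg]
  conv_lhs => rhs; rw [← zp_one (p := p) (𝓟.pairing g g)]
  rw [zp_eq_zp_iff hG₂ (𝓟.nondegenerate g hg)]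
  constructor
  · intro h
    have hb : b ≠ 0 := by rintro rfl; simp at h
    exact ⟨hb, eq_inv_of_mul_eq_one_left h⟩
  · rintro ⟨hb, rfl⟩
    exact inv_mul_cancel₀ hb

end Exponents

/-! ## The honest parties -/

section Honest

variable {p : ℕ} {G₁ G₂ : Type} [CommGroup G₁] [CommGroup G₂]

namespace Platform

variable (𝓟 : Platform p G₁ G₂)

theorem wp_ofList_cons (i : Instr p G₁ G₂) (l : List (Instr p G₁ G₂)) (σ : Store p G₁ G₂)
    (H : Store p G₁ G₂ → ℝ≥0∞) :
    𝓟.wp (Prog.ofList (i :: l)) σ H = pexp (𝓟.effect σ i) fun τ => 𝓟.wp (Prog.ofList l) τ H := rfl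

theorem wp_ofList_nil (σ : Store p G₁ G₂) (H : Store p G₁ G₂ → ℝ≥0∞) :
    𝓟.wp (Prog.ofList []) σ H = H σ := rfl

/-- The random choice of `r` by the honest prover. -/
noncomputable def respDist (x y m : ZMod p) (Φ : ZMod p → ℝ≥0∞) : ℝ≥0∞ :=
  open Classical in
  pexp (uniformOn {a : ZMod p | a ≠ 0} 0) fun r =>
    if x + (m + y * r) = 0 then pexp (uniformOn {a : ZMod p | a ≠ 0 ∧ a ≠ r} 0) Φ else Φ r

theorem wp_prover (σ : Store p G₁ G₂) (Φ : G₁ → ZMod p → ℝ≥0∞) (x y m : ZMod p) (g : G₁)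
    (hx : σ.get .scalar 0 = x) (hy : σ.get .scalar 1 = y) (hm : σ.get .scalar 2 = m)
    (hg : σ.get .src 0 = g) :
    𝓟.wp (sdhScheme p G₁ G₂).prover σ (fun τ => Φ (τ.get .src 3) (τ.get .scalar 3)) =
      respDist x y m fun r => Φ (g ^ ((x + (m + y * r))⁻¹).val) r := by
  simp only [sdhScheme, wp, wp_ofList_cons, wp_ofList_nil, effect, pexp_map, pexp_pure, respDist]
  congr 1
  ext r
  simp [Store.get_set_same, Store.get_set_ne, hx, hy, hm, hg]

theorem wp_verify [Fact p.Prime] (hG₁ : Nat.card G₁ = p) (hG₂ : Nat.card G₂ = p)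
    (σ : Store p G₁ G₂) (Φ : Bool → ℝ≥0∞) {g s : G₁} (hgen : IsGenerator g) (x y m r : ZMod p)
    (hg : σ.get .src 0 = g) (hu : σ.get .src 1 = zp g x) (hv : σ.get .src 2 = zp g y)
    (hz : σ.get .tgt 0 = 𝓟.pairing g g) (hm : σ.get .scalar 2 = m)
    (hs : σ.get .src 3 = s) (hr : σ.get .scalar 3 = r) :
    𝓟.wp (sdhScheme p G₁ G₂).verify σ (fun τ => Φ (τ.get .bit 0 : Bool)) =
      open Classical in
      Φ (decide (x + (m + y * r) ≠ 0 ∧ s = zp g (x + (m + y * r))⁻¹)) := by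
  simp only [sdhScheme, wp_ofList_cons, wp_ofList_nil, effect, pexp_pure]
  rw [Store.get_set_same]
  have key : 𝓟.pairing s (zp g x * zp g m * zp (zp g y) r) = 𝓟.pairing g g ↔
      x + (m + y * r) ≠ 0 ∧ s = zp g (x + (m + y * r))⁻¹ := by
    rw [zp_mul hG₁, ← zp_add hG₁, ← zp_add hG₁, pairing_eq_iff hG₁ hG₂ 𝓟 hgen, add_assoc]
  congr 1
  refine (decide_eq_decide).2 (Iff.trans ?_ key)
  simp [Store.get_set_ne, Store.get_set_same, hg, hu, hv, hz, hm, hs, hr, zp]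

/-- The public key on a blank memory. -/
def pubStore (g : G₁) (x y : ZMod p) : Store p G₁ G₂ :=
  (((Store.blank.set .src 0 g).set .src 1 (zp g x)).set .src 2 (zp g y)).set .tgt 0
    (𝓟.pairing g g)

/-- The memory `K` holds the keys that belong to the exponents `x` and `y`. -/
structure IsKey (g : G₁) (x y : ZMod p) (K : Store p G₁ G₂) : Prop where
  src0 : K.get .src 0 = g
  src1 : K.get .src 1 = zp g x
  src2 : K.get .src 2 = zp g y
  tgt0 : K.get .tgt 0 = 𝓟.pairing g g
  scalar0 : K.get .scalar 0 = x
  scalar1 : K.get .scalar 1 = y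

theorem receive_pub {g : G₁} {x y : ZMod p} {K : Store p G₁ G₂} (hK : 𝓟.IsKey g x y K)
    (β : Store p G₁ G₂) : Store.receive (sdhScheme p G₁ G₂).pub K β =
      (((β.set .src 0 g).set .src 1 (zp g x)).set .src 2 (zp g y)).set .tgt 0
        (𝓟.pairing g g) := by
  simp only [sdhScheme, Store.receive_cons, Store.receive_nil, hK.src0, hK.src1, hK.src2, hK.tgt0]

theorem publicStore_eq {g : G₁} {x y : ZMod p} {K : Store p G₁ G₂} (hK : 𝓟.IsKey g x y K) :
    (sdhScheme p G₁ G₂).publicStore K = 𝓟.pubStore g x y :=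
  𝓟.receive_pub hK _

theorem proverStore_eq {g : G₁} {x y : ZMod p} {K : Store p G₁ G₂} (hK : 𝓟.IsKey g x y K) :
    (sdhScheme p G₁ G₂).proverStore K =
      ((𝓟.pubStore g x y).set .scalar 0 x).set .scalar 1 y := by
  simp only [IdScheme.proverStore, sdhScheme, List.cons_append, List.nil_append,
    Store.receive_cons, Store.receive_nil, hK.src0, hK.src1, hK.src2, hK.tgt0, hK.scalar0,
    hK.scalar1, pubStore]

theorem wp_keygen (g : G₁) (H : Store p G₁ G₂ → ℝ≥0∞) (H' : ZMod p → ZMod p → ℝ≥0∞)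
    (h : ∀ x y K, 𝓟.IsKey g x y K → H K = H' x y) :
    𝓟.wp (sdhScheme p G₁ G₂).keygen (Store.blank.set .src 0 g) H =
      pexp (uniformOn {a : ZMod p | a ≠ 0} 0) fun x =>
        pexp (uniformOn {a : ZMod p | a ≠ 0} 0) fun y => H' x y := by
  simp only [sdhScheme, wp_ofList_cons, wp_ofList_nil, effect, pexp_map, pexp_pure]
  congr 1; ext x
  congr 1; ext y
  refine h x y _ ⟨?_, ?_, ?_, ?_, ?_, ?_⟩ <;>
    simp [Store.get_set_ne, Store.get_set_same, zp]

theorem expect_keygen (g : G₁) (H : Store p G₁ G₂ → ℝ≥0∞) (H' : ZMod p → ZMod p → ℝ≥0∞)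
    (h : ∀ x y K, 𝓟.IsKey g x y K → H K = H' x y) :
    expect (𝓟.run 𝓟.sdhKeygenTime (sdhScheme p G₁ G₂).keygen (Store.blank.set .src 0 g)) H =
      pexp (uniformOn {a : ZMod p | a ≠ 0} 0) fun x =>
        pexp (uniformOn {a : ZMod p | a ≠ 0} 0) fun y => H' x y := by
  rw [𝓟.expect_run_eq_wp, 𝓟.wp_keygen g H H' h]
  · simp [sdhScheme, Prog.ofList, Prog.LoopFree]
  · simp [sdhScheme, Prog.ofList, Prog.size, worstTime, cost, sdhKeygenTime]; omega

theorem prover_loopFree : (sdhScheme p G₁ G₂).prover.LoopFree := by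
  simp [sdhScheme, Prog.ofList, Prog.LoopFree]

theorem prover_time :
    (sdhScheme p G₁ G₂).prover.size + 𝓟.worstTime (sdhScheme p G₁ G₂).prover ≤
      𝓟.sdhProverTime := by
  simp [sdhScheme, Prog.ofList, Prog.size, worstTime, cost, sdhProverTime]; omega

theorem verify_loopFree : (sdhScheme p G₁ G₂).verify.LoopFree := by
  simp [sdhScheme, Prog.ofList, Prog.LoopFree]

theorem verify_time :
    (sdhScheme p G₁ G₂).verify.size + 𝓟.worstTime (sdhScheme p G₁ G₂).verify +
      (𝓟.scalarTime + 1) ≤ 𝓟.sdhVerifierTime := by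
  simp [sdhScheme, Prog.ofList, Prog.size, worstTime, cost, sdhVerifierTime]; omega

end Platform

end Honest

/-! ## Viability -/

section Viability

theorem pexp_uniformOn_eq_one {α : Type} {S : Set α} (d : α) (hS : S.Finite) (hne : S.Nonempty)
    {f : α → ℝ≥0∞} (hf : ∀ a ∈ S, f a = 1) : pexp (uniformOn S d) f = 1 := by
  classical
  rw [pexp_uniformOn d hS.toFinset (by simp) (by simpa using hne),
    Finset.sum_congr rfl (fun a ha => hf a (by simpa using ha))]
  simp only [Finset.sum_const, nsmul_eq_mul, mul_one]
  refine ENNReal.inv_mul_cancel ?_ (ENNReal.natCast_ne_top _)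
  simpa [Finset.card_eq_zero, Set.nonempty_iff_ne_empty] using hne.ne_empty

theorem add_mul_ne_zero_of_two :
    ∀ x y m r : ZMod 2, x ≠ 0 → y ≠ 0 → m ≠ 0 → r ≠ 0 → x + (m + y * r) ≠ 0 := by
  decide

variable {p : ℕ} [Fact p.Prime] {G₁ G₂ : Type} [CommGroup G₁] [CommGroup G₂]

theorem respDist_eq_one {x y m : ZMod p} (hx : x ≠ 0) (hy : y ≠ 0) (hm : m ≠ 0)
    {Φ : ZMod p → ℝ≥0∞} (hΦ : ∀ r, x + (m + y * r) ≠ 0 → Φ r = 1) :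
    Platform.respDist x y m Φ = 1 := by
  refine pexp_uniformOn_eq_one _ (Set.toFinite _) ⟨1, one_ne_zero⟩ fun r hr => ?_
  split
  · rename_i h0
    have hr0 : r ≠ 0 := hr
    have hne : {a : ZMod p | a ≠ 0 ∧ a ≠ r}.Nonempty := by
      refine ⟨-r, neg_ne_zero.2 hr0, fun h => ?_⟩
      have h2 : (2 : ZMod p) * r = 0 := by linear_combination -h
      have h2 : (2 : ZMod p) = 0 := (mul_eq_zero.1 h2).resolve_right hr0
      have hp : p = 2 := by
        have := (ZMod.natCast_eq_zero_iff 2 p).1 (by exact_mod_cast h2)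
        exact (Nat.prime_dvd_prime_iff_eq Fact.out Nat.prime_two).1 this
      subst hp
      exact add_mul_ne_zero_of_two x y m r hx hy hm hr0 h0
    refine pexp_uniformOn_eq_one _ (Set.toFinite _) hne fun r' hr' => hΦ r' fun h1 => hr'.2 ?_
    exact mul_left_cancel₀ hy (by linear_combination h1 - h0)
  · rename_i h0
    exact hΦ r h0

theorem generators_finite (hG₁ : Nat.card G₁ = p) : {g : G₁ | IsGenerator g}.Finite := by
  have : Finite G₁ := Nat.finite_of_card_ne_zero (by rw [hG₁]; exact (Fact.out : p.Prime).ne_zero)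
  exact Set.toFinite _

theorem generators_nonempty [IsCyclic G₁] : {g : G₁ | IsGenerator g}.Nonempty :=
  IsCyclic.exists_generator (α := G₁)

namespace Platform

variable (𝓟 : Platform p G₁ G₂)

theorem expect_challenge {t : ℕ} (ht : 𝓟.scalarTime + 1 ≤ t) (σ : Store p G₁ G₂)
    (H : Store p G₁ G₂ → ℝ≥0∞) :
    expect (𝓟.run t (sdhScheme p G₁ G₂).challenge σ) H =
      pexp (uniformOn {a : ZMod p | a ≠ 0} 0) fun m => H (σ.set .scalar 2 m) := by
  rw [𝓟.expect_run_eq_wp (by simp [sdhScheme, Prog.LoopFree])]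
  · exact pexp_map _ _ _
  · simp [sdhScheme, Prog.size, worstTime, cost]; omega

/-- The response `(s, r)` arrives at a party with memory `β`. -/
def answer (β : Store p G₁ G₂) (s : G₁) (r : ZMod p) : Store p G₁ G₂ :=
  (β.set .src 3 s).set .scalar 3 r

theorem expect_prover {t : ℕ} (ht : 𝓟.sdhProverTime ≤ t) {g : G₁} {x y : ZMod p}
    {K : Store p G₁ G₂} (hK : 𝓟.IsKey g x y K) (ν β : Store p G₁ G₂) {m : ZMod p}
    (hm : ν.get .scalar 2 = m) (H : Store p G₁ G₂ → ℝ≥0∞) :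
    expect (𝓟.run t (sdhScheme p G₁ G₂).prover (Store.receive (sdhScheme p G₁ G₂).chal ν
      ((sdhScheme p G₁ G₂).proverStore K)))
        (fun π => H (Store.receive (sdhScheme p G₁ G₂).resp π β)) =
      respDist x y m fun r => H (answer β (zp g (x + (m + y * r))⁻¹) r) := by
  rw [𝓟.expect_run_eq_wp prover_loopFree (𝓟.prover_time.trans ht)]
  refine 𝓟.wp_prover _ (fun s r => H (answer β s r)) x y m g ?_ ?_ ?_ ?_ <;>
  · rw [𝓟.proverStore_eq hK]
    simp [sdhScheme, Store.receive_cons, Store.receive_nil, Store.get_set_ne, Store.get_set_same,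
      pubStore, hm]

/-- The verifier accepts the response `(s, r)` to the challenge `m`. -/
def Accepts (g : G₁) (x y m : ZMod p) (s : G₁) (r : ZMod p) : Prop :=
  x + (m + y * r) ≠ 0 ∧ s = zp g (x + (m + y * r))⁻¹

theorem expect_verify (hG₁ : Nat.card G₁ = p) (hG₂ : Nat.card G₂ = p) {t : ℕ}
    (ht : 𝓟.sdhVerifierTime ≤ t) {g : G₁} (hg : IsGenerator g) {x y : ZMod p}
    (m : ZMod p) (π : Store p G₁ G₂) :
    expect (𝓟.run t (sdhScheme p G₁ G₂).verify (Store.receive (sdhScheme p G₁ G₂).resp π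
      ((𝓟.pubStore g x y).set .scalar 2 m))) (fun ν =>
        indic ((ν.get .bit (sdhScheme p G₁ G₂).out : Bool) = true)) =
      indic (Accepts g x y m (π.get .src 3) (π.get .scalar 3)) := by
  have ht' := 𝓟.verify_time
  rw [𝓟.expect_run_eq_wp verify_loopFree (by omega)]
  refine (𝓟.wp_verify hG₁ hG₂ _ (fun b => indic (b = true)) hg x y m (π.get .scalar 3)
    (s := π.get .src 3) ?_ ?_ ?_ ?_ ?_ ?_ ?_).trans ?_
  · simp [sdhScheme, Store.receive_cons, Store.receive_nil, Store.get_set_ne, Store.get_set_same,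
      pubStore]
  · simp [sdhScheme, Store.receive_cons, Store.receive_nil, Store.get_set_ne, Store.get_set_same,
      pubStore]
  · simp [sdhScheme, Store.receive_cons, Store.receive_nil, Store.get_set_ne, Store.get_set_same,
      pubStore]
  · simp [sdhScheme, Store.receive_cons, Store.receive_nil, Store.get_set_ne, Store.get_set_same,
      pubStore]
  · simp [sdhScheme, Store.receive_cons, Store.receive_nil, Store.get_set_ne, Store.get_set_same,
      pubStore]
  · simp [sdhScheme, Store.receive_cons, Store.receive_nil, Store.get_set_ne, Store.get_set_same,
      pubStore]
  · simp [sdhScheme, Store.receive_cons, Store.receive_nil, Store.get_set_same,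
      pubStore]
  · simp only [decide_eq_true_eq, Accepts]

theorem viability [IsCyclic G₁] (hG₁ : Nat.card G₁ = p) (hG₂ : Nat.card G₂ = p) {t : ℕ}
    (hP : 𝓟.sdhProverTime ≤ t) (hV : 𝓟.sdhVerifierTime ≤ t) :
    ∀ α ∈ (sdhScheme p G₁ G₂).params.support,
      prob ((sdhScheme p G₁ G₂).honest 𝓟 𝓟.sdhKeygenTime t α) = 1 := by
  intro α hα
  obtain ⟨g, hg, rfl⟩ : ∃ g : G₁, IsGenerator g ∧ Store.blank.set .src 0 g = α := by
    simp only [sdhScheme, PMF.mem_support_map_iff] at hα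
    obtain ⟨g, hg, rfl⟩ := hα
    refine ⟨g, ?_, rfl⟩
    have h : {g : G₁ | IsGenerator g}.Finite ∧ {g : G₁ | IsGenerator g}.Nonempty :=
      ⟨generators_finite hG₁, generators_nonempty⟩
    rw [randomGenerator, uniformOn, dif_pos h] at hg
    simpa using hg
  have hV' := 𝓟.verify_time
  rw [prob_eq]
  simp only [IdScheme.honest, expect_bind, expect_pure]
  rw [𝓟.expect_keygen g _ (fun x y => pexp (uniformOn {a : ZMod p | a ≠ 0} 0) fun m =>
    respDist x y m fun r => indic (Accepts g x y m (zp g (x + (m + y * r))⁻¹) r))]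
  · rw [pexp_uniformOn_eq_one, ENNReal.toReal_one]
    · exact Set.toFinite _
    · exact ⟨1, one_ne_zero⟩
    intro x hx
    refine pexp_uniformOn_eq_one _ (Set.toFinite _) ⟨1, one_ne_zero⟩ fun y hy => ?_
    refine pexp_uniformOn_eq_one _ (Set.toFinite _) ⟨1, one_ne_zero⟩ fun m hm => ?_
    exact respDist_eq_one hx hy hm fun r hr => indic_of ⟨hr, rfl⟩
  · intro x y K hK
    rw [𝓟.expect_challenge (by omega)]
    congr 1; ext m
    rw [𝓟.publicStore_eq hK]
    simp only [𝓟.expect_verify hG₁ hG₂ hV hg]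
    have h := 𝓟.expect_prover hP hK ((𝓟.pubStore g x y).set .scalar 2 m) Store.blank
      (Store.get_set_same _ _ _ _)
      (fun τ => indic (Accepts g x y m (τ.get .src 3) (τ.get .scalar 3)))
    simpa [sdhScheme, Store.receive_cons, Store.receive_nil, Store.get_set_ne, Store.get_set_same,
      answer] using h

end Platform

end Viability

/-! ## Attacks as games -/

section Games

variable {p : ℕ}

namespace Platform

theorem respDist_mono (x y m : ZMod p) {Φ Ψ : ZMod p → ℝ≥0∞} (h : ∀ r, Φ r ≤ Ψ r) :
    respDist x y m Φ ≤ respDist x y m Ψ :=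
  pexp_mono fun r => by
    split
    · exact pexp_mono h
    · exact h r

theorem respDist_const (x y m : ZMod p) (c : ℝ≥0∞) : respDist x y m (fun _ => c) = c := by
  simp only [respDist, pexp_const, ite_self]

theorem respDist_add (x y m : ZMod p) (Φ Ψ : ZMod p → ℝ≥0∞) :
    respDist x y m (fun r => Φ r + Ψ r) = respDist x y m Φ + respDist x y m Ψ := by
  unfold respDist
  rw [← pexp_add]
  congr 1; ext r
  split
  · exact pexp_add _ _ _
  · rfl

variable [Fact p.Prime] {G₁ G₂ : Type} [CommGroup G₁] [CommGroup G₂]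

/-- The responses `r` that the honest prover may give to the challenge `m`. -/
noncomputable def goodResp (x y m : ZMod p) : Finset (ZMod p) :=
  open Classical in Finset.univ.filter fun r => r ≠ 0 ∧ x + (m + y * r) ≠ 0

theorem mem_goodResp {x y m r : ZMod p} : r ∈ goodResp x y m ↔ r ≠ 0 ∧ x + (m + y * r) ≠ 0 := by
  simp [goodResp]

theorem card_units : (Finset.univ.filter fun a : ZMod p => a ≠ 0).card = p - 1 := by
  rw [Finset.filter_ne', Finset.card_erase_of_mem (Finset.mem_univ _), Finset.card_univ, ZMod.card]

theorem pexp_units (f : ZMod p → ℝ≥0∞) :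
    pexp (uniformOn {a : ZMod p | a ≠ 0} 0) f =
      ((p - 1 : ℕ) : ℝ≥0∞)⁻¹ * ∑ a ∈ Finset.univ.filter (fun a : ZMod p => a ≠ 0), f a := by
  rw [pexp_uniformOn (s := Finset.univ.filter (fun a : ZMod p => a ≠ 0)), card_units]
  · simp
  · exact ⟨1, by simp⟩

theorem respDist_le (hp : 3 ≤ p) {x y m : ZMod p} (hy : y ≠ 0) (Φ : ZMod p → ℝ≥0∞) :
    respDist x y m Φ ≤ ((p - 2 : ℕ) : ℝ≥0∞)⁻¹ * ∑ r ∈ goodResp x y m, Φ r := by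
  classical
  set T := ∑ r ∈ goodResp x y m, Φ r with hT
  have h2 : ((p - 2 : ℕ) : ℝ≥0∞) ≠ 0 := by
    simp only [ne_eq, Nat.cast_eq_zero]; omega
  have h1 : ((p - 1 : ℕ) : ℝ≥0∞) ≠ 0 := by
    simp only [ne_eq, Nat.cast_eq_zero]; omega
  have hfirst : (∑ r ∈ Finset.univ.filter (fun a : ZMod p => a ≠ 0),
      if x + (m + y * r) = 0 then pexp (uniformOn {a : ZMod p | a ≠ 0 ∧ a ≠ r} 0) Φ else Φ r) ≤
      T + ((p - 2 : ℕ) : ℝ≥0∞)⁻¹ * T := by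
    rw [← Finset.sum_filter_add_sum_filter_not _ (fun r => x + (m + y * r) = 0), add_comm]
    refine add_le_add ?_ ?_
    · rw [Finset.sum_congr rfl (g := Φ)]
      · rw [hT, goodResp, Finset.filter_filter]
      · intro r hr
        rw [if_neg (Finset.mem_filter.1 hr).2]
    · set r₀ : ZMod p := -(x + m) / y with hr₀
      have hz : ∀ r, x + (m + y * r) = 0 ↔ r = r₀ := by
        intro r
        rw [hr₀, eq_div_iff hy]
        constructor <;> intro h <;> linear_combination h
      have hsub : (Finset.univ.filter (fun a : ZMod p => a ≠ 0)).filter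
          (fun r => x + (m + y * r) = 0) ⊆ {r₀} := by
        intro r hr
        simpa using (hz r).1 (Finset.mem_filter.1 hr).2
      by_cases hr0 : r₀ = 0
      · rw [Finset.sum_eq_zero]
        · exact zero_le
        · intro r hr
          have h := Finset.mem_filter.1 hr
          have h' := (Finset.mem_filter.1 h.1).2
          exact absurd (((hz r).1 h.2).trans hr0) h'
      refine (Finset.sum_le_sum_of_subset hsub).trans ?_
      rw [Finset.sum_singleton, if_pos ((hz _).2 rfl),
        pexp_uniformOn (s := (Finset.univ.filter fun a : ZMod p => a ≠ 0).erase r₀)]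
      · rw [Finset.card_erase_of_mem (by simpa using hr0), card_units,
          show p - 1 - 1 = p - 2 by omega, hT]
        refine mul_le_mul_right (Finset.sum_le_sum_of_subset fun r hr => ?_) _
        simp only [Finset.mem_erase, Finset.mem_filter, Finset.mem_univ, true_and] at hr
        rw [mem_goodResp, Ne, Ne, hz]
        exact ⟨hr.2, hr.1⟩
      · intro a
        simp [and_comm]
      · rw [← Finset.card_pos, Finset.card_erase_of_mem (by simpa using hr0), card_units]
        omega
  rw [respDist, pexp_units]
  refine (mul_le_mul_right hfirst _).trans (le_of_eq ?_)
  have h3 : T + ((p - 2 : ℕ) : ℝ≥0∞)⁻¹ * T =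
      ((p - 1 : ℕ) : ℝ≥0∞) * (((p - 2 : ℕ) : ℝ≥0∞)⁻¹ * T) := by
    have h4 : ((p - 1 : ℕ) : ℝ≥0∞) = ((p - 2 : ℕ) : ℝ≥0∞) + 1 := by
      rw [show p - 1 = p - 2 + 1 by omega]; push_cast; rfl
    rw [h4, add_mul, one_mul, ← mul_assoc, ENNReal.mul_inv_cancel h2 (ENNReal.natCast_ne_top _),
      one_mul]
  rw [h3, ← mul_assoc, ENNReal.inv_mul_cancel h1 (ENNReal.natCast_ne_top _), one_mul]

variable (𝓟 : Platform p G₁ G₂)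

/-- The interaction of `B` with the honest prover; the history of challenges and responses is
recorded. -/
noncomputable def game (g : G₁) (x y : ZMod p) (B : Prog p G₁ G₂)
    (F : ℕ → Store p G₁ G₂ → List (ZMod p × ZMod p) → ℝ≥0∞) :
    ℕ → ℕ → Store p G₁ G₂ → List (ZMod p × ZMod p) → ℝ≥0∞
  | 0, n, β, h => expect (𝓟.exec B n β) fun e => F e.1 e.2 h
  | k + 1, n, β, h => expect (𝓟.exec B n β) fun e =>
      respDist x y (e.2.get .scalar 2) fun r =>
        game g x y B F k e.1 (answer e.2 (zp g (x + (e.2.get .scalar 2 + y * r))⁻¹) r)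
          ((e.2.get .scalar 2, r) :: h)

/-- The same interaction, with the sum over all good responses instead of the average. -/
noncomputable def gameSum (g : G₁) (x y : ZMod p) (B : Prog p G₁ G₂)
    (F : ℕ → Store p G₁ G₂ → List (ZMod p × ZMod p) → ℝ≥0∞) :
    ℕ → ℕ → Store p G₁ G₂ → List (ZMod p × ZMod p) → ℝ≥0∞
  | 0, n, β, h => expect (𝓟.exec B n β) fun e => F e.1 e.2 h
  | k + 1, n, β, h => expect (𝓟.exec B n β) fun e =>
      ∑ r ∈ goodResp x y (e.2.get .scalar 2),
        gameSum g x y B F k e.1 (answer e.2 (zp g (x + (e.2.get .scalar 2 + y * r))⁻¹) r)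
          ((e.2.get .scalar 2, r) :: h)

theorem expect_interact {t : ℕ} (ht : 𝓟.sdhProverTime ≤ t) {g : G₁} {x y : ZMod p}
    {K : Store p G₁ G₂} (hK : 𝓟.IsKey g x y K) (B : Prog p G₁ G₂)
    (F : ℕ × Store p G₁ G₂ → ℝ≥0∞) (k : ℕ) :
    ∀ (n : ℕ) (β : Store p G₁ G₂) (h : List (ZMod p × ZMod p)),
      expect ((sdhScheme p G₁ G₂).interact 𝓟 t B K k n β) F =
        𝓟.game g x y B (fun m τ _ => F (m, τ)) k n β h := by
  induction k with
  | zero => intro n β h; rfl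
  | succ k ih =>
    intro n β h
    rw [IdScheme.interact, game, expect_bind]
    congr 1; ext e
    rw [expect_bind]
    rw [𝓟.expect_prover ht hK e.2 e.2 rfl
      (fun τ => expect ((sdhScheme p G₁ G₂).interact 𝓟 t B K k e.1 τ) F)]
    congr 1; ext r
    exact ih _ _ _

theorem game_mono {g : G₁} {x y : ZMod p} {B : Prog p G₁ G₂}
    {F F' : ℕ → Store p G₁ G₂ → List (ZMod p × ZMod p) → ℝ≥0∞} (hF : ∀ m τ h, F m τ h ≤ F' m τ h)
    (k : ℕ) : ∀ n β h, 𝓟.game g x y B F k n β h ≤ 𝓟.game g x y B F' k n β h := by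
  induction k with
  | zero => intro n β h; exact expect_mono fun e => hF _ _ _
  | succ k ih => intro n β h; exact expect_mono fun e => respDist_mono _ _ _ fun r => ih _ _ _

theorem game_add (g : G₁) (x y : ZMod p) (B : Prog p G₁ G₂)
    (F F' : ℕ → Store p G₁ G₂ → List (ZMod p × ZMod p) → ℝ≥0∞) (k : ℕ) :
    ∀ n β h, 𝓟.game g x y B (fun m τ l => F m τ l + F' m τ l) k n β h =
      𝓟.game g x y B F k n β h + 𝓟.game g x y B F' k n β h := by
  induction k with
  | zero => intro n β h; exact expect_add _ _ _
  | succ k ih =>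
    intro n β h
    simp only [game, ih, respDist_add, expect_add]

theorem game_le_const {g : G₁} {x y : ZMod p} {B : Prog p G₁ G₂}
    {F : ℕ → Store p G₁ G₂ → List (ZMod p × ZMod p) → ℝ≥0∞} {c : ℝ≥0∞} (q : ℕ)
    (hF : ∀ m τ h, h.length = q → F m τ h ≤ c)
    (k : ℕ) : ∀ n β h, h.length + k = q → 𝓟.game g x y B F k n β h ≤ c := by
  induction k with
  | zero => intro n β h hl; exact expect_le_const fun e => hF _ _ _ (by omega)
  | succ k ih =>
    intro n β h hl
    refine expect_le_const fun e => ?_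
    refine le_trans (respDist_mono _ _ _ fun r => ih _ _ _ ?_) (respDist_const _ _ _ _).le
    simp only [List.length_cons]; omega

theorem game_le_gameSum {g : G₁} {x y : ZMod p} (hy : y ≠ 0) {B : Prog p G₁ G₂}
    (F : ℕ → Store p G₁ G₂ → List (ZMod p × ZMod p) → ℝ≥0∞)
    (k : ℕ) (hp : 0 < k → 3 ≤ p) : ∀ n β h, 𝓟.game g x y B F k n β h ≤
      (((p - 2 : ℕ) : ℝ≥0∞)⁻¹) ^ k * 𝓟.gameSum g x y B F k n β h := by
  induction k with
  | zero => intro n β h; simp [game, gameSum]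
  | succ k ih =>
    intro n β h
    rw [game, gameSum, ← expect_const_mul]
    refine expect_mono fun e => ?_
    refine (respDist_le (hp (by omega)) hy _).trans ?_
    rw [pow_succ', mul_assoc, Finset.mul_sum (a := _ ^ k)]
    exact mul_le_mul_right (Finset.sum_le_sum fun r _ => ih (fun _ => hp (by omega)) _ _ _) _

/-- The last phase of an attack: `A` is run on the memory `β` and a random challenge. -/
noncomputable def finish (g : G₁) (x y : ZMod p) (A : Prog p G₁ G₂)
    (W : List (ZMod p × ZMod p) → ZMod p → G₁ → ZMod p → Prop)
    (n : ℕ) (β : Store p G₁ G₂) (h : List (ZMod p × ZMod p)) : ℝ≥0∞ :=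
  pexp (uniformOn {a : ZMod p | a ≠ 0} 0) fun m =>
    expect (𝓟.exec A n (((((β.set .src 0 g).set .src 1 (zp g x)).set .src 2 (zp g y)).set .tgt 0
      (𝓟.pairing g g)).set .scalar 2 m)) fun e =>
        indic (W h m (e.2.get .src 3) (e.2.get .scalar 3))

theorem expect_attack (hG₁ : Nat.card G₁ = p) (hG₂ : Nat.card G₂ = p) [IsCyclic G₁] {t : ℕ} (q : ℕ)
    (hP : 𝓟.sdhProverTime ≤ t) (hV : 𝓟.sdhVerifierTime ≤ t) (A B : Prog p G₁ G₂) :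
    expect ((sdhScheme p G₁ G₂).attack 𝓟 𝓟.sdhKeygenTime t q A B) (fun b => indic (b = true)) =
      if A.size + B.size ≤ t then
        pexp (randomGenerator G₁) fun g => pexp (uniformOn {a : ZMod p | a ≠ 0} 0) fun x =>
          pexp (uniformOn {a : ZMod p | a ≠ 0} 0) fun y =>
            𝓟.game g x y B (𝓟.finish g x y A fun _ m s r => Accepts g x y m s r) q
              (t - (A.size + B.size)) (𝓟.pubStore g x y) []
      else 0 := by
  rw [IdScheme.attack]
  split_ifs with hs
  · simp only [expect_bind, expect_lift, expect_pure]
    refine (pexp_map _ _ _).trans ?_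
    have hS : {g : G₁ | IsGenerator g}.Finite ∧ {g : G₁ | IsGenerator g}.Nonempty :=
      ⟨generators_finite hG₁, generators_nonempty⟩
    unfold pexp
    refine tsum_congr fun g => ?_
    by_cases hg : IsGenerator g
    · congr 1
      refine 𝓟.expect_keygen g _ _ fun x y K hK => ?_
      rw [𝓟.expect_interact hP hK (h := []), 𝓟.publicStore_eq hK]
      congr 1
      ext m τ _
      have hV' := 𝓟.verify_time
      rw [𝓟.expect_challenge (by omega)]
      congr 1; ext c
      simp only [𝓟.expect_verify hG₁ hG₂ hV hg, 𝓟.receive_pub hK]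
      simp [sdhScheme, Store.receive_cons, Store.receive_nil, Store.get_set_same]
    · have : (randomGenerator G₁) g = 0 := by
        rw [randomGenerator, uniformOn, dif_pos hS, PMF.uniformOfFinset_apply]
        simp [hg]
      simp only [this, zero_mul]
  · exact expect_failure _

end Platform

end Games

/-! ## Guessing the responses in advance -/

section ListGames

variable {p : ℕ} [Fact p.Prime]

/-- Sum over all lists of length `k`. -/
noncomputable def sumList : ℕ → (List (ZMod p) → ℝ≥0∞) → ℝ≥0∞
  | 0, Φ => Φ []
  | k + 1, Φ => ∑ w : ZMod p, sumList k fun ws => Φ (w :: ws)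

theorem sumList_le (k : ℕ) : ∀ (Φ : List (ZMod p) → ℝ≥0∞) (c : ℝ≥0∞),
    (∀ ws, ws.length = k → Φ ws ≤ c) → sumList k Φ ≤ (p : ℝ≥0∞) ^ k * c := by
  induction k with
  | zero => intro Φ c h; simpa [sumList] using h [] rfl
  | succ k ih =>
    intro Φ c h
    refine (Finset.sum_le_sum fun w _ => ih (fun ws => Φ (w :: ws)) c fun ws hws =>
      h _ (by simp [hws])).trans ?_
    rw [Finset.sum_const, Finset.card_univ, ZMod.card, nsmul_eq_mul, pow_succ', mul_assoc]

theorem expect_sumList {α : Type} (e : OptionT PMF α) (k : ℕ) :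
    ∀ Φ : List (ZMod p) → α → ℝ≥0∞,
      expect e (fun a => sumList k fun ws => Φ ws a) = sumList k fun ws => expect e (Φ ws) := by
  induction k with
  | zero => intro Φ; rfl
  | succ k ih => intro Φ; simp only [sumList, expect_sum, ih]

theorem pexp_sumList {α : Type} (μ : PMF α) (k : ℕ) :
    ∀ Φ : List (ZMod p) → α → ℝ≥0∞,
      pexp μ (fun a => sumList k fun ws => Φ ws a) = sumList k fun ws => pexp μ (Φ ws) := by
  induction k with
  | zero => intro Φ; rfl
  | succ k ih => intro Φ; simp only [sumList, pexp_sum, ih]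

theorem sum_le_sum_of_leftInverse (s : Finset (ZMod p)) (V : ZMod p → Prop)
    (φ ρ : ZMod p → ZMod p) (h : ∀ r ∈ s, V (φ r) ∧ ρ (φ r) = r) (Ψ : ZMod p → ℝ≥0∞) :
    ∑ r ∈ s, Ψ r ≤ ∑ w, open Classical in if V w then Ψ (ρ w) else 0 := by
  classical
  have h1 : ∑ r ∈ s, Ψ r = ∑ w ∈ s.image φ, if V w then Ψ (ρ w) else 0 := by
    rw [Finset.sum_image]
    · exact Finset.sum_congr rfl fun r hr => by rw [if_pos (h r hr).1, (h r hr).2]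
    · intro a ha b hb hab
      rw [← (h a ha).2, ← (h b hb).2, hab]
  rw [h1]
  exact Finset.sum_le_sum_of_subset (Finset.subset_univ _)

variable {G₁ G₂ : Type} [CommGroup G₁] [CommGroup G₂]

namespace Platform

variable (𝓟 : Platform p G₁ G₂)

/-- The interaction of `B` with a prover whose response to the challenge `m` is `ρ m w`, where `w`
is taken from a list; `V` decides whether the interaction may go on. -/
noncomputable def gameList (g : G₁) (x y : ZMod p) (ρ : ZMod p → ZMod p → ZMod p)
    (V : ZMod p → ZMod p → Prop) (B : Prog p G₁ G₂)
    (F : ℕ → Store p G₁ G₂ → List (ZMod p × ZMod p) → ℝ≥0∞) :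
    List (ZMod p) → ℕ → Store p G₁ G₂ → List (ZMod p × ZMod p) → ℝ≥0∞
  | [], n, β, h => expect (𝓟.exec B n β) fun e => F e.1 e.2 h
  | w :: ws, n, β, h => expect (𝓟.exec B n β) fun e => open Classical in
      if V (e.2.get .scalar 2) w then
        gameList g x y ρ V B F ws e.1
          (answer e.2 (zp g (x + (e.2.get .scalar 2 + y * ρ (e.2.get .scalar 2) w))⁻¹)
            (ρ (e.2.get .scalar 2) w))
          ((e.2.get .scalar 2, ρ (e.2.get .scalar 2) w) :: h)
      else 0

theorem gameSum_eq_zero {g : G₁} {x y : ZMod p} {B : Prog p G₁ G₂}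
    {F : ℕ → Store p G₁ G₂ → List (ZMod p × ZMod p) → ℝ≥0∞} {bad : ZMod p → Prop}
    (hF : ∀ n β h, (∃ e ∈ h, bad e.1) → F n β h = 0) (k : ℕ) :
    ∀ n β h, (∃ e ∈ h, bad e.1) → 𝓟.gameSum g x y B F k n β h = 0 := by
  induction k with
  | zero =>
    intro n β h hh
    simp only [gameSum, hF _ _ h hh, expect_zero]
  | succ k ih =>
    intro n β h hh
    have : ∀ m r : ZMod p, ∃ e ∈ (m, r) :: h, bad e.1 := fun m r => by
      obtain ⟨e, he, hb⟩ := hh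
      exact ⟨e, List.mem_cons_of_mem _ he, hb⟩
    simp only [gameSum, ih _ _ _ (this _ _), Finset.sum_const_zero, expect_zero]

theorem gameList_eq_zero {g : G₁} {x y : ZMod p} {ρ : ZMod p → ZMod p → ZMod p}
    {V : ZMod p → ZMod p → Prop} {B : Prog p G₁ G₂}
    (F : ℕ → Store p G₁ G₂ → List (ZMod p × ZMod p) → ℝ≥0∞) {w : ZMod p} (hw : ∀ m, ¬V m w)
    (ws : List (ZMod p)) :
    ∀ n β h, w ∈ ws → 𝓟.gameList g x y ρ V B F ws n β h = 0 := by
  induction ws with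
  | nil => intro n β h hm; simp at hm
  | cons w' ws ih =>
    intro n β h hm
    rw [gameList]
    refine (congrArg _ (funext fun e => ?_)).trans (expect_zero (𝓟.exec B n β))
    rcases List.mem_cons.1 hm with rfl | hm
    · rw [if_neg (hw _)]
    · rw [ih _ _ _ hm, ite_self]

theorem gameSum_le_sumList {g : G₁} {x y : ZMod p} {ρ : ZMod p → ZMod p → ZMod p}
    {V : ZMod p → ZMod p → Prop} {B : Prog p G₁ G₂}
    {F : ℕ → Store p G₁ G₂ → List (ZMod p × ZMod p) → ℝ≥0∞} {bad : ZMod p → Prop}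
    (hF : ∀ n β h, (∃ e ∈ h, bad e.1) → F n β h = 0) (φ : ZMod p → ZMod p → ZMod p)
    (hφ : ∀ m r, ¬bad m → r ∈ goodResp x y m → V m (φ m r) ∧ ρ m (φ m r) = r) (k : ℕ) :
    ∀ n β h, 𝓟.gameSum g x y B F k n β h ≤
      sumList k fun ws => 𝓟.gameList g x y ρ V B F ws n β h := by
  classical
  induction k with
  | zero => intro n β h; exact le_rfl
  | succ k ih =>
    intro n β h
    simp only [sumList, gameList, gameSum]
    simp only [← expect_sumList, ← expect_sum]
    refine expect_mono fun e => ?_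
    by_cases hb : bad (e.2.get .scalar 2)
    · refine (Finset.sum_eq_zero fun r _ => ?_).trans_le zero_le
      exact 𝓟.gameSum_eq_zero hF k _ _ _ ⟨_, List.mem_cons_self, hb⟩
    refine (Finset.sum_le_sum fun r _ => ih _ _ _).trans ?_
    refine (sum_le_sum_of_leftInverse _ (V (e.2.get .scalar 2)) (φ (e.2.get .scalar 2))
      (ρ (e.2.get .scalar 2)) (fun r hr => hφ _ r hb hr) (fun r => sumList k fun ws =>
        𝓟.gameList g x y ρ V B F ws e.1
          (answer e.2 (zp g (x + (e.2.get .scalar 2 + y * r))⁻¹) r)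
          ((e.2.get .scalar 2, r) :: h))).trans (Finset.sum_le_sum fun w _ => ?_)
    split
    · exact le_rfl
    · exact zero_le

end Platform

end ListGames

/-! ## Programs use finitely many tapes -/

section Frame

variable {p : ℕ} {G₁ G₂ : Type}

/-- The tapes of an instruction. -/
def Instr.tapes : Instr p G₁ G₂ → List ℕ
  | .const _ d _ | .move _ d _ | .coin d | .rand d | .randUnit d => [d]
  | .copy _ d i | .encode _ d i | .decode _ d i | .neg d i | .inv d i | .randUnitNe d i => [d, i]
  | .eq _ d i j | .nand d i j | .add d i j | .mul d i j | .mul₁ d i j | .exp₁ d i j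
  | .mul₂ d i j | .exp₂ d i j | .pair d i j => [d, i, j]

/-- The program uses tapes with numbers below `N` only. -/
def Prog.Below (N : ℕ) : Prog p G₁ G₂ → Prop
  | .skip => True
  | .op i => ∀ a ∈ i.tapes, a < N
  | .seq c d => c.Below N ∧ d.Below N
  | .ite b c d => b < N ∧ c.Below N ∧ d.Below N
  | .loop b c => b < N ∧ c.Below N

theorem Prog.Below.mono {N N' : ℕ} (hN : N ≤ N') {c : Prog p G₁ G₂} (h : c.Below N) :
    c.Below N' := by
  induction c with
  | skip => trivial
  | op i => exact fun a ha => (h a ha).trans_le hN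
  | seq c d hc hd => exact ⟨hc h.1, hd h.2⟩
  | ite b c d hc hd => exact ⟨h.1.trans_le hN, hc h.2.1, hd h.2.2⟩
  | loop b c hc => exact ⟨h.1.trans_le hN, hc h.2⟩

theorem Prog.exists_below (c : Prog p G₁ G₂) : ∃ N, c.Below N := by
  induction c with
  | skip => exact ⟨0, trivial⟩
  | op i => exact ⟨i.tapes.sum + 1, fun a ha => Nat.lt_succ_of_le (List.le_sum_of_mem ha)⟩
  | seq c d hc hd =>
    obtain ⟨N, hN⟩ := hc
    obtain ⟨M, hM⟩ := hd
    exact ⟨N + M, hN.mono (by omega), hM.mono (by omega)⟩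
  | ite b c d hc hd =>
    obtain ⟨N, hN⟩ := hc
    obtain ⟨M, hM⟩ := hd
    exact ⟨N + M + b + 1, by omega, hN.mono (by omega), hM.mono (by omega)⟩
  | loop b c hc =>
    obtain ⟨N, hN⟩ := hc
    exact ⟨N + b + 1, by omega, hN.mono (by omega)⟩

variable [CommGroup G₁] [CommGroup G₂]

namespace Store

/-- The tapes of `σ` with numbers below `N`, and the other tapes of `ρ`. -/
def merge (N : ℕ) (σ ρ : Store p G₁ G₂) : Store p G₁ G₂ :=
  fun k i => if i < N then σ k i else ρ k i

theorem merge_of_lt {N i : ℕ} (σ ρ : Store p G₁ G₂) (k : Kind) (h : i < N) :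
    merge N σ ρ k i = σ k i := if_pos h

theorem merge_of_le {N i : ℕ} (σ ρ : Store p G₁ G₂) (k : Kind) (h : N ≤ i) :
    merge N σ ρ k i = ρ k i := if_neg (by omega)

theorem get_merge_of_lt {N i : ℕ} (σ ρ : Store p G₁ G₂) (k : Kind) (h : i < N) :
    (merge N σ ρ).get k i = σ.get k i := by
  rw [get, merge_of_lt _ _ _ h]; rfl

theorem merge_setTape {N i : ℕ} (σ ρ : Store p G₁ G₂) (k : Kind) (h : i < N)
    (T : Turing.Tape (Symb p G₁ G₂ k)) :
    (merge N σ ρ).setTape k i T = merge N (σ.setTape k i T) ρ := by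
  funext k' i'
  by_cases hki : (k', i') = (k, i)
  · obtain ⟨rfl, rfl⟩ := Prod.mk.inj hki
    rw [setTape_same, merge_of_lt _ _ _ h, setTape_same]
  · rw [setTape_ne _ _ hki]
    by_cases hi : i' < N
    · rw [merge_of_lt _ _ _ hi, merge_of_lt _ _ _ hi, setTape_ne _ _ hki]
    · rw [merge_of_le _ _ _ (by omega), merge_of_le _ _ _ (by omega)]

theorem merge_set {N i : ℕ} (σ ρ : Store p G₁ G₂) (k : Kind) (h : i < N)
    (v : Symb p G₁ G₂ k) : (merge N σ ρ).set k i v = merge N (σ.set k i v) ρ := by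
  rw [set, merge_setTape _ _ _ h, merge_of_lt _ _ _ h]; rfl

theorem merge_eq_self {N : ℕ} {σ ρ : Store p G₁ G₂} (h : ∀ k i, i < N → ρ k i = σ k i) :
    merge N σ ρ = ρ := by
  funext k i
  by_cases hi : i < N
  · rw [merge_of_lt _ _ _ hi, h k i hi]
  · rw [merge_of_le _ _ _ (by omega)]

end Store

namespace Platform

variable (𝓟 : Platform p G₁ G₂)

theorem pexp_effect_merge {N : ℕ} (i : Instr p G₁ G₂) (hi : ∀ a ∈ i.tapes, a < N)
    (σ ρ : Store p G₁ G₂) (H : Store p G₁ G₂ → ℝ≥0∞) :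
    pexp (𝓟.effect (Store.merge N σ ρ) i) H =
      pexp (𝓟.effect σ i) fun τ => H (Store.merge N τ ρ) := by
  cases i <;> simp only [Instr.tapes, List.mem_cons, List.not_mem_nil, or_false, forall_eq_or_imp,
      forall_eq] at hi <;>
    simp only [effect, pexp_pure, pexp_map, Store.merge_set, Store.merge_setTape,
      Store.get_merge_of_lt, Store.merge_of_lt, hi]
  · rw [Store.get_merge_of_lt _ _ _ hi.2.1, Store.get_merge_of_lt _ _ _ hi.2.2]
  · exact congrArg H (Store.merge_setTape _ _ _ hi.1 _)

theorem expect_exec_merge {N : ℕ} (c : Prog p G₁ G₂) (ρ : Store p G₁ G₂) :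
    ∀ (_ : c.Below N) (n : ℕ) (σ : Store p G₁ G₂) (F : ℕ × Store p G₁ G₂ → ℝ≥0∞),
      expect (𝓟.exec c n (Store.merge N σ ρ)) F =
        expect (𝓟.exec c n σ) fun e => F (e.1, Store.merge N e.2 ρ) := by
  induction c with
  | skip => intro hc n σ F; simp only [expect_exec_skip]
  | op i =>
    intro hc n σ F
    simp only [expect_exec_op]
    split
    · exact 𝓟.pexp_effect_merge i hc σ ρ _
    · rfl
  | seq c₁ c₂ h₁ h₂ =>
    intro hc n σ F
    simp only [expect_exec_seq, h₁ hc.1, h₂ hc.2]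
  | ite b c₁ c₂ h₁ h₂ =>
    intro hc n σ F
    cases n with
    | zero => simp only [exec, expect_failure]
    | succ n =>
      simp only [expect_exec_ite, Store.get_merge_of_lt _ _ _ hc.1, h₁ hc.2.1, h₂ hc.2.2]
  | loop b c ih =>
    intro hc n σ F
    have key : ∀ f n σ, expect (iterate (𝓟.exec c) b f n (Store.merge N σ ρ)) F =
        expect (iterate (𝓟.exec c) b f n σ) fun e => F (e.1, Store.merge N e.2 ρ) := by
      intro f
      induction f with
      | zero => intro n σ; simp only [expect_iterate_fuel_zero]
      | succ f ihf =>
        intro n σ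
        cases n with
        | zero => simp only [expect_iterate_zero]
        | succ n =>
          simp only [expect_iterate_succ, Store.get_merge_of_lt _ _ _ hc.1, ih hc.2, ihf]
    simpa only [exec] using key n n σ

/-- A program behaves in the same way on memories that agree on the tapes that it uses. -/
theorem expect_exec_le_of_agree {N : ℕ} {c : Prog p G₁ G₂} (hc : c.Below N) (d n : ℕ)
    {β σ : Store p G₁ G₂} (hσ : ∀ k i, i < N → σ k i = β k i)
    {F F' : ℕ × Store p G₁ G₂ → ℝ≥0∞}
    (hF : ∀ m β' σ', (∀ k i, i < N → σ' k i = β' k i) → (∀ k i, N ≤ i → σ' k i = σ k i) →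
      F (m, β') ≤ F' (m + d, σ')) :
    expect (𝓟.exec c n β) F ≤ expect (𝓟.exec c (n + d) σ) F' := by
  rw [← Store.merge_eq_self hσ, 𝓟.expect_exec_merge c σ hc]
  refine 𝓟.expect_exec_budget c d n β _ _ fun m τ => hF m τ _ ?_ ?_
  · exact fun k i hi => Store.merge_of_lt _ _ _ hi
  · exact fun k i hi => Store.merge_of_le _ _ _ hi

end Platform

end Frame

/-! ## Deterministic runs -/

section Leads

variable {p : ℕ} {G₁ G₂ : Type} [CommGroup G₁] [CommGroup G₂]

namespace Store

/-- The memories `σ` and `τ` agree except on the tapes in `S`. -/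
def SameExcept (S : List (Kind × ℕ)) (σ τ : Store p G₁ G₂) : Prop :=
  ∀ k i, (k, i) ∉ S → τ k i = σ k i

theorem SameExcept.get {S : List (Kind × ℕ)} {σ τ : Store p G₁ G₂} (h : SameExcept S σ τ)
    {k : Kind} {i : ℕ} (hi : (k, i) ∉ S) : τ.get k i = σ.get k i := by
  rw [Store.get, h k i hi]; rfl

theorem SameExcept.refl (S : List (Kind × ℕ)) (σ : Store p G₁ G₂) : SameExcept S σ σ :=
  fun _ _ _ => rfl

theorem SameExcept.trans {S : List (Kind × ℕ)} {σ τ ρ : Store p G₁ G₂} (h : SameExcept S σ τ)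
    (h' : SameExcept S τ ρ) : SameExcept S σ ρ :=
  fun k i hi => (h' k i hi).trans (h k i hi)

theorem SameExcept.mono {S S' : List (Kind × ℕ)} {σ τ : Store p G₁ G₂} (h : SameExcept S σ τ)
    (hS : ∀ e ∈ S, e ∈ S') : SameExcept S' σ τ :=
  fun k i hi => h k i fun hi' => hi (hS _ hi')

end Store

namespace Platform

variable (𝓟 : Platform p G₁ G₂)

/-- Executed on `σ`, the program `c` almost surely ends in a memory with the property `Q`. -/
def Leads (c : Prog p G₁ G₂) (σ : Store p G₁ G₂) (Q : Store p G₁ G₂ → Prop) : Prop :=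
  ∀ (H : Store p G₁ G₂ → ℝ≥0∞) (a : ℝ≥0∞), (∀ τ, Q τ → a ≤ H τ) → a ≤ 𝓟.wp c σ H

variable {𝓟}

theorem Leads.seq {c d : Prog p G₁ G₂} {σ : Store p G₁ G₂} {Q R : Store p G₁ G₂ → Prop}
    (hc : 𝓟.Leads c σ Q) (hd : ∀ τ, Q τ → 𝓟.Leads d τ R) : 𝓟.Leads (.seq c d) σ R :=
  fun _ _ h => hc _ _ fun τ hτ => hd τ hτ _ _ h

theorem Leads.mono {c : Prog p G₁ G₂} {σ : Store p G₁ G₂} {Q R : Store p G₁ G₂ → Prop}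
    (hc : 𝓟.Leads c σ Q) (h : ∀ τ, Q τ → R τ) : 𝓟.Leads c σ R :=
  fun _ _ hH => hc _ _ fun τ hτ => hH τ (h τ hτ)

theorem leads_skip {σ : Store p G₁ G₂} {Q : Store p G₁ G₂ → Prop} (h : Q σ) :
    𝓟.Leads .skip σ Q :=
  fun _ _ hH => hH σ h

theorem leads_nil {σ : Store p G₁ G₂} {Q : Store p G₁ G₂ → Prop} (h : Q σ) :
    𝓟.Leads (Prog.ofList []) σ Q :=
  leads_skip h

theorem leads_cons {i : Instr p G₁ G₂} {l : List (Instr p G₁ G₂)} {σ τ : Store p G₁ G₂}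
    {Q : Store p G₁ G₂ → Prop} (hi : 𝓟.effect σ i = PMF.pure τ)
    (h : 𝓟.Leads (Prog.ofList l) τ Q) : 𝓟.Leads (Prog.ofList (i :: l)) σ Q := fun H a hH => by
  rw [wp_ofList_cons, hi, pexp_pure]
  exact h H a hH

theorem wp_ofList_append (l l' : List (Instr p G₁ G₂)) (H : Store p G₁ G₂ → ℝ≥0∞) :
    ∀ σ : Store p G₁ G₂, 𝓟.wp (Prog.ofList (l ++ l')) σ H =
      𝓟.wp (Prog.ofList l) σ fun τ => 𝓟.wp (Prog.ofList l') τ H := by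
  induction l with
  | nil => intro σ; rfl
  | cons i l ih => intro σ; simp only [List.cons_append, wp_ofList_cons, ih]

theorem Leads.append {l l' : List (Instr p G₁ G₂)} {σ : Store p G₁ G₂}
    {Q R : Store p G₁ G₂ → Prop} (hc : 𝓟.Leads (Prog.ofList l) σ Q)
    (hd : ∀ τ, Q τ → 𝓟.Leads (Prog.ofList l') τ R) : 𝓟.Leads (Prog.ofList (l ++ l')) σ R :=
  fun H a h => by
    rw [wp_ofList_append]
    exact hc _ _ fun τ hτ => hd τ hτ _ _ h

theorem Leads.ite {b : ℕ} {c d : Prog p G₁ G₂} {σ : Store p G₁ G₂} {Q : Store p G₁ G₂ → Prop}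
    (hc : (σ.get .bit b : Bool) = true → 𝓟.Leads c σ Q)
    (hd : (σ.get .bit b : Bool) ≠ true → 𝓟.Leads d σ Q) : 𝓟.Leads (.ite b c d) σ Q :=
  fun H a h => by
    rw [wp]
    split
    · exact hc ‹_› H a h
    · exact hd ‹_› H a h

end Platform

end Leads

section Codes

variable {p : ℕ} [Fact p.Prime] {G₁ G₂ : Type} [CommGroup G₁] [CommGroup G₂]

/-- One step of the multiplication of powers. -/
def linStep (N k : ℕ) (c : ZMod p) : List (Instr p G₁ G₂) :=
  [.const .scalar N c, .exp₁ (N + 1) (N + 10 + k) N, .mul₁ N N (N + 1)]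

/-- Computation of `∏ (G k) ^ (c k)` for `k < n`, where `G k` is on tape `N + 10 + k`. -/
def linCode (N : ℕ) (c : ℕ → ZMod p) : ℕ → List (Instr p G₁ G₂)
  | 0 => [.const .src N (1 : G₁)]
  | n + 1 => linCode N c n ++ linStep N n (c n)

/-- The tapes `N + 10, …` hold the powers `g ^ (a ^ k)`, `k < n`. -/
def HoldsPowers (N n : ℕ) (g : G₁) (a : ZMod p) (σ : Store p G₁ G₂) : Prop :=
  ∀ k < n, σ.get .src (N + 10 + k) = zp g (a ^ k)

theorem HoldsPowers.of_same {N n : ℕ} {g : G₁} {a : ZMod p} {σ τ : Store p G₁ G₂}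
    {S : List (Kind × ℕ)} (h : HoldsPowers N n g a σ) (hS : Store.SameExcept S σ τ)
    (hN : ∀ e ∈ S, e.1 = .src → e.2 < N + 10) : HoldsPowers N n g a τ := by
  intro k hk
  rw [hS.get, h k hk]
  intro hm
  have := hN _ hm rfl
  simp at this

namespace Platform

variable {𝓟 : Platform p G₁ G₂}

theorem leads_linCode (hG₁ : Nat.card G₁ = p) {N n : ℕ} {g : G₁} {a : ZMod p}
    {σ : Store p G₁ G₂} (c : ℕ → ZMod p) (hσ : HoldsPowers N n g a σ) :
    𝓟.Leads (Prog.ofList (linCode N c n)) σ fun τ =>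
      Store.SameExcept [(.src, N), (.src, N + 1), (.scalar, N)] σ τ ∧
      τ.get .src N = zp g (∑ k ∈ Finset.range n, c k * a ^ k) := by
  induction n with
  | zero =>
    refine leads_cons rfl (leads_nil ⟨?_, ?_⟩)
    · intro k i hki
      simp only [List.mem_cons, not_or] at hki
      exact Store.set_ne _ _ hki.1
    · rw [Store.get_set_same]; simp [zp_zero]
  | succ n ih =>
    refine (ih fun k hk => hσ k (by omega)).append fun τ hτ => ?_
    refine leads_cons rfl (leads_cons rfl (leads_cons rfl (leads_nil ⟨hτ.1.trans ?_, ?_⟩)))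
    · intro k i hki
      simp only [List.mem_cons, not_or, List.not_mem_nil, not_false_eq_true, and_true] at hki
      rw [Store.set_ne _ _ hki.1, Store.set_ne _ _ hki.2.1, Store.set_ne _ _ hki.2.2]
    · have h1 : τ.get .src (N + 10 + n) = zp g (a ^ n) := by
        rw [hτ.1.get, hσ n (by omega)]
        simp; omega
      have h2 := hτ.2
      simp only [Store.get_set_same]
      rw [Finset.sum_range_succ, zp_add hG₁, mul_comm (c n), ← zp_mul hG₁, ← h1, ← h2]
      rw [Store.get_set_ne _ _ (by simp), Store.get_set_ne _ _ (by simp),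
        Store.get_set_ne _ _ (by simp)]
      rfl

end Platform

end Codes

/-! ## Tapes as lists -/

section Tapes

variable {Γ : Type} {_ : Inhabited Γ}

/-- The symbol at position `j` of a tape, relative to its head. -/
def cell (T : Turing.Tape Γ) (j : ℤ) : Γ := T.nth j

/-- The tape with a new symbol under its head. -/
def put (T : Turing.Tape Γ) (x : Γ) : Turing.Tape Γ := T.write x

/-- The tape with its head moved. -/
def shift (T : Turing.Tape Γ) (d : Turing.Dir) : Turing.Tape Γ := T.move d

theorem cell_zero (T : Turing.Tape Γ) : cell T 0 = T.head := T.nth_zero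

theorem cell_put (T : Turing.Tape Γ) (x : Γ) (j : ℤ) :
    cell (put T x) j = if j = 0 then x else cell T j := T.write_nth x

theorem cell_left (T : Turing.Tape Γ) (j : ℤ) : cell (shift T .left) j = cell T (j - 1) :=
  T.move_left_nth j

theorem cell_right (T : Turing.Tape Γ) (j : ℤ) : cell (shift T .right) j = cell T (j + 1) :=
  T.move_right_nth j

theorem cell_blank (j : ℤ) : cell (Turing.Tape.mk₁ [] : Turing.Tape Γ) j = default := by
  cases j with
  | ofNat n =>
    cases n <;> simp [cell, Turing.Tape.mk₁, Turing.Tape.mk₂, Turing.Tape.mk', Turing.Tape.nth]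
  | negSucc n =>
    simp [cell, Turing.Tape.mk₁, Turing.Tape.mk₂, Turing.Tape.mk', Turing.Tape.nth]

/-- From its head rightwards, the tape `T` holds the list `l`. -/
def HoldsRight (T : Turing.Tape Γ) (l : List Γ) : Prop :=
  ∀ (j : ℕ) (hj : j < l.length), cell T j = l[j]

/-- From the cell before its head leftwards, the tape `T` holds the list `l`. -/
def HoldsLeft (T : Turing.Tape Γ) (l : List Γ) : Prop :=
  ∀ (j : ℕ) (hj : j < l.length), cell T (-(j + 1 : ℤ)) = l[j]

theorem HoldsRight.nil (T : Turing.Tape Γ) : HoldsRight T [] := by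
  intro j hj; simp at hj

theorem HoldsLeft.nil (T : Turing.Tape Γ) : HoldsLeft T [] := by
  intro j hj; simp at hj

theorem HoldsRight.head {T : Turing.Tape Γ} {x : Γ} {l : List Γ} (h : HoldsRight T (x :: l)) :
    T.head = x := by
  have h0 : cell T ((0 : ℕ) : ℤ) = x := h 0 (by simp)
  simpa [cell_zero] using h0

theorem HoldsRight.move {T : Turing.Tape Γ} {x : Γ} {l : List Γ} (h : HoldsRight T (x :: l)) :
    HoldsRight (shift T .right) l := by
  intro j hj
  rw [cell_right]
  exact h (j + 1) (by simpa using hj)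

theorem HoldsRight.push {T : Turing.Tape Γ} {l : List Γ} (h : HoldsRight T l) (x : Γ) :
    HoldsRight (put (shift T .left) x) (x :: l) := by
  intro j hj
  rw [cell_put]
  cases j with
  | zero => simp
  | succ j =>
    rw [if_neg (by positivity), cell_left]
    simpa using h j (by simpa using hj)

theorem HoldsLeft.push {T : Turing.Tape Γ} {l : List Γ} (h : HoldsLeft T l) (x : Γ) :
    HoldsLeft (shift (put T x) .right) (x :: l) := by
  intro j hj
  rw [cell_right, cell_put]
  cases j with
  | zero => simp
  | succ j =>
    rw [if_neg (by push_cast; omega)]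
    have := h j (by simpa using hj)
    simpa using this

theorem HoldsLeft.head {T : Turing.Tape Γ} {x : Γ} {l : List Γ} (h : HoldsLeft T (x :: l)) :
    (shift T .left).head = x := by
  have h0 : cell T (-((0 : ℕ) + 1 : ℤ)) = x := h 0 (by simp)
  rw [← cell_zero, cell_left]
  simpa using h0

theorem HoldsLeft.move {T : Turing.Tape Γ} {x : Γ} {l : List Γ} (h : HoldsLeft T (x :: l)) :
    HoldsLeft (shift T .left) l := by
  intro j hj
  rw [cell_left]
  have := h (j + 1) (by simpa using hj)
  simp only [List.getElem_cons_succ] at this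
  rw [← this]
  congr 1

end Tapes

section Codes

variable {p : ℕ} [Fact p.Prime] {G₁ G₂ : Type} [CommGroup G₁] [CommGroup G₂]

/-- Horner's scheme: a step of the division by `X - w`, with `w` on tape `N + 9`. -/
def hornerStep (N k : ℕ) (c : ZMod p) : List (Instr p G₁ G₂) :=
  [.exp₁ (N + 1) (N + 10 + k) (N + 10), .mul₁ N N (N + 1), .mul (N + 10) (N + 9) (N + 10),
    .const .scalar N c, .add (N + 10) N (N + 10)]

/-- Horner's scheme for the polynomial with the coefficients `c k`, `k < n`. -/
def hornerCode (N : ℕ) (c : ℕ → ZMod p) : ℕ → List (Instr p G₁ G₂)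
  | 0 => []
  | n + 1 => hornerStep N n (c n) ++ hornerCode N c n

namespace Platform

variable {𝓟 : Platform p G₁ G₂}

theorem leads_hornerCode (hG₁ : Nat.card G₁ = p) {N : ℕ} {g : G₁} {a w : ZMod p}
    (c : ℕ → ZMod p) (n : ℕ) : ∀ {σ : Store p G₁ G₂} {d E : ZMod p},
    HoldsPowers N n g a σ → σ.get .scalar (N + 9) = w → σ.get .scalar (N + 10) = d →
    σ.get .src N = zp g E →
    𝓟.Leads (Prog.ofList (hornerCode N c n)) σ fun τ =>
      Store.SameExcept [(.src, N), (.src, N + 1), (.scalar, N), (.scalar, N + 10)] σ τ ∧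
      τ.get .scalar (N + 10) = d * w ^ n + ∑ k ∈ Finset.range n, c k * w ^ k ∧
      ∃ E', τ.get .src N = zp g E' ∧ (a - w) * E' +
        (d * w ^ n + ∑ k ∈ Finset.range n, c k * w ^ k) =
        (a - w) * E + (d * a ^ n + ∑ k ∈ Finset.range n, c k * a ^ k) := by
  induction n with
  | zero =>
    intro σ d E hσ hw hd hE
    refine leads_nil ⟨Store.SameExcept.refl _ _, ?_, E, hE, ?_⟩
    · simpa using hd
    · simp
  | succ n ih =>
    intro σ d E hσ hw hd hE
    have hstep : 𝓟.Leads (Prog.ofList (hornerStep N n (c n))) σ fun τ =>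
        Store.SameExcept [(.src, N), (.src, N + 1), (.scalar, N), (.scalar, N + 10)] σ τ ∧
        τ.get .scalar (N + 10) = c n + w * d ∧ τ.get .src N = zp g (E + a ^ n * d) := by
      refine leads_cons rfl (leads_cons rfl (leads_cons rfl (leads_cons rfl (leads_cons rfl
        (leads_nil ⟨?_, ?_, ?_⟩)))))
      · intro k i hki
        simp only [List.mem_cons, not_or, List.not_mem_nil, not_false_eq_true, and_true] at hki
        rw [Store.set_ne _ _ hki.2.2.2, Store.set_ne _ _ hki.2.2.1, Store.set_ne _ _ hki.2.2.2,
          Store.set_ne _ _ hki.1, Store.set_ne _ _ hki.2.1]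
      · simp only [Store.get_set_same]
        congr 1
        rw [Store.get_set_ne _ _ (by simp), Store.get_set_same]
        rw [Store.get_set_ne _ _ (by simp), Store.get_set_ne _ _ (by simp),
          Store.get_set_ne _ _ (by simp), Store.get_set_ne _ _ (by simp), hw, hd]
      · rw [Store.get_set_ne _ _ (by simp), Store.get_set_ne _ _ (by simp),
          Store.get_set_ne _ _ (by simp), Store.get_set_same, Store.get_set_same,
          Store.get_set_ne _ _ (by simp), hE, hσ n (by omega), hd, zp_add hG₁, ← zp_mul hG₁]
        rfl
    refine hstep.append fun τ hτ => ?_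
    refine (ih (d := c n + w * d) (E := E + a ^ n * d) ?_ ?_ hτ.2.1 hτ.2.2).mono fun ρ hρ => ?_
    · exact (HoldsPowers.of_same (fun k hk => hσ k (by omega)) hτ.1 (by simp))
    · rw [hτ.1.get (by simp), hw]
    · obtain ⟨h1, h2, E', h3, h4⟩ := hρ
      refine ⟨hτ.1.trans h1, ?_, E', h3, ?_⟩
      · rw [h2, Finset.sum_range_succ]; ring
      · rw [Finset.sum_range_succ, Finset.sum_range_succ]; linear_combination h4

end Platform

end Codes

/-! ## Initialization of the simulation -/

section Init

theorem not_mem_of_lt {S : List (Kind × ℕ)} {N i : ℕ} {k : Kind} (hS : ∀ e ∈ S, N ≤ e.2)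
    (hi : i < N) : (k, i) ∉ S :=
  fun h => absurd (hS _ h) (by simpa using hi)

variable {p : ℕ} [Fact p.Prime] {G₁ G₂ : Type} [CommGroup G₁] [CommGroup G₂]

/-- Computation of an entry of the queue of prepared responses. -/
def pushCode (N n : ℕ) (c : ℕ → ZMod p) (w : ZMod p) : List (Instr p G₁ G₂) :=
  linCode N c n ++
    [.move .src (N + 2) .left, .copy .src (N + 2) N, .move .scalar (N + 2) .left,
      .const .scalar (N + 2) w, .move .bit (N + 1) .left, .const .bit (N + 1) true]

/-- Computation of the queue of prepared responses. -/
def buildCode (N n : ℕ) (c : ZMod p → ℕ → ZMod p) : List (ZMod p) → List (Instr p G₁ G₂)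
  | [] => []
  | w :: ws => buildCode N n c ws ++ pushCode N n (c w) w

/-- The queue of prepared responses. -/
structure Queue (N : ℕ) (s : ZMod p → G₁) (ws : List (ZMod p)) (σ : Store p G₁ G₂) : Prop where
  src : HoldsRight (σ .src (N + 2)) (ws.map s)
  scalar : HoldsRight (σ .scalar (N + 2)) ws
  bit : ∀ j : ℕ, cell (σ .bit (N + 1)) j = decide (j < ws.length)

theorem Queue.of_same {N : ℕ} {s : ZMod p → G₁} {ws : List (ZMod p)} {σ τ : Store p G₁ G₂}
    {S : List (Kind × ℕ)} (h : Queue N s ws σ) (hS : Store.SameExcept S σ τ)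
    (h1 : (.src, N + 2) ∉ S) (h2 : (.scalar, N + 2) ∉ S) (h3 : (.bit, N + 1) ∉ S) :
    Queue N s ws τ := by
  refine ⟨?_, ?_, ?_⟩
  · rw [hS _ _ h1]; exact h.src
  · rw [hS _ _ h2]; exact h.scalar
  · rw [hS _ _ h3]; exact h.bit

/-- Copy the tapes `0, …, n - 1` to `N + 10, …`. -/
def copyCode (N : ℕ) : ℕ → List (Instr p G₁ G₂)
  | 0 => []
  | n + 1 => copyCode N n ++ [.copy .src (N + 10 + n) n]

/-- Clear the tapes `0, …, n - 1`. -/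
def clearCode : ℕ → List (Instr p G₁ G₂)
  | 0 => []
  | n + 1 => clearCode n ++ [.const .src n (1 : G₁)]

/-- Computation of the public key. -/
def pubCode (N n : ℕ) (c₀ c₁ c₂ : ℕ → ZMod p) : List (Instr p G₁ G₂) :=
  (linCode N c₀ n ++ [.copy .src (N + 3) N]) ++ ((linCode N c₁ n ++ [.copy .src (N + 4) N]) ++
    ((linCode N c₂ n ++ [.copy .src (N + 5) N]) ++
      [.pair N (N + 3) (N + 3), .const .bit N true, .copy .src 0 (N + 3), .copy .src 1 (N + 4),
        .copy .src 2 (N + 5), .copy .tgt 0 N]))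

theorem sdhInput_aux (g : G₁) (x : ZMod p) (n : ℕ) :
    (∀ i < n, (List.range n).foldl (fun σ i => σ.set .src i (g ^ (x ^ i).val))
      (Store.blank : Store p G₁ G₂) .src i =
        (Store.blank : Store p G₁ G₂).set .src i (zp g (x ^ i)) .src i) ∧
    ∀ k i, (k ≠ .src ∨ n ≤ i) → (List.range n).foldl (fun σ i => σ.set .src i (g ^ (x ^ i).val))
      (Store.blank : Store p G₁ G₂) k i = Store.blank k i := by
  induction n with
  | zero => exact ⟨fun i hi => absurd hi (by omega), fun k i _ => rfl⟩
  | succ n ih =>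
    simp only [List.range_succ, List.foldl_append, List.foldl_cons, List.foldl_nil]
    refine ⟨fun i hi => ?_, fun k i hki => ?_⟩
    · rcases Nat.lt_succ_iff_lt_or_eq.1 hi with hi | rfl
      · rw [Store.set_ne _ _ (by simp; omega), ih.1 i hi]
      · rw [Store.set_same, ih.2 _ _ (Or.inr le_rfl), Store.set_same]; rfl
    · rw [Store.set_ne, ih.2]
      · rcases hki with h | h
        · exact Or.inl h
        · right; omega
      · rintro h
        obtain ⟨rfl, rfl⟩ := Prod.mk.inj h
        rcases hki with h | h
        · exact h rfl
        · omega

namespace Platform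

variable {𝓟 : Platform p G₁ G₂}

theorem leads_pushCode (hG₁ : Nat.card G₁ = p) {N n : ℕ} {g : G₁} {a : ZMod p}
    {σ : Store p G₁ G₂} (c : ZMod p → ℕ → ZMod p) {w : ZMod p} {ws : List (ZMod p)}
    (hσ : HoldsPowers N n g a σ)
    (hq : Queue N (fun w => zp g (∑ k ∈ Finset.range n, c w k * a ^ k)) ws σ) :
    𝓟.Leads (Prog.ofList (pushCode N n (c w) w)) σ fun τ =>
      Store.SameExcept [(.src, N), (.src, N + 1), (.src, N + 2), (.scalar, N), (.scalar, N + 2),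
        (.bit, N + 1)] σ τ ∧
      Queue N (fun w => zp g (∑ k ∈ Finset.range n, c w k * a ^ k)) (w :: ws) τ := by
  refine (leads_linCode hG₁ (c w) hσ).append fun τ hτ => ?_
  have hq := hq.of_same hτ.1 (by simp) (by simp) (by simp)
  refine leads_cons rfl (leads_cons rfl (leads_cons rfl (leads_cons rfl (leads_cons rfl
    (leads_cons rfl (leads_nil ⟨(hτ.1.mono ?_).trans ?_, ?_, ?_, ?_⟩))))))
  · simp
  · intro k i hki
    simp only [List.mem_cons, not_or, List.not_mem_nil, not_false_eq_true, and_true] at hki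
    obtain ⟨h1, h2, h3, h4, h5, h6⟩ := hki
    rw [Store.set_ne _ _ h6, Store.setTape_ne _ _ h6, Store.set_ne _ _ h5, Store.setTape_ne _ _ h5,
      Store.set_ne _ _ h3, Store.setTape_ne _ _ h3]
  · rw [Store.set_ne _ _ (by simp), Store.setTape_ne _ _ (by simp), Store.set_ne _ _ (by simp),
      Store.setTape_ne _ _ (by simp), Store.set_same, Store.setTape_same,
      Store.get_setTape_ne _ _ (by simp), hτ.2]
    exact hq.src.push _
  · rw [Store.set_ne _ _ (by simp), Store.setTape_ne _ _ (by simp), Store.set_same,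
      Store.setTape_same, Store.set_ne _ _ (by simp), Store.setTape_ne _ _ (by simp)]
    exact hq.scalar.push _
  · intro j
    rw [Store.set_same, Store.setTape_same, Store.set_ne _ _ (by simp),
      Store.setTape_ne _ _ (by simp), Store.set_ne _ _ (by simp), Store.setTape_ne _ _ (by simp)]
    refine (cell_put _ _ _).trans ?_
    cases j with
    | zero => simp
    | succ j =>
      rw [if_neg (by positivity)]
      refine (cell_left _ _).trans ?_
      have := hq.bit j
      simpa using this

theorem leads_buildCode (hG₁ : Nat.card G₁ = p) {N n : ℕ} {g : G₁} {a : ZMod p}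
    {σ : Store p G₁ G₂} (c : ZMod p → ℕ → ZMod p) (ws : List (ZMod p))
    (hσ : HoldsPowers N n g a σ) (hb : ∀ j : ℕ, cell (σ .bit (N + 1)) j = false) :
    𝓟.Leads (Prog.ofList (buildCode N n c ws)) σ fun τ =>
      Store.SameExcept [(.src, N), (.src, N + 1), (.src, N + 2), (.scalar, N), (.scalar, N + 2),
        (.bit, N + 1)] σ τ ∧
      Queue N (fun w => zp g (∑ k ∈ Finset.range n, c w k * a ^ k)) ws τ := by
  induction ws with
  | nil =>
    refine leads_nil ⟨Store.SameExcept.refl _ _, HoldsRight.nil _, HoldsRight.nil _, fun j => ?_⟩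
    rw [hb]; simp
  | cons w ws ih =>
    refine ih.append fun τ hτ => ?_
    refine (leads_pushCode hG₁ c (hσ.of_same hτ.1 (by simp)) hτ.2).mono fun ρ hρ => ?_
    exact ⟨hτ.1.trans hρ.1, hρ.2⟩

theorem leads_copyCode {N n : ℕ} {g : G₁} {a : ZMod p} {σ : Store p G₁ G₂} (hn : n ≤ N)
    (hσ : ∀ k < n, σ.get .src k = zp g (a ^ k)) :
    𝓟.Leads (Prog.ofList (copyCode N n)) σ fun τ =>
      (∀ k i, (k ≠ .src ∨ i < N + 10) → τ k i = σ k i) ∧ HoldsPowers N n g a τ := by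
  induction n with
  | zero => exact leads_nil ⟨fun _ _ _ => rfl, fun k hk => absurd hk (by omega)⟩
  | succ n ih =>
    refine (ih (by omega) fun k hk => hσ k (by omega)).append fun τ hτ => ?_
    refine leads_cons rfl (leads_nil ⟨fun k i hki => ?_, fun k hk => ?_⟩)
    · rw [Store.set_ne, hτ.1 k i hki]
      rintro h
      obtain ⟨rfl, rfl⟩ := Prod.mk.inj h
      rcases hki with h | h
      · exact h rfl
      · omega
    · rcases Nat.lt_succ_iff_lt_or_eq.1 hk with hk | rfl
      · rw [Store.get_set_ne _ _ (by simp; omega), hτ.2 k hk]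
      · rw [Store.get_set_same, Store.get, hτ.1 _ _ (Or.inr (by omega))]
        exact hσ k (by omega)

theorem leads_clearCode {n : ℕ} {σ : Store p G₁ G₂} :
    𝓟.Leads (Prog.ofList (clearCode n)) σ fun τ =>
      (∀ k i, (k ≠ .src ∨ n ≤ i) → τ k i = σ k i) ∧
      ∀ i < n, τ .src i = σ.set .src i (1 : G₁) .src i := by
  induction n with
  | zero => exact leads_nil ⟨fun _ _ _ => rfl, fun k hk => absurd hk (by omega)⟩
  | succ n ih =>
    refine ih.append fun τ hτ => ?_
    refine leads_cons rfl (leads_nil ⟨fun k i hki => ?_, fun i hi => ?_⟩)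
    · rw [Store.set_ne, hτ.1 k i]
      · rcases hki with h | h
        · exact Or.inl h
        · right; omega
      rintro h
      obtain ⟨rfl, rfl⟩ := Prod.mk.inj h
      rcases hki with h | h
      · exact h rfl
      · omega
    · rcases Nat.lt_succ_iff_lt_or_eq.1 hi with hi | rfl
      · rw [Store.set_ne _ _ (by simp; omega), hτ.2 i hi]
      · rw [Store.set_same, hτ.1 _ _ (Or.inr le_rfl), Store.set_same]

theorem leads_linCode_copy (hG₁ : Nat.card G₁ = p) {N n : ℕ} {g : G₁} {a : ZMod p}
    {σ : Store p G₁ G₂} (c : ℕ → ZMod p) (d : ℕ) (hσ : HoldsPowers N n g a σ) :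
    𝓟.Leads (Prog.ofList (linCode N c n ++ [.copy .src d N])) σ fun τ =>
      Store.SameExcept [(.src, N), (.src, N + 1), (.src, d), (.scalar, N)] σ τ ∧
      τ.get .src d = zp g (∑ k ∈ Finset.range n, c k * a ^ k) := by
  refine (leads_linCode hG₁ c hσ).append fun τ hτ => leads_cons rfl (leads_nil ⟨?_, ?_⟩)
  · refine (hτ.1.mono (by simp)).trans fun k i hki => ?_
    simp only [List.mem_cons, not_or, List.not_mem_nil, not_false_eq_true, and_true] at hki
    rw [Store.set_ne _ _ hki.2.2.1]
  · rw [Store.get_set_same, hτ.2]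

/-- The memory `σ` of the simulator, after the history `h`, with the memory `β` of the attacker
and a queue for the list `ws`. -/
structure SimInv (𝓟 : Platform p G₁ G₂) (N n : ℕ) (g₀ : G₁) (a : ZMod p) (g : G₁) (x y : ZMod p)
    (s : ZMod p → G₁) (ws : List (ZMod p)) (h : List (ZMod p × ZMod p)) (β σ : Store p G₁ G₂) :
    Prop where
  agree : ∀ k i, i < N → σ k i = β k i
  powers : HoldsPowers N n g₀ a σ
  src3 : σ.get .src (N + 3) = g
  src4 : σ.get .src (N + 4) = zp g x
  src5 : σ.get .src (N + 5) = zp g y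
  tgt0 : σ.get .tgt N = 𝓟.pairing g g
  queue : Queue N s ws σ
  left3 : HoldsLeft (σ .scalar (N + 3)) (h.map Prod.fst)
  left4 : HoldsLeft (σ .scalar (N + 4)) (h.map Prod.snd)

theorem leads_pubCode (hG₁ : Nat.card G₁ = p) {N n : ℕ} (hN : 6 ≤ N) {g₀ g : G₁} {a x y : ZMod p}
    {σ : Store p G₁ G₂} (c₀ c₁ c₂ : ℕ → ZMod p) (hσ : HoldsPowers N n g₀ a σ)
    (h₀ : zp g₀ (∑ k ∈ Finset.range n, c₀ k * a ^ k) = g)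
    (h₁ : zp g₀ (∑ k ∈ Finset.range n, c₁ k * a ^ k) = zp g x)
    (h₂ : zp g₀ (∑ k ∈ Finset.range n, c₂ k * a ^ k) = zp g y)
    (hblank : ∀ k i, (k ≠ .src ∨ i < N) → σ k i = Store.blank k i) :
    𝓟.Leads (Prog.ofList (pubCode N n c₀ c₁ c₂)) σ fun τ =>
      (∀ k i, i < N → τ k i = 𝓟.pubStore g x y k i) ∧ HoldsPowers N n g₀ a τ ∧
      τ.get .src (N + 3) = g ∧ τ.get .src (N + 4) = zp g x ∧ τ.get .src (N + 5) = zp g y ∧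
      τ.get .tgt N = 𝓟.pairing g g ∧ τ.get .bit N = true ∧
      ∀ j : ℕ, cell (τ .bit (N + 1)) j = false := by
  refine (leads_linCode_copy hG₁ c₀ _ hσ).append fun τ₁ h1 => ?_
  have hσ := hσ.of_same h1.1 (by simp)
  refine (leads_linCode_copy hG₁ c₁ _ hσ).append fun τ₂ h2 => ?_
  have hσ := hσ.of_same h2.1 (by simp)
  refine (leads_linCode_copy hG₁ c₂ _ hσ).append fun τ h3 => ?_
  have hσ := hσ.of_same h3.1 (by simp)
  have e3 : τ.get .src (N + 3) = g := by
    rw [h3.1.get (by simp), h2.1.get (by simp), h1.2, h₀]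
  have e4 : τ.get .src (N + 4) = zp g x := by
    rw [h3.1.get (by simp), h2.2, h₁]
  have e5 : τ.get .src (N + 5) = zp g y := by
    rw [h3.2, h₂]
  have hsame := ((h1.1.mono (S' := [(.src, N), (.src, N + 1), (.src, N + 3), (.src, N + 4),
    (.src, N + 5), (.scalar, N)]) (by simp)).trans (h2.1.mono (by simp))).trans
      (h3.1.mono (by simp))
  have hlow : ∀ k i, i < N → τ k i = Store.blank k i := fun k i hi => by
    rw [hsame k i (not_mem_of_lt (by simp) hi), hblank k i (Or.inr hi)]
  have hbit : τ .bit (N + 1) = Store.blank .bit (N + 1) := by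
    rw [hsame _ _ (by simp), hblank _ _ (Or.inl (by simp))]
  have i0 : N ≠ 0 := by omega
  have i1 : N ≠ 1 := by omega
  have i2 : N ≠ 2 := by omega
  refine leads_cons rfl (leads_cons rfl (leads_cons rfl (leads_cons rfl (leads_cons rfl
    (leads_cons rfl (leads_nil ⟨?_, ?_, ?_, ?_, ?_, ?_, ?_, ?_⟩))))))
  · intro k i hi
    have hne : i ≠ N := by omega
    have key : ∀ (k' : Kind) (v v' : Symb p G₁ G₂ k') (d : ℕ) (ρ ρ' : Store p G₁ G₂),
        v = v' → (∀ k i, i < N → ρ k i = ρ' k i) →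
        ∀ k i, i < N → ρ.set k' d v k i = ρ'.set k' d v' k i := by
      rintro k' v _ d ρ ρ' rfl h k i hi
      by_cases hkd : (k, i) = (k', d)
      · obtain ⟨rfl, rfl⟩ := Prod.mk.inj hkd
        rw [Store.set_same, Store.set_same, h _ _ hi]
      · rw [Store.set_ne _ _ hkd, Store.set_ne _ _ hkd, h _ _ hi]
    refine key _ _ _ _ _ _ ?_ (key _ _ _ _ _ _ ?_ (key _ _ _ _ _ _ ?_ (key _ _ _ _ _ _ ?_ ?_)))
      k i hi
    · simp [Store.get_set_ne, Store.get_set_same, e3]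
    · simp [Store.get_set_ne, e5]
    · simp [Store.get_set_ne, e4]
    · simp [Store.get_set_ne, e3]
    · intro k i hi
      rw [Store.set_ne _ _ (by simp; omega), Store.set_ne _ _ (by simp; omega), hlow k i hi]
  · intro k hk
    rw [← hσ k hk]
    rw [Store.get_set_ne _ _ (by simp), Store.get_set_ne _ _ (by simp; omega),
      Store.get_set_ne _ _ (by simp; omega), Store.get_set_ne _ _ (by simp),
      Store.get_set_ne _ _ (by simp), Store.get_set_ne _ _ (by simp)]
  · simp [Store.get_set_ne, e3]
  · simp [Store.get_set_ne, e4]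
  · simp [Store.get_set_ne, e5]
  · simp [Store.get_set_ne, Store.get_set_same, e3, i0]
  · simp [Store.get_set_ne, Store.get_set_same]
  · intro j
    rw [Store.set_ne _ _ (by simp), Store.set_ne _ _ (by simp), Store.set_ne _ _ (by simp),
      Store.set_ne _ _ (by simp), Store.set_ne _ _ (by simp), Store.set_ne _ _ (by simp), hbit]
    exact cell_blank _

/-- The first phase of the simulation. -/
def initCode (N n : ℕ) (c₀ c₁ c₂ : ℕ → ZMod p) (c : ZMod p → ℕ → ZMod p) (ws : List (ZMod p)) :
    List (Instr p G₁ G₂) :=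
  copyCode N n ++ (clearCode n ++ (pubCode N n c₀ c₁ c₂ ++ buildCode N n c ws))

theorem leads_initCode (hG₁ : Nat.card G₁ = p) {N q : ℕ} (hN : 6 ≤ N) (hq : q + 1 ≤ N)
    {g₀ g : G₁} {a x y : ZMod p} (c₀ c₁ c₂ : ℕ → ZMod p) (c : ZMod p → ℕ → ZMod p)
    (ws : List (ZMod p))
    (h₀ : zp g₀ (∑ k ∈ Finset.range (q + 1), c₀ k * a ^ k) = g)
    (h₁ : zp g₀ (∑ k ∈ Finset.range (q + 1), c₁ k * a ^ k) = zp g x)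
    (h₂ : zp g₀ (∑ k ∈ Finset.range (q + 1), c₂ k * a ^ k) = zp g y) :
    𝓟.Leads (Prog.ofList (initCode N (q + 1) c₀ c₁ c₂ c ws)) (sdhInput q g₀ a) fun τ =>
      𝓟.SimInv N (q + 1) g₀ a g x y
        (fun w => zp g₀ (∑ k ∈ Finset.range (q + 1), c w k * a ^ k)) ws [] (𝓟.pubStore g x y) τ ∧
      τ.get .bit N = true := by
  obtain ⟨hin, hout⟩ := sdhInput_aux (G₂ := G₂) g₀ a (q + 1)
  refine (leads_copyCode (g := g₀) (a := a) hq fun k hk => ?_).append fun τ₁ h1 => ?_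
  · rw [sdhInput, Store.get, hin k hk]
    exact Store.get_set_same _ _ _ _
  refine leads_clearCode.append fun τ₂ h2 => ?_
  refine (leads_pubCode hG₁ hN c₀ c₁ c₂ (?_ : HoldsPowers N (q + 1) g₀ a τ₂) h₀ h₁ h₂ ?_).append
    fun τ₃ h3 => ?_
  · intro k hk
    rw [Store.get, h2.1 _ _ (Or.inr (by omega))]
    exact h1.2 k hk
  · intro k i hki
    by_cases hi : k ≠ .src ∨ q + 1 ≤ i
    · rw [h2.1 k i hi, h1.1 k i (by rcases hki with h | h; exacts [Or.inl h, Or.inr (by omega)])]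
      exact hout k i hi
    · push Not at hi
      obtain ⟨rfl, hi⟩ := hi
      rw [h2.2 i hi, Store.set_same, h1.1 _ _ (Or.inr (by omega)), sdhInput, hin i hi,
        Store.set_same]
      rfl
  · obtain ⟨ha, hp, e3, e4, e5, et, eb, hb⟩ := h3
    refine (leads_buildCode hG₁ c ws hp hb).mono fun τ hτ => ⟨⟨?_, ?_, ?_, ?_, ?_, ?_, ?_, ?_, ?_⟩,
      ?_⟩
    · intro k i hi
      rw [hτ.1 k i (not_mem_of_lt (by simp) hi), ha k i hi]
    · exact hp.of_same hτ.1 (by simp)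
    · rw [hτ.1.get (by simp), e3]
    · rw [hτ.1.get (by simp), e4]
    · rw [hτ.1.get (by simp), e5]
    · rw [hτ.1.get (by simp), et]
    · exact hτ.2
    · exact HoldsLeft.nil _
    · exact HoldsLeft.nil _
    · rw [hτ.1.get (by simp), eb]

end Platform

end Init

/-! ## The simulation loop -/

section Loop

variable {p : ℕ} [Fact p.Prime] {G₁ G₂ : Type} [CommGroup G₁] [CommGroup G₂]

theorem Prog.loopFree_ofList (l : List (Instr p G₁ G₂)) : (Prog.ofList l).LoopFree := by
  induction l with
  | nil => trivial
  | cons i l ih => exact ⟨trivial, ih⟩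

namespace Platform

variable {𝓟 : Platform p G₁ G₂}

theorem Leads.le_expect {c : Prog p G₁ G₂} {σ : Store p G₁ G₂} {Q : Store p G₁ G₂ → Prop}
    (h : 𝓟.Leads c σ Q) (hc : c.LoopFree) {n : ℕ} (hn : 𝓟.worstTime c ≤ n)
    {F : ℕ × Store p G₁ G₂ → ℝ≥0∞} {a : ℝ≥0∞}
    (hF : ∀ m τ, Q τ → n ≤ m + 𝓟.worstTime c → a ≤ F (m, τ)) :
    a ≤ expect (𝓟.exec c n σ) F := by
  classical
  refine (h (fun τ => if Q τ then a else 0) a fun τ hτ => by rw [if_pos hτ]).trans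
    (𝓟.wp_le_expect c hc n σ F _ hn fun m τ hm => ?_)
  split
  · exact hF m τ ‹_› hm
  · exact zero_le

variable (𝓟)

/-- The parts of the simulation that depend on the secret exponent that is known to it: the
computation of a response `(sf m w s, ρ m w)` to the challenge `m` from an entry `(w, s)` of the
queue, and of a candidate `cf m r m' r'` for the unknown exponent from two transcripts. -/
structure Strategy where
  resp : ℕ → List (Instr p G₁ G₂)
  cand : ℕ → List (Instr p G₁ G₂)
  ρ : ZMod p → ZMod p → ZMod p
  sf : ZMod p → ZMod p → G₁ → G₁
  cf : ZMod p → ZMod p → ZMod p → ZMod p → ZMod p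
  leads_resp : ∀ (N : ℕ) (σ : Store p G₁ G₂), 6 ≤ N →
    𝓟.Leads (Prog.ofList (resp N)) σ fun τ =>
      Store.SameExcept [(.src, 3), (.scalar, 3), (.scalar, N), (.scalar, N + 1)] σ τ ∧
      τ .src 3 = σ.set .src 3 (sf (σ.get .scalar 2) (σ.get .scalar (N + 2))
        (σ.get .src (N + 2))) .src 3 ∧
      τ .scalar 3 = σ.set .scalar 3 (ρ (σ.get .scalar 2) (σ.get .scalar (N + 2))) .scalar 3
  leads_cand : ∀ (N : ℕ) (σ : Store p G₁ G₂), 6 ≤ N →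
    𝓟.Leads (Prog.ofList (cand N)) σ fun τ =>
      Store.SameExcept [(.scalar, N), (.scalar, N + 1), (.scalar, N + 6)] σ τ ∧
      τ.get .scalar (N + 6) = cf (σ.get .scalar (N + 3)) (σ.get .scalar (N + 4))
        (σ.get .scalar (N + 5)) (σ.get .scalar 3)

variable {𝓟}

/-- Record an interaction and move on in the queue. -/
def recordCode (N : ℕ) : List (Instr p G₁ G₂) :=
  [.copy .scalar (N + 3) 2, .move .scalar (N + 3) .right, .copy .scalar (N + 4) 3,
    .move .scalar (N + 4) .right, .move .src (N + 2) .right, .move .scalar (N + 2) .right,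
    .move .bit (N + 1) .right]

theorem SimInv.congr {N n : ℕ} {g₀ : G₁} {a : ZMod p} {g : G₁} {x y : ZMod p}
    {s : ZMod p → G₁} {ws : List (ZMod p)} {h : List (ZMod p × ZMod p)} {β β' σ σ' : Store p G₁ G₂}
    (H : 𝓟.SimInv N n g₀ a g x y s ws h β σ) (h1 : ∀ k i, i < N → σ' k i = β' k i)
    (h2 : ∀ k i, N ≤ i → (k, i) ≠ (.bit, N) → σ' k i = σ k i) :
    𝓟.SimInv N n g₀ a g x y s ws h β' σ' := by
  have hg : ∀ k i, N ≤ i → (k, i) ≠ (.bit, N) → σ'.get k i = σ.get k i := fun k i hi hk => by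
    rw [Store.get, h2 k i hi hk]; rfl
  refine ⟨h1, fun k hk => ?_, ?_, ?_, ?_, ?_, ⟨?_, ?_, ?_⟩, ?_, ?_⟩
  · rw [hg _ _ (by omega) (by simp), H.powers k hk]
  · rw [hg _ _ (by omega) (by simp), H.src3]
  · rw [hg _ _ (by omega) (by simp), H.src4]
  · rw [hg _ _ (by omega) (by simp), H.src5]
  · rw [hg _ _ (by omega) (by simp), H.tgt0]
  · rw [h2 _ _ (by omega) (by simp)]; exact H.queue.src
  · rw [h2 _ _ (by omega) (by simp)]; exact H.queue.scalar
  · rw [h2 _ _ (by omega) (by simp)]; exact H.queue.bit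
  · rw [h2 _ _ (by omega) (by simp)]; exact H.left3
  · rw [h2 _ _ (by omega) (by simp)]; exact H.left4

theorem leads_respond (Γ : 𝓟.Strategy) {N n : ℕ} (hN : 6 ≤ N) {g₀ : G₁} {a : ZMod p} {g : G₁}
    {x y : ZMod p} {s : ZMod p → G₁} {w : ZMod p} {ws : List (ZMod p)}
    {h : List (ZMod p × ZMod p)} {β σ : Store p G₁ G₂}
    (H : 𝓟.SimInv N n g₀ a g x y s (w :: ws) h β σ) {m : ZMod p} (hm : β.get .scalar 2 = m) :
    𝓟.Leads (Prog.ofList (Γ.resp N ++ recordCode N)) σ fun τ =>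
      𝓟.SimInv N n g₀ a g x y s ws ((m, Γ.ρ m w) :: h) (answer β (Γ.sf m w (s w)) (Γ.ρ m w)) τ ∧
      τ.get .bit N = σ.get .bit N := by
  have hm' : σ.get .scalar 2 = m := by rw [← hm, Store.get, H.agree _ _ (by omega)]; rfl
  have hw : σ.get .scalar (N + 2) = w := H.queue.scalar.head
  have hs : σ.get .src (N + 2) = s w := H.queue.src.head
  refine (Γ.leads_resp N σ hN).append fun τ hτ => ?_
  rw [hm', hw, hs] at hτ
  obtain ⟨h1, h2, h3⟩ := hτ
  have hr : τ.get .scalar 3 = Γ.ρ m w := by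
    rw [Store.get, h3]; exact Store.get_set_same _ _ _ _
  have hτm : τ.get .scalar 2 = m := by
    rw [h1.get, hm']
    simp; omega
  refine leads_cons rfl (leads_cons rfl (leads_cons rfl (leads_cons rfl (leads_cons rfl
    (leads_cons rfl (leads_cons rfl (leads_nil ?_)))))))
  rw [hτm, Store.get_setTape_ne _ _ (by simp; omega), Store.get_set_ne _ _ (by simp; omega), hr]
  refine ⟨⟨fun k i hi => ?_, fun k hk => ?_, ?_, ?_, ?_, ?_, ⟨?_, ?_, ?_⟩, ?_, ?_⟩, ?_⟩
  · have hne : ∀ c, i ≠ N + c := fun c => by omega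
    rw [Store.setTape_ne _ _ (by simp [hne]), Store.setTape_ne _ _ (by simp [hne]),
      Store.setTape_ne _ _ (by simp [hne]), Store.setTape_ne _ _ (by simp [hne]),
      Store.set_ne _ _ (by simp [hne]), Store.setTape_ne _ _ (by simp [hne]),
      Store.set_ne _ _ (by simp [hne]), answer]
    by_cases hk : (k, i) = (.scalar, 3)
    · obtain ⟨rfl, rfl⟩ := Prod.mk.inj hk
      rw [h3, Store.set_same, Store.set_same, H.agree _ _ hi, Store.set_ne _ _ (by simp)]
    · rw [Store.set_ne _ _ hk]
      by_cases hk' : (k, i) = (.src, 3)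
      · obtain ⟨rfl, rfl⟩ := Prod.mk.inj hk'
        rw [h2, Store.set_same, Store.set_same, H.agree _ _ hi]
      · rw [Store.set_ne _ _ hk', h1, H.agree _ _ hi]
        simp only [List.mem_cons, hk, hk', Prod.mk.injEq, List.not_mem_nil]
        have := hne 0; have := hne 1
        simp_all
  · rw [Store.get_setTape_ne _ _ (by simp), Store.get_setTape_ne _ _ (by simp),
      Store.get_setTape_ne _ _ (by simp; omega), Store.get_setTape_ne _ _ (by simp),
      Store.get_set_ne _ _ (by simp), Store.get_setTape_ne _ _ (by simp),
      Store.get_set_ne _ _ (by simp), h1.get, H.powers k hk]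
    simp; omega
  · rw [Store.get_setTape_ne _ _ (by simp), Store.get_setTape_ne _ _ (by simp),
      Store.get_setTape_ne _ _ (by simp), Store.get_setTape_ne _ _ (by simp),
      Store.get_set_ne _ _ (by simp), Store.get_setTape_ne _ _ (by simp),
      Store.get_set_ne _ _ (by simp), h1.get, H.src3]
    simp; omega
  · rw [Store.get_setTape_ne _ _ (by simp), Store.get_setTape_ne _ _ (by simp),
      Store.get_setTape_ne _ _ (by simp), Store.get_setTape_ne _ _ (by simp),
      Store.get_set_ne _ _ (by simp), Store.get_setTape_ne _ _ (by simp),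
      Store.get_set_ne _ _ (by simp), h1.get, H.src4]
    simp
  · rw [Store.get_setTape_ne _ _ (by simp), Store.get_setTape_ne _ _ (by simp),
      Store.get_setTape_ne _ _ (by simp), Store.get_setTape_ne _ _ (by simp),
      Store.get_set_ne _ _ (by simp), Store.get_setTape_ne _ _ (by simp),
      Store.get_set_ne _ _ (by simp), h1.get, H.src5]
    simp
  · rw [Store.get_setTape_ne _ _ (by simp), Store.get_setTape_ne _ _ (by simp),
      Store.get_setTape_ne _ _ (by simp), Store.get_setTape_ne _ _ (by simp),
      Store.get_set_ne _ _ (by simp), Store.get_setTape_ne _ _ (by simp),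
      Store.get_set_ne _ _ (by simp), h1.get, H.tgt0]
    simp
  · rw [Store.setTape_ne _ _ (by simp), Store.setTape_ne _ _ (by simp), Store.setTape_same,
      Store.setTape_ne _ _ (by simp), Store.set_ne _ _ (by simp),
      Store.setTape_ne _ _ (by simp), Store.set_ne _ _ (by simp), h1 _ _ (by simp; omega)]
    exact H.queue.src.move
  · rw [Store.setTape_ne _ _ (by simp), Store.setTape_same, Store.setTape_ne _ _ (by simp),
      Store.setTape_ne _ _ (by simp), Store.set_ne _ _ (by simp),
      Store.setTape_ne _ _ (by simp), Store.set_ne _ _ (by simp), h1 _ _ (by simp; omega)]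
    exact H.queue.scalar.move
  · intro j
    rw [Store.setTape_same, Store.setTape_ne _ _ (by simp), Store.setTape_ne _ _ (by simp),
      Store.setTape_ne _ _ (by simp), Store.set_ne _ _ (by simp),
      Store.setTape_ne _ _ (by simp), Store.set_ne _ _ (by simp), h1 _ _ (by simp)]
    refine (cell_right _ _).trans ?_
    have := H.queue.bit (j + 1)
    simpa using this
  · rw [Store.setTape_ne _ _ (by simp), Store.setTape_ne _ _ (by simp),
      Store.setTape_ne _ _ (by simp), Store.setTape_ne _ _ (by simp), Store.set_ne _ _ (by simp),
      Store.setTape_same, Store.set_same, h1 _ _ (by simp; omega)]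
    exact H.left3.push m
  · rw [Store.setTape_ne _ _ (by simp), Store.setTape_ne _ _ (by simp),
      Store.setTape_ne _ _ (by simp), Store.setTape_same, Store.set_same,
      Store.setTape_ne _ _ (by simp), Store.set_ne _ _ (by simp), h1 _ _ (by simp; try omega)]
    exact H.left4.push (Γ.ρ m w)
  · rw [Store.get_setTape_ne _ _ (by simp), Store.get_setTape_ne _ _ (by simp),
      Store.get_setTape_ne _ _ (by simp), Store.get_setTape_ne _ _ (by simp),
      Store.get_set_ne _ _ (by simp), Store.get_setTape_ne _ _ (by simp),
      Store.get_set_ne _ _ (by simp), h1.get]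
    simp

/-- Respond to the challenge of the attacker, as long as there are entries in the queue. -/
def Strategy.step (Γ : 𝓟.Strategy) (N : ℕ) : Prog p G₁ G₂ :=
  .ite (N + 1) (Prog.ofList (Γ.resp N ++ recordCode N)) (.op (.const .bit N false))

/-- A round of the simulated interaction. -/
def Strategy.round (Γ : 𝓟.Strategy) (N : ℕ) (B : Prog p G₁ G₂) : Prog p G₁ G₂ :=
  .seq B (Γ.step N)

theorem Strategy.step_loopFree (Γ : 𝓟.Strategy) (N : ℕ) : (Γ.step N).LoopFree :=
  ⟨Prog.loopFree_ofList _, trivial⟩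

/-- Simulation of the interaction of the attacker with the prover. -/
theorem gameList_le_expect_loop (Γ : 𝓟.Strategy) {N n₀ : ℕ} (hN : 6 ≤ N) {g₀ : G₁} {a : ZMod p}
    {g : G₁} {x y : ZMod p} {s : ZMod p → G₁} {B : Prog p G₁ G₂} (hB : B.Below N)
    {V φ : ZMod p → ZMod p → _} {full : List (ZMod p)}
    (hV : ∀ w ∈ full, ∀ m, V m w → Γ.sf m w (s w) = zp g (x + (m + y * Γ.ρ m w))⁻¹)
    (hφ : ∀ m w, V m w → φ m (Γ.ρ m w) = w)
    {F : ℕ → Store p G₁ G₂ → List (ZMod p × ZMod p) → ℝ≥0∞} {F' : ℕ × Store p G₁ G₂ → ℝ≥0∞}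
    {D : ℕ} (hF : ∀ m β h m' σ, 𝓟.SimInv N n₀ g₀ a g x y s [] h β σ →
      (h.map fun e => φ e.1 e.2).Perm full → m + D ≤ m' → F m β h ≤ F' (m', σ))
    (ws : List (ZMod p)) : ∀ (h : List (ZMod p × ZMod p)) (n n' f : ℕ) (β σ : Store p G₁ G₂),
      𝓟.SimInv N n₀ g₀ a g x y s ws h β σ → σ.get .bit N = true →
      ((h.map fun e => φ e.1 e.2) ++ ws).Perm full → ws.length + 2 ≤ f →
      n + (ws.length + 1) * (1 + 𝓟.worstTime (Γ.step N)) + 1 + D ≤ n' →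
      𝓟.gameList g x y Γ.ρ V B F ws n β h ≤
        expect (iterate (𝓟.exec (Γ.round N B)) N f n' σ) F' := by
  induction ws with
  | nil =>
    intro h n n' f β σ H hflag hfull hf hn
    obtain ⟨f, rfl⟩ : ∃ k, f = k + 2 := ⟨f - 2, by simp at hf; omega⟩
    simp only [List.length_nil, zero_add, one_mul] at hn
    obtain ⟨n', rfl⟩ : ∃ k, n' = n + k + 1 := ⟨n' - 1 - n, by omega⟩
    rw [show f + 2 = (f + 1) + 1 from rfl, expect_iterate_succ, if_pos hflag, Strategy.round,
      expect_exec_seq, gameList]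
    refine 𝓟.expect_exec_le_of_agree hB n' n H.agree fun m β' σ' h1 h2 => ?_
    have H' := H.congr h1 fun k i hi _ => h2 k i hi
    have hstep : 𝓟.Leads (Γ.step N) σ' fun τ =>
        𝓟.SimInv N n₀ g₀ a g x y s [] h β' τ ∧ τ.get .bit N = false := by
      refine Leads.ite (fun hb => ?_) fun _ => ?_
      · have := H'.queue.bit 0
        have h3 : σ'.get .bit (N + 1) = cell (σ' .bit (N + 1)) (0 : ℕ) := (cell_zero _).symm
        rw [h3, this] at hb
        simp at hb
      · intro K c hK
        rw [wp, effect, pexp_pure]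
        refine hK _ ⟨H'.congr (fun k i hi => ?_) (fun k i _ hk => ?_), Store.get_set_same _ _ _ _⟩
        · rw [Store.set_ne, h1 k i hi]
          simp; omega
        · rw [Store.set_ne _ _ hk]
    refine hstep.le_expect (Γ.step_loopFree N) (by omega) fun m' τ hτ hm' => ?_
    obtain ⟨m', rfl⟩ : ∃ k, m' = k + 1 := ⟨m' - 1, by omega⟩
    rw [expect_iterate_succ, if_neg (by rw [hτ.2]; simp)]
    exact hF _ _ _ _ _ hτ.1 (by simpa using hfull) (by omega)
  | cons w ws ih =>
    intro h n n' f β σ H hflag hfull hf hn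
    obtain ⟨f, rfl⟩ : ∃ k, f = k + 1 := ⟨f - 1, by simp at hf; omega⟩
    simp only [List.length_cons] at hn hf
    rw [add_mul (ws.length + 1), one_mul] at hn
    obtain ⟨n', rfl⟩ : ∃ k, n' = n + k + 1 := ⟨n' - 1 - n, by omega⟩
    rw [expect_iterate_succ, if_pos hflag, Strategy.round, expect_exec_seq, gameList]
    refine 𝓟.expect_exec_le_of_agree hB n' n H.agree fun m β' σ' h1 h2 => ?_
    have H' := H.congr h1 fun k i hi _ => h2 k i hi
    have hflag' : σ'.get .bit N = true := by
      rw [Store.get, h2 _ _ le_rfl]; exact hflag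
    dsimp only
    split
    swap
    · exact zero_le
    rename_i hv
    have hw : w ∈ full := hfull.subset (by simp)
    have hstep : 𝓟.Leads (Γ.step N) σ' fun τ =>
        𝓟.SimInv N n₀ g₀ a g x y s ws ((β'.get .scalar 2, Γ.ρ (β'.get .scalar 2) w) :: h)
          (answer β' (Γ.sf (β'.get .scalar 2) w (s w)) (Γ.ρ (β'.get .scalar 2) w)) τ ∧
          τ.get .bit N = σ'.get .bit N := by
      refine Leads.ite (fun _ => leads_respond Γ hN H' rfl) fun hb => ?_
      have := H'.queue.bit 0
      have h3 : σ'.get .bit (N + 1) = cell (σ' .bit (N + 1)) (0 : ℕ) := (cell_zero _).symm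
      rw [h3, this] at hb
      simp at hb
    refine hstep.le_expect (Γ.step_loopFree N) (by omega) fun m' τ hτ hm' => ?_
    rw [← hV w hw _ hv]
    refine ih _ _ _ _ _ _ hτ.1 (hτ.2.trans hflag') ?_ (by omega) (by omega)
    simp only [List.map_cons, hφ _ _ hv]
    refine List.Perm.trans ?_ hfull
    exact List.perm_middle.symm

end Platform

end Loop

/-! ## The output of the simulation -/

section Output

variable {p : ℕ} [Fact p.Prime] {G₁ G₂ : Type} [CommGroup G₁] [CommGroup G₂]

namespace Platform

variable {𝓟 : Platform p G₁ G₂}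

/-- Test whether the scalar on tape `N + d` is the unknown exponent. -/
def testCode (N d : ℕ) : List (Instr p G₁ G₂) :=
  [.exp₁ (N + 1) (N + 10) (N + d), .eq .src (N + 2) (N + 1) (N + 11)]

theorem leads_testCode (hG₁ : Nat.card G₁ = p) {N n : ℕ} (hn : 2 ≤ n) {g₀ : G₁}
    (hg₀ : IsGenerator g₀) {a c : ZMod p} {σ : Store p G₁ G₂} (d : ℕ)
    (hσ : HoldsPowers N n g₀ a σ) (hc : σ.get .scalar (N + d) = c) :
    𝓟.Leads (Prog.ofList (testCode N d)) σ fun τ =>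
      Store.SameExcept [(.src, N + 1), (.bit, N + 2)] σ τ ∧
      ((τ.get .bit (N + 2) : Bool) = true ↔ c = a) := by
  have h0 : σ.get .src (N + 10) = zp g₀ (a ^ 0) := hσ 0 (by omega)
  have h1 : σ.get .src (N + 11) = zp g₀ (a ^ 1) := hσ 1 (by omega)
  refine leads_cons rfl (leads_cons rfl (leads_nil ⟨?_, ?_⟩))
  · intro k i hki
    simp only [List.mem_cons, not_or, List.not_mem_nil, not_false_eq_true, and_true] at hki
    rw [Store.set_ne _ _ hki.2, Store.set_ne _ _ hki.1]
  · rw [Store.get_set_same]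
    simp only [decide_eq_true_eq]
    rw [Store.get_set_same,
      Store.get_set_ne _ _ (by simp), h0, h1, hc, ← zp_eq_zp_iff hG₁ hg₀ (a := c)]
    have : zp g₀ (a ^ 0) ^ c.val = zp g₀ c := by
      rw [show zp g₀ (a ^ 0) ^ c.val = zp (zp g₀ (a ^ 0)) c from rfl, zp_mul hG₁, pow_zero,
        one_mul]
    rw [pow_one]
    exact Eq.congr this rfl

/-- Compute and test a candidate for the unknown exponent. -/
def Strategy.scanStep (Γ : 𝓟.Strategy) (N : ℕ) : Prog p G₁ G₂ :=
  .seq (Prog.ofList ([.move .scalar (N + 3) .left, .move .scalar (N + 4) .left] ++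
    (Γ.cand N ++ testCode N 6))) (.ite (N + 2) (.op (.copy .scalar (N + 7) (N + 6))) .skip)

/-- Test the candidates that come from `k` recorded interactions. -/
def Strategy.scan (Γ : 𝓟.Strategy) (N : ℕ) : ℕ → Prog p G₁ G₂
  | 0 => .skip
  | k + 1 => .seq (Γ.scanStep N) (Γ.scan N k)

theorem leads_op {i : Instr p G₁ G₂} {σ τ : Store p G₁ G₂} {Q : Store p G₁ G₂ → Prop}
    (hi : 𝓟.effect σ i = PMF.pure τ) (h : Q τ) : 𝓟.Leads (.op i) σ Q := fun H a hH => by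
  rw [wp, hi, pexp_pure]
  exact hH τ h

/-- The tapes that are changed by `Strategy.scan`. -/
def scanTapes (N : ℕ) : List (Kind × ℕ) :=
  [(.scalar, N), (.scalar, N + 1), (.scalar, N + 3), (.scalar, N + 4), (.scalar, N + 6),
    (.scalar, N + 7), (.src, N + 1), (.bit, N + 2)]

theorem leads_scanStep (hG₁ : Nat.card G₁ = p) (Γ : 𝓟.Strategy) {N n : ℕ} (hN : 6 ≤ N)
    (hn : 2 ≤ n) {g₀ : G₁} (hg₀ : IsGenerator g₀) {a m r : ZMod p} {σ : Store p G₁ G₂}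
    {e : ZMod p × ZMod p} {h : List (ZMod p × ZMod p)} (hσ : HoldsPowers N n g₀ a σ)
    (hm : σ.get .scalar (N + 5) = m) (hr : σ.get .scalar 3 = r)
    (h3 : HoldsLeft (σ .scalar (N + 3)) ((e :: h).map Prod.fst))
    (h4 : HoldsLeft (σ .scalar (N + 4)) ((e :: h).map Prod.snd)) :
    𝓟.Leads (Γ.scanStep N) σ fun τ => Store.SameExcept (scanTapes N) σ τ ∧
      HoldsLeft (τ .scalar (N + 3)) (h.map Prod.fst) ∧
      HoldsLeft (τ .scalar (N + 4)) (h.map Prod.snd) ∧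
      ((σ.get .scalar (N + 7) = a ∨ Γ.cf e.1 e.2 m r = a) → τ.get .scalar (N + 7) = a) := by
  have hmove : 𝓟.Leads (Prog.ofList [.move .scalar (N + 3) .left, .move .scalar (N + 4) .left]) σ
      fun τ => Store.SameExcept [(.scalar, N + 3), (.scalar, N + 4)] σ τ ∧
        HoldsLeft (τ .scalar (N + 3)) (h.map Prod.fst) ∧
        HoldsLeft (τ .scalar (N + 4)) (h.map Prod.snd) ∧
        τ.get .scalar (N + 3) = e.1 ∧ τ.get .scalar (N + 4) = e.2 := by
    refine leads_cons rfl (leads_cons rfl (leads_nil ⟨fun k i hki => ?_, ?_, ?_, ?_, ?_⟩))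
    · simp only [List.mem_cons, not_or, List.not_mem_nil, not_false_eq_true, and_true] at hki
      rw [Store.setTape_ne _ _ hki.2, Store.setTape_ne _ _ hki.1]
    · rw [Store.setTape_ne _ _ (by simp), Store.setTape_same]
      exact h3.move
    · rw [Store.setTape_same, Store.setTape_ne _ _ (by simp)]
      exact h4.move
    · rw [Store.get_setTape_ne _ _ (by simp), Store.get_setTape_same]
      exact h3.head
    · rw [Store.get_setTape_same, Store.setTape_ne _ _ (by simp)]
      exact h4.head
  have hcand : 𝓟.Leads (Prog.ofList ([.move .scalar (N + 3) .left, .move .scalar (N + 4) .left] ++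
      (Γ.cand N ++ testCode N 6))) σ fun τ => Store.SameExcept [(.scalar, N), (.scalar, N + 1),
        (.scalar, N + 3), (.scalar, N + 4), (.scalar, N + 6), (.src, N + 1), (.bit, N + 2)] σ τ ∧
        HoldsLeft (τ .scalar (N + 3)) (h.map Prod.fst) ∧
        HoldsLeft (τ .scalar (N + 4)) (h.map Prod.snd) ∧
        τ.get .scalar (N + 6) = Γ.cf e.1 e.2 m r ∧
        ((τ.get .bit (N + 2) : Bool) = true ↔ Γ.cf e.1 e.2 m r = a) := by
    refine hmove.append fun τ₁ ⟨s1, l3, l4, e1, e2⟩ => ?_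
    refine (Γ.leads_cand N τ₁ hN).append fun τ₂ ⟨s2, hc⟩ => ?_
    rw [e1, e2, s1.get (by simp), hm, s1.get (by simp; omega), hr] at hc
    refine (leads_testCode hG₁ hn hg₀ 6 ((hσ.of_same s1 (by simp)).of_same s2 (by simp)) hc).mono
      fun τ ⟨s3, ht⟩ => ⟨?_, ?_, ?_, ?_, ht⟩
    · exact ((s1.mono (by simp)).trans (s2.mono (by simp))).trans (s3.mono (by simp))
    · rw [s3 _ _ (by simp), s2 _ _ (by simp)]; exact l3
    · rw [s3 _ _ (by simp), s2 _ _ (by simp)]; exact l4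
    · rw [s3.get (by simp), hc]
  refine hcand.seq fun τ ⟨s, l3, l4, hc, ht⟩ => Leads.ite (fun hb => ?_) fun hb => ?_
  · refine leads_op rfl ⟨?_, ?_, ?_, fun _ => ?_⟩
    · intro k i hki
      rw [Store.set_ne, s k i]
      · intro h; exact hki (by simp only [scanTapes, List.mem_cons] at h ⊢; tauto)
      · intro h; exact hki (by simp [scanTapes, h])
    · rw [Store.set_ne _ _ (by simp)]; exact l3
    · rw [Store.set_ne _ _ (by simp)]; exact l4
    · rw [Store.get_set_same, hc]; exact ht.1 hb
  · refine leads_skip ⟨s.mono (by simp [scanTapes]), l3, l4, fun h => ?_⟩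
    rcases h with h | h
    · rw [s.get (by simp), h]
    · exact absurd (ht.2 h) hb

theorem leads_scan (hG₁ : Nat.card G₁ = p) (Γ : 𝓟.Strategy) {N n : ℕ} (hN : 6 ≤ N)
    (hn : 2 ≤ n) {g₀ : G₁} (hg₀ : IsGenerator g₀) {a m r : ZMod p}
    (h : List (ZMod p × ZMod p)) : ∀ {σ : Store p G₁ G₂}, HoldsPowers N n g₀ a σ →
    σ.get .scalar (N + 5) = m → σ.get .scalar 3 = r →
    HoldsLeft (σ .scalar (N + 3)) (h.map Prod.fst) →
    HoldsLeft (σ .scalar (N + 4)) (h.map Prod.snd) →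
    𝓟.Leads (Γ.scan N h.length) σ fun τ => Store.SameExcept (scanTapes N) σ τ ∧
      ((σ.get .scalar (N + 7) = a ∨ ∃ e ∈ h, Γ.cf e.1 e.2 m r = a) →
        τ.get .scalar (N + 7) = a) := by
  induction h with
  | nil =>
    intro σ hσ hm hr h3 h4
    refine leads_skip ⟨Store.SameExcept.refl _ _, fun h => ?_⟩
    simpa using h
  | cons e h ih =>
    intro σ hσ hm hr h3 h4
    refine (leads_scanStep hG₁ Γ hN hn hg₀ hσ hm hr h3 h4).seq fun τ ⟨s, l3, l4, hX⟩ => ?_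
    refine (ih (hσ.of_same s (by simp [scanTapes])) ?_ ?_ l3 l4).mono fun ρ ⟨s', hX'⟩ =>
      ⟨s.trans s', fun hh => ?_⟩
    · rw [s.get (by simp [scanTapes]), hm]
    · rw [s.get, hr]
      simp [scanTapes]; omega
    · refine hX' ?_
      rcases hh with hh | ⟨e', he', hh⟩
      · exact Or.inl (hX (Or.inl hh))
      · rcases List.mem_cons.1 he' with rfl | he'
        · exact Or.inl (hX (Or.inr hh))
        · exact Or.inr ⟨e', he', hh⟩

/-- The memory holds a solution of the Strong Diffie-Hellman problem. -/
def Solved (g₀ : G₁) (a : ZMod p) (σ : Store p G₁ G₂) : Prop :=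
  a + σ.get .scalar 0 ≠ 0 ∧ σ.get .src 0 = zp g₀ (a + σ.get .scalar 0)⁻¹

/-- Output if the unknown exponent has been found. -/
def foundCode (N : ℕ) : List (Instr p G₁ G₂) :=
  [.const .scalar 0 (0 : ZMod p), .inv N (N + 7), .exp₁ 0 (N + 10) N]

/-- Output obtained from the forged response by division. -/
def divideCode (N n : ℕ) (b : ZMod p) (c : ℕ → ZMod p) : List (Instr p G₁ G₂) :=
  [.const .scalar N b, .mul (N + 8) N 3, .add (N + 8) (N + 5) (N + 8), .neg (N + 9) (N + 8),
      .const .scalar (N + 10) (0 : ZMod p), .const .src N (1 : G₁)] ++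
    (hornerCode N c n ++
      [.const .scalar N (-1 : ZMod p), .exp₁ N N N, .mul₁ N 3 N, .inv (N + 10) (N + 10),
        .exp₁ 0 N (N + 10), .copy .scalar 0 (N + 8)])

theorem leads_foundCode (hG₁ : Nat.card G₁ = p) {N n : ℕ} (hN : 6 ≤ N) (hn : 2 ≤ n) {g₀ : G₁}
    {a : ZMod p} (ha : a ≠ 0) {σ : Store p G₁ G₂} (hσ : HoldsPowers N n g₀ a σ)
    (hX : σ.get .scalar (N + 7) = a) :
    𝓟.Leads (Prog.ofList (foundCode N)) σ (Solved g₀ a) := by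
  have h0 : σ.get .src (N + 10) = zp g₀ (a ^ 0) := hσ 0 (by omega)
  have hN0 : (0 : ℕ) ≠ N := by omega
  refine leads_cons rfl (leads_cons rfl (leads_cons rfl (leads_nil ?_)))
  unfold Solved
  have e1 : ∀ (v : ZMod p) (w : ZMod p) (u : G₁), (((σ.set .scalar 0 v).set .scalar N w).set .src 0
      u).get .scalar 0 = v := fun v w u => by
    rw [Store.get_set_ne _ _ (by simp), Store.get_set_ne _ _ (by simpa using hN0),
      Store.get_set_same]
  rw [e1, add_zero]
  refine ⟨ha, ?_⟩
  rw [Store.get_set_same, Store.get_set_same, Store.get_set_ne _ _ (by simp),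
    Store.get_set_ne _ _ (by simp), Store.get_set_ne _ _ (by simp), h0, hX]
  rw [show zp g₀ (a ^ 0) ^ (a⁻¹).val = zp (zp g₀ (a ^ 0)) a⁻¹ from rfl, zp_mul hG₁, pow_zero,
    one_mul]

theorem leads_divideCode (hG₁ : Nat.card G₁ = p) {N n : ℕ} (hN : 6 ≤ N) {g₀ : G₁}
    {a b m r : ZMod p} (c : ℕ → ZMod p) {σ : Store p G₁ G₂} (hσ : HoldsPowers N n g₀ a σ)
    (hm : σ.get .scalar (N + 5) = m) (hr : σ.get .scalar 3 = r)
    (hs : σ.get .src 3 = zp g₀ ((∑ k ∈ Finset.range n, c k * a ^ k) * (a + (m + b * r))⁻¹))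
    (ha : a + (m + b * r) ≠ 0)
    (hc : ∑ k ∈ Finset.range n, c k * (-(m + b * r)) ^ k ≠ 0) :
    𝓟.Leads (Prog.ofList (divideCode N n b c)) σ (Solved g₀ a) := by
  have i3 : (3 : ℕ) ≠ N := by omega
  have i0 : (0 : ℕ) ≠ N := by omega
  have hpre : 𝓟.Leads (Prog.ofList [.const .scalar N b, .mul (N + 8) N 3,
      .add (N + 8) (N + 5) (N + 8), .neg (N + 9) (N + 8), .const .scalar (N + 10) (0 : ZMod p),
      .const .src N (1 : G₁)]) σ fun τ => Store.SameExcept [(.scalar, N), (.scalar, N + 8),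
        (.scalar, N + 9), (.scalar, N + 10), (.src, N)] σ τ ∧
        τ.get .scalar (N + 8) = m + b * r ∧ τ.get .scalar (N + 9) = -(m + b * r) ∧
        τ.get .scalar (N + 10) = (0 : ZMod p) ∧ τ.get .src N = zp g₀ (0 : ZMod p) := by
    refine leads_cons rfl (leads_cons rfl (leads_cons rfl (leads_cons rfl (leads_cons rfl
      (leads_cons rfl (leads_nil ⟨fun k i hki => ?_, ?_, ?_, ?_, ?_⟩))))))
    · simp only [List.mem_cons, not_or, List.not_mem_nil, not_false_eq_true, and_true] at hki
      rw [Store.set_ne _ _ hki.2.2.2.2, Store.set_ne _ _ hki.2.2.2.1, Store.set_ne _ _ hki.2.2.1,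
        Store.set_ne _ _ hki.2.1, Store.set_ne _ _ hki.2.1, Store.set_ne _ _ hki.1]
    · simp [Store.get_set_ne, Store.get_set_same, hm, hr, i3]
    · simp [Store.get_set_ne, Store.get_set_same, hm, hr, i3]
    · simp [Store.get_set_ne, Store.get_set_same]
    · rw [Store.get_set_same, zp_zero]
  refine hpre.append fun τ₁ ⟨s1, e8, e9, e10, eN⟩ => ?_
  refine (leads_hornerCode hG₁ c n (hσ.of_same s1 (by simp)) e9 e10 eN).append
    fun τ₂ ⟨s2, f10, E, hE, hrel⟩ => ?_
  set w := m + b * r with hw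
  set fw := ∑ k ∈ Finset.range n, c k * (-w) ^ k with hfw
  set fa := ∑ k ∈ Finset.range n, c k * a ^ k with hfa
  have hs2 : τ₂.get .src 3 = zp g₀ (fa * (a + w)⁻¹) := by
    rw [s2.get (by simp; omega), s1.get (by simp; omega), hs]
  have f8 : τ₂.get .scalar (N + 8) = w := by rw [s2.get (by simp), e8]
  simp only [zero_mul, zero_add, mul_zero] at f10 hrel
  refine leads_cons rfl (leads_cons rfl (leads_cons rfl (leads_cons rfl (leads_cons rfl
    (leads_cons rfl (leads_nil ?_))))))
  have g8 : ∀ (v1 v2 : ZMod p) (u1 u2 u3 : G₁),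
      (((((τ₂.set .scalar N v1).set .src N u1).set .src N u2).set .scalar (N + 10) v2).set
        .src 0 u3).get .scalar (N + 8) = w := fun v1 v2 u1 u2 u3 => by
    simp [Store.get_set_ne, f8]
  unfold Solved
  rw [Store.get_set_same, g8]
  refine ⟨ha, ?_⟩
  rw [Store.get_set_ne _ _ (by simp), Store.get_set_same, Store.get_set_same,
    Store.get_set_ne _ _ (by simp), Store.get_set_same, Store.get_set_ne _ _ (by simpa using i3),
    Store.get_set_ne _ _ (by simp), hs2, Store.get_set_same, Store.get_set_same,
    Store.get_set_ne _ _ (by simp), hE, Store.get_set_ne _ _ (by simp),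
    Store.get_set_ne _ _ (by simp), Store.get_set_ne _ _ (by simp), f10]
  rw [show (zp g₀ (fa * (a + w)⁻¹) * zp g₀ E ^ (-1 : ZMod p).val) ^ (fw⁻¹).val =
    zp (zp g₀ (fa * (a + w)⁻¹) * zp (zp g₀ E) (-1 : ZMod p)) fw⁻¹ from rfl, zp_mul hG₁,
    ← zp_add hG₁, zp_mul hG₁]
  congr 1
  field_simp
  linear_combination -hrel

/-- The last phase of the simulation. -/
def Strategy.final (Γ : 𝓟.Strategy) (N n q : ℕ) (b : ZMod p) (c : ℕ → ZMod p) : Prog p G₁ G₂ :=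
  .seq (.op (.const .scalar (N + 7) (0 : ZMod p))) (.seq (Γ.scan N q)
    (.seq (Prog.ofList (testCode N 7))
      (.ite (N + 2) (Prog.ofList (foundCode N)) (Prog.ofList (divideCode N n b c)))))

theorem Strategy.final_loopFree (Γ : 𝓟.Strategy) (N n q : ℕ) (b : ZMod p) (c : ℕ → ZMod p) :
    (Γ.final N n q b c).LoopFree := by
  refine ⟨trivial, ?_, Prog.loopFree_ofList _, Prog.loopFree_ofList _, Prog.loopFree_ofList _⟩
  induction q with
  | zero => trivial
  | succ q ih => exact ⟨⟨Prog.loopFree_ofList _, trivial, trivial⟩, ih⟩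

/-- The simulator solves the Strong Diffie-Hellman problem with the forged response `(s, r)` to
the challenge `m`. -/
def Strategy.Wins (Γ : 𝓟.Strategy) (n : ℕ) (g₀ : G₁) (a b : ZMod p) (c : ℕ → ZMod p)
    (h : List (ZMod p × ZMod p)) (m : ZMod p) (s : G₁) (r : ZMod p) : Prop :=
  (∃ e ∈ h, Γ.cf e.1 e.2 m r = a) ∨
    (s = zp g₀ ((∑ k ∈ Finset.range n, c k * a ^ k) * (a + (m + b * r))⁻¹) ∧
      a + (m + b * r) ≠ 0 ∧ ∑ k ∈ Finset.range n, c k * (-(m + b * r)) ^ k ≠ 0)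

theorem leads_final (hG₁ : Nat.card G₁ = p) (Γ : 𝓟.Strategy) {N n : ℕ} (hN : 6 ≤ N)
    (hn : 2 ≤ n) {g₀ : G₁} (hg₀ : IsGenerator g₀) {a b m r : ZMod p} (ha : a ≠ 0) {s : G₁}
    (c : ℕ → ZMod p) {h : List (ZMod p × ZMod p)} {σ : Store p G₁ G₂}
    (hσ : HoldsPowers N n g₀ a σ) (hm : σ.get .scalar (N + 5) = m) (hr : σ.get .scalar 3 = r)
    (hs : σ.get .src 3 = s) (h3 : HoldsLeft (σ .scalar (N + 3)) (h.map Prod.fst))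
    (h4 : HoldsLeft (σ .scalar (N + 4)) (h.map Prod.snd)) (hW : Γ.Wins n g₀ a b c h m s r) :
    𝓟.Leads (Γ.final N n h.length b c) σ (Solved g₀ a) := by
  have hzero : 𝓟.Leads (.op (.const .scalar (N + 7) (0 : ZMod p))) σ fun τ =>
      Store.SameExcept [(.scalar, N + 7)] σ τ := by
    refine leads_op rfl fun k i hki => ?_
    simp only [List.mem_cons, not_or, List.not_mem_nil, not_false_eq_true, and_true] at hki
    rw [Store.set_ne _ _ hki]
  refine hzero.seq fun τ₁ s1 => ?_
  have hr1 : τ₁.get .scalar 3 = r := by rw [s1.get (by simp), hr]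
  have hσ1 := hσ.of_same s1 (by simp)
  refine (leads_scan hG₁ Γ hN hn hg₀ h hσ1 ((s1.get (by simp)).trans hm) hr1 ?_ ?_).seq
    fun τ₂ ⟨s2, hX⟩ => ?_
  · rw [s1 _ _ (by simp)]; exact h3
  · rw [s1 _ _ (by simp)]; exact h4
  have hσ2 := hσ1.of_same s2 (by simp [scanTapes])
  refine (leads_testCode hG₁ hn hg₀ 7 hσ2 rfl).seq fun τ₃ ⟨s3, ht⟩ => ?_
  have hσ3 := hσ2.of_same s3 (by simp)
  refine Leads.ite (fun hb => ?_) fun hb => ?_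
  · exact leads_foundCode hG₁ hN hn ha hσ3 ((s3.get (by simp)).trans (ht.1 hb))
  · rcases hW with hW | ⟨hW1, hW2, hW3⟩
    · exact absurd (ht.2 (hX (Or.inr hW))) hb
    · refine leads_divideCode hG₁ hN c hσ3 (m := m) (r := r) ?_ ?_ ?_ hW2 hW3
      · rw [s3.get (by simp), s2.get (by simp [scanTapes]), s1.get (by simp), hm]
      · rw [s3.get (by simp), s2.get (by simp [scanTapes]; omega), hr1]
      · rw [s3.get (by simp; omega), s2.get (by simp [scanTapes]; omega), s1.get (by simp), hs, hW1]

end Platform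

end Output

/-! ## The simulator -/

section Simulator

variable {p : ℕ} [Fact p.Prime] {G₁ G₂ : Type} [CommGroup G₁] [CommGroup G₂]

/-- Restore the public key on the tapes of the attacker, and choose a challenge. -/
def restoreCode (N : ℕ) : List (Instr p G₁ G₂) :=
  [.copy .src 0 (N + 3), .copy .src 1 (N + 4), .copy .src 2 (N + 5), .copy .tgt 0 N, .randUnit 2,
    .copy .scalar (N + 5) 2]

namespace Platform

variable {𝓟 : Platform p G₁ G₂}

theorem finish_le_expect (hG₁ : Nat.card G₁ = p) (Γ : 𝓟.Strategy) {N n₀ : ℕ} (hN : 6 ≤ N)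
    (hn₀ : 2 ≤ n₀) {g₀ : G₁} (hg₀ : IsGenerator g₀) {a b : ZMod p} (ha : a ≠ 0) {g : G₁}
    {x y : ZMod p} {s : ZMod p → G₁} {A : Prog p G₁ G₂} (hA : A.Below N)
    {W : List (ZMod p × ZMod p) → ZMod p → G₁ → ZMod p → Prop} (c : ℕ → ZMod p)
    {h : List (ZMod p × ZMod p)} {β σ : Store p G₁ G₂}
    (hW : ∀ m s r, W h m s r → Γ.Wins n₀ g₀ a b c h m s r)
    (H : 𝓟.SimInv N n₀ g₀ a g x y s [] h β σ) {n n' : ℕ}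
    (hn : n + (𝓟.worstTime (Prog.ofList (restoreCode N)) +
      𝓟.worstTime (Γ.final N n₀ h.length b c)) ≤ n') :
    𝓟.finish g x y A W n β h ≤ expect (𝓟.exec (.seq (Prog.ofList (restoreCode N))
      (.seq A (Γ.final N n₀ h.length b c))) n' σ) fun e => indic (Solved g₀ a e.2) := by
  set R : Prog p G₁ G₂ := Prog.ofList (restoreCode N) with hR
  set K : Prog p G₁ G₂ := Γ.final N n₀ h.length b c with hK
  obtain ⟨d, hd⟩ : ∃ d, n' = n + (𝓟.worstTime R + 𝓟.worstTime K) + d := ⟨_, (by omega : n' = n +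
    (𝓟.worstTime R + 𝓟.worstTime K) + (n' - (n + (𝓟.worstTime R + 𝓟.worstTime K))))⟩
  rw [expect_exec_seq]
  refine le_trans ?_ (𝓟.wp_le_expect R (Prog.loopFree_ofList _) n' σ _
    (fun τ => expect (𝓟.exec (.seq A K) (n + 𝓟.worstTime K) τ)
      fun e => indic (Solved g₀ a e.2)) (by omega) fun m τ hm => ?_)
  swap
  · obtain ⟨d', rfl⟩ : ∃ d', m = n + 𝓟.worstTime K + d' := ⟨m - (n + 𝓟.worstTime K), by omega⟩
    exact 𝓟.expect_exec_budget _ d' _ _ _ _ fun _ _ => le_rfl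
  simp only [hR, restoreCode, wp_ofList_cons, wp_ofList_nil, effect, pexp_pure, pexp_map]
  refine pexp_mono fun m => ?_
  have i0 : ∀ c, (0 : ℕ) ≠ N + c := fun c => by omega
  have i1 : ∀ c, (1 : ℕ) ≠ N + c := fun c => by omega
  have i2 : ∀ c, (2 : ℕ) ≠ N + c := fun c => by omega
  have j0 : ∀ c, N + c ≠ (0 : ℕ) := fun c => by omega
  have j1 : ∀ c, N + c ≠ (1 : ℕ) := fun c => by omega
  have j2 : ∀ c, N + c ≠ (2 : ℕ) := fun c => by omega
  have k0 : N ≠ 0 := j0 0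
  have k1 : N ≠ 1 := j1 0
  have k2 : N ≠ 2 := j2 0
  rw [expect_exec_seq]
  set τ : Store p G₁ G₂ := Store.set _ .scalar (N + 5) _ with hτ
  have e4 : (σ.set .src 0 (σ.get .src (N + 3))).get .src (N + 4) = zp g x := by
    rw [Store.get_set_ne _ _ (by simp), H.src4]
  have e5 : ((σ.set .src 0 (σ.get .src (N + 3))).set .src 1 ((σ.set .src 0
      (σ.get .src (N + 3))).get .src (N + 4))).get .src (N + 5) = zp g y := by
    rw [Store.get_set_ne _ _ (by simp), Store.get_set_ne _ _ (by simp), H.src5]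
  have et : (((σ.set .src 0 (σ.get .src (N + 3))).set .src 1 ((σ.set .src 0
      (σ.get .src (N + 3))).get .src (N + 4))).set .src 2 (((σ.set .src 0
      (σ.get .src (N + 3))).set .src 1 ((σ.set .src 0
      (σ.get .src (N + 3))).get .src (N + 4))).get .src (N + 5))).get .tgt N =
        𝓟.pairing g g := by
    rw [Store.get_set_ne _ _ (by simp), Store.get_set_ne _ _ (by simp),
      Store.get_set_ne _ _ (by simp), H.tgt0]
  rw [et, e5, e4, H.src3, Store.get_set_same] at hτ
  have key : ∀ (k' : Kind) (v : Symb p G₁ G₂ k') (d : ℕ) (ρ ρ' : Store p G₁ G₂),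
      (∀ k i, i < N → ρ k i = ρ' k i) →
      ∀ k i, i < N → ρ.set k' d v k i = ρ'.set k' d v k i := by
    rintro k' v d ρ ρ' h k i hi
    by_cases hkd : (k, i) = (k', d)
    · obtain ⟨rfl, rfl⟩ := Prod.mk.inj hkd
      rw [Store.set_same, Store.set_same, h _ _ hi]
    · rw [Store.set_ne _ _ hkd, Store.set_ne _ _ hkd, h _ _ hi]
  refine 𝓟.expect_exec_le_of_agree hA (𝓟.worstTime K) n (fun k i hi => ?_)
    fun l β' σ' h1 h2 => ?_
  · rw [hτ, Store.set_ne _ _ (by simp; omega)]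
    exact key _ _ _ _ _ (key _ _ _ _ _ (key _ _ _ _ _ (key _ _ _ _ _ (key _ _ _ _ _ H.agree))))
      k i hi
  · have hge : ∀ k i, N ≤ i → (k, i) ≠ (.scalar, N + 5) → σ' k i = σ k i := fun k i hi hk => by
      have l0 : i ≠ 0 := by omega
      have l1 : i ≠ 1 := by omega
      have l2 : i ≠ 2 := by omega
      rw [h2 k i hi, hτ, Store.set_ne _ _ hk, Store.set_ne _ _ (by simp [l2]),
        Store.set_ne _ _ (by simp [l0]), Store.set_ne _ _ (by simp [l2]),
        Store.set_ne _ _ (by simp [l1]), Store.set_ne _ _ (by simp [l0])]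
    by_cases hw : W h m (β'.get .src 3) (β'.get .scalar 3)
    swap
    · rw [indic_of_not hw]; exact zero_le
    rw [indic_of hw]
    have hfin : 𝓟.Leads K σ' (Solved g₀ a) := by
      refine leads_final hG₁ Γ hN hn₀ hg₀ ha c (m := m) (r := β'.get .scalar 3)
        (s := β'.get .src 3) (fun k hk => ?_) ?_ ?_ ?_ ?_ ?_ (hW _ _ _ hw)
      · rw [Store.get, hge _ _ (by omega) (by simp)]; exact H.powers k hk
      · rw [Store.get, h2 _ _ (by omega), hτ]; exact Store.get_set_same _ _ _ _
      · rw [Store.get, h1 _ _ (by omega)]; rfl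
      · rw [Store.get, h1 _ _ (by omega)]; rfl
      · rw [hge _ _ (by omega) (by simp)]; exact H.left3
      · rw [hge _ _ (by omega) (by simp)]; exact H.left4
    exact hfin.le_expect (Γ.final_loopFree _ _ _ _ _) (by omega)
      fun m' τ' hs _ => (indic_of hs).ge

/-- The simulator. -/
def Strategy.sim (Γ : 𝓟.Strategy) (N n : ℕ) (b : ZMod p) (c₀ c₁ c₂ : ℕ → ZMod p)
    (c : ZMod p → ℕ → ZMod p) (ws : List (ZMod p)) (A B : Prog p G₁ G₂) : Prog p G₁ G₂ :=
  .seq (Prog.ofList (initCode N n c₀ c₁ c₂ c ws)) (.seq (.loop N (Γ.round N B))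
    (.seq (Prog.ofList (restoreCode N)) (.seq A (Γ.final N n ws.length b c₀))))

theorem gameList_le_expect_sim (hG₁ : Nat.card G₁ = p) (Γ : 𝓟.Strategy) {N q : ℕ} (hN : 6 ≤ N)
    (hq : 1 ≤ q) (hqN : q + 1 ≤ N) {g₀ g : G₁} (hg₀ : IsGenerator g₀) {a b : ZMod p} (ha : a ≠ 0)
    {x y : ZMod p} {A B : Prog p G₁ G₂} (hA : A.Below N) (hB : B.Below N)
    (c₀ c₁ c₂ : ℕ → ZMod p) (c : ZMod p → ℕ → ZMod p) (ws : List (ZMod p))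
    (h₀ : zp g₀ (∑ k ∈ Finset.range (q + 1), c₀ k * a ^ k) = g)
    (h₁ : zp g₀ (∑ k ∈ Finset.range (q + 1), c₁ k * a ^ k) = zp g x)
    (h₂ : zp g₀ (∑ k ∈ Finset.range (q + 1), c₂ k * a ^ k) = zp g y)
    {V φ : ZMod p → ZMod p → _}
    (hV : ∀ w ∈ ws, ∀ m, V m w →
      Γ.sf m w (zp g₀ (∑ k ∈ Finset.range (q + 1), c w k * a ^ k)) =
        zp g (x + (m + y * Γ.ρ m w))⁻¹)
    (hφ : ∀ m w, V m w → φ m (Γ.ρ m w) = w)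
    {W : List (ZMod p × ZMod p) → ZMod p → G₁ → ZMod p → Prop}
    (hW : ∀ h, (h.map fun e => φ e.1 e.2).Perm ws → ∀ m s r, W h m s r →
      Γ.Wins (q + 1) g₀ a b c₀ h m s r) {n n' : ℕ}
    (hn : n + 𝓟.worstTime (Prog.ofList (initCode N (q + 1) c₀ c₁ c₂ c ws)) +
      ((ws.length + 1) * (1 + 𝓟.worstTime (Γ.step N)) + 1 +
        (𝓟.worstTime (Prog.ofList (restoreCode N)) +
          𝓟.worstTime (Γ.final N (q + 1) ws.length b c₀))) ≤ n') :
    𝓟.gameList g x y Γ.ρ V B (𝓟.finish g x y A W) ws n (𝓟.pubStore g x y) [] ≤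
      expect (𝓟.exec (Γ.sim N (q + 1) b c₀ c₁ c₂ c ws A B) n' (sdhInput q g₀ a))
        fun e => indic (Solved g₀ a e.2) := by
  have hinit := leads_initCode (𝓟 := 𝓟) hG₁ hN hqN c₀ c₁ c₂ c ws h₀ h₁ h₂
  rw [Strategy.sim, expect_exec_seq]
  refine hinit.le_expect (Prog.loopFree_ofList _) (by omega) fun m τ hτ hm => ?_
  dsimp only
  rw [expect_exec_seq, exec]
  have h1 : ws.length + 1 ≤ (ws.length + 1) * (1 + 𝓟.worstTime (Γ.step N)) :=
    Nat.le_mul_of_pos_right _ (by omega)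
  refine gameList_le_expect_loop Γ hN hB hV hφ (D := 𝓟.worstTime (Prog.ofList (restoreCode N)) +
          𝓟.worstTime (Γ.final N (q + 1) ws.length b c₀)) ?_ ws [] n m m _ τ hτ.1 hτ.2
          (by simp) (by omega) (by omega)
  intro m β h m' σ H hperm hm'
  have hlen : ws.length = h.length := by rw [← hperm.length_eq, List.length_map]
  rw [hlen] at hm' ⊢
  exact finish_le_expect hG₁ Γ hN (by omega) hg₀ ha hA c₀ (hW h hperm) H hm'

end Platform

end Simulator

/-! ## Running time of the simulation -/

section Costs

variable {p : ℕ} {G₁ G₂ : Type}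

/-- The instructions that are used by the simulators. -/
def Instr.Cheap : Instr p G₁ G₂ → Prop
  | .encode .. | .decode .. | .mul₂ .. | .exp₂ .. => False
  | _ => True

/-- All instructions of the program are cheap. -/
def Prog.Cheap : Prog p G₁ G₂ → Prop
  | .skip => True
  | .op i => i.Cheap
  | .seq c d => c.Cheap ∧ d.Cheap
  | .ite _ c d => c.Cheap ∧ d.Cheap
  | .loop _ c => c.Cheap

theorem Prog.cheap_ofList {l : List (Instr p G₁ G₂)} (h : ∀ i ∈ l, i.Cheap) :
    (Prog.ofList l).Cheap := by
  induction l with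
  | nil => trivial
  | cons i l ih =>
    exact ⟨h i List.mem_cons_self, ih fun j hj => h j (List.mem_cons_of_mem _ hj)⟩

theorem Prog.size_ofList (l : List (Instr p G₁ G₂)) : (Prog.ofList l).size = l.length := by
  induction l with
  | nil => rfl
  | cons i l ih => simp only [Prog.ofList, Prog.size, ih, List.length_cons]; omega

variable [CommGroup G₁] [CommGroup G₂]

namespace Platform

variable (𝓟 : Platform p G₁ G₂)

theorem cost_le_of_cheap {M : ℕ} (h1 : 1 ≤ M) (hs : 𝓟.scalarTime ≤ M) (hm : 𝓟.mulTime₁ ≤ M)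
    (he : 𝓟.expTime₁ ≤ M) (hp : 𝓟.pairTime ≤ M) {i : Instr p G₁ G₂} (hi : i.Cheap) :
    𝓟.cost i ≤ M := by
  cases i <;> simp only [cost] <;> first | assumption | exact hi.elim

theorem worstTime_le_of_cheap {M : ℕ} (h1 : 1 ≤ M)
    (hM : ∀ i : Instr p G₁ G₂, i.Cheap → 𝓟.cost i ≤ M)
    (c : Prog p G₁ G₂) (hc : c.Cheap) : 𝓟.worstTime c ≤ M * c.size := by
  induction c with
  | skip => simp [worstTime]
  | op i => simpa [worstTime, Prog.size] using hM i hc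
  | seq c d h₁ h₂ =>
    simp only [worstTime, Prog.size, mul_add]
    exact add_le_add (h₁ hc.1) (h₂ hc.2)
  | ite b c d h₁ h₂ =>
    simp only [worstTime, Prog.size, mul_add, mul_one]
    have h₁ := h₁ hc.1
    have h₂ := h₂ hc.2
    omega
  | loop b c ih =>
    simp only [worstTime, Prog.size, mul_add, mul_one]
    have ih := ih hc
    omega

end Platform

theorem length_linCode (N : ℕ) (c : ℕ → ZMod p) (n : ℕ) :
    (linCode N c n : List (Instr p G₁ G₂)).length = 3 * n + 1 := by
  induction n with
  | zero => rfl
  | succ n ih => simp only [linCode, List.length_append, ih, linStep, List.length_cons,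
      List.length_nil]; omega

theorem cheap_linCode (N : ℕ) (c : ℕ → ZMod p) (n : ℕ) :
    ∀ i ∈ (linCode N c n : List (Instr p G₁ G₂)), i.Cheap := by
  induction n with
  | zero => simp [linCode, Instr.Cheap]
  | succ n ih =>
    intro i hi
    rcases List.mem_append.1 hi with hi | hi
    · exact ih i hi
    · simp only [linStep, List.mem_cons, List.not_mem_nil, or_false] at hi
      rcases hi with rfl | rfl | rfl <;> trivial

theorem length_hornerCode (N : ℕ) (c : ℕ → ZMod p) (n : ℕ) :
    (hornerCode N c n : List (Instr p G₁ G₂)).length = 5 * n := by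
  induction n with
  | zero => rfl
  | succ n ih => simp only [hornerCode, List.length_append, ih, hornerStep, List.length_cons,
      List.length_nil]; omega

theorem cheap_hornerCode (N : ℕ) (c : ℕ → ZMod p) (n : ℕ) :
    ∀ i ∈ (hornerCode N c n : List (Instr p G₁ G₂)), i.Cheap := by
  induction n with
  | zero => simp [hornerCode]
  | succ n ih =>
    intro i hi
    rcases List.mem_append.1 hi with hi | hi
    · simp only [hornerStep, List.mem_cons, List.not_mem_nil, or_false] at hi
      rcases hi with rfl | rfl | rfl | rfl | rfl <;> trivial
    · exact ih i hi

theorem length_initCode [Fact p.Prime] (N n : ℕ) (c₀ c₁ c₂ : ℕ → ZMod p) (c : ZMod p → ℕ → ZMod p)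
    (ws : List (ZMod p)) :
    (Platform.initCode N n c₀ c₁ c₂ c ws : List (Instr p G₁ G₂)).length =
      11 * n + 12 + ws.length * (3 * n + 7) := by
  have h1 : ∀ n, (copyCode N n : List (Instr p G₁ G₂)).length = n := by
    intro n
    induction n with
    | zero => rfl
    | succ n ih => simp [copyCode, ih]
  have h2 : ∀ n, (clearCode n : List (Instr p G₁ G₂)).length = n := by
    intro n
    induction n with
    | zero => rfl
    | succ n ih => simp [clearCode, ih]
  have h3 : (buildCode N n c ws : List (Instr p G₁ G₂)).length = ws.length * (3 * n + 7) := by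
    induction ws with
    | nil => simp [buildCode]
    | cons w ws ih =>
      simp only [buildCode, pushCode, List.length_append, ih, length_linCode, List.length_cons,
        List.length_nil, add_mul]
      omega
  simp only [Platform.initCode, pubCode, List.length_append, h1, h2, h3, length_linCode,
    List.length_cons, List.length_nil]
  omega

theorem cheap_initCode [Fact p.Prime] (N n : ℕ) (c₀ c₁ c₂ : ℕ → ZMod p) (c : ZMod p → ℕ → ZMod p)
    (ws : List (ZMod p)) :
    ∀ i ∈ (Platform.initCode N n c₀ c₁ c₂ c ws : List (Instr p G₁ G₂)), i.Cheap := by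
  have h1 : ∀ n, ∀ i ∈ (copyCode N n : List (Instr p G₁ G₂)), i.Cheap := by
    intro n
    induction n with
    | zero => simp [copyCode]
    | succ n ih =>
      intro i hi
      rcases List.mem_append.1 hi with hi | hi
      · exact ih i hi
      · simp only [List.mem_cons, List.not_mem_nil, or_false] at hi
        subst hi; trivial
  have h2 : ∀ n, ∀ i ∈ (clearCode n : List (Instr p G₁ G₂)), i.Cheap := by
    intro n
    induction n with
    | zero => simp [clearCode]
    | succ n ih =>
      intro i hi
      rcases List.mem_append.1 hi with hi | hi
      · exact ih i hi
      · simp only [List.mem_cons, List.not_mem_nil, or_false] at hi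
        subst hi; trivial
  have h3 : ∀ i ∈ (buildCode N n c ws : List (Instr p G₁ G₂)), i.Cheap := by
    induction ws with
    | nil => simp [buildCode]
    | cons w ws ih =>
      intro i hi
      simp only [buildCode, pushCode, List.mem_append] at hi
      rcases hi with hi | hi | hi
      · exact ih i hi
      · exact cheap_linCode _ _ _ i hi
      · simp only [List.mem_cons, List.not_mem_nil, or_false] at hi
        rcases hi with rfl | rfl | rfl | rfl | rfl | rfl <;> trivial
  intro i hi
  simp only [Platform.initCode, pubCode, List.mem_append, List.mem_cons, List.not_mem_nil,
    or_false] at hi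
  rcases hi with hi | hi | ((hi | rfl) | (hi | rfl) | (hi | rfl) | rfl | rfl | rfl | rfl | rfl |
    rfl) | hi
  · exact h1 n i hi
  · exact h2 n i hi
  · exact cheap_linCode _ _ _ i hi
  · trivial
  · exact cheap_linCode _ _ _ i hi
  · trivial
  · exact cheap_linCode _ _ _ i hi
  · trivial
  · trivial
  · trivial
  · trivial
  · trivial
  · trivial
  · trivial
  · exact h3 i hi

namespace Platform

variable [Fact p.Prime] {𝓟 : Platform p G₁ G₂}

/-- The codes of the strategy are short and consist of cheap instructions. -/
structure Strategy.Light (Γ : 𝓟.Strategy) : Prop where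
  length_resp : ∀ N, (Γ.resp N).length ≤ 6
  length_cand : ∀ N, (Γ.cand N).length ≤ 6
  cheap_resp : ∀ N, ∀ i ∈ Γ.resp N, i.Cheap
  cheap_cand : ∀ N, ∀ i ∈ Γ.cand N, i.Cheap

theorem Strategy.Light.step {Γ : 𝓟.Strategy} (h : Γ.Light) (N : ℕ) :
    (Γ.step N).size ≤ 15 ∧ (Γ.step N).Cheap := by
  refine ⟨?_, Prog.cheap_ofList fun i hi => ?_, trivial⟩
  · have := h.length_resp N
    simp only [Strategy.step, Prog.size, Prog.size_ofList, recordCode, List.length_append,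
      List.length_cons, List.length_nil]
    omega
  · rcases List.mem_append.1 hi with hi | hi
    · exact h.cheap_resp N i hi
    · simp only [recordCode, List.mem_cons, List.not_mem_nil, or_false] at hi
      rcases hi with rfl | rfl | rfl | rfl | rfl | rfl | rfl <;> trivial

theorem Strategy.Light.final {Γ : 𝓟.Strategy} (h : Γ.Light) (N n q : ℕ) (b : ZMod p)
    (c : ℕ → ZMod p) :
    (Γ.final N n q b c).size ≤ 12 * q + 5 * n + 19 ∧ (Γ.final N n q b c).Cheap := by
  have hscan : (Γ.scan N q).size ≤ 12 * q ∧ (Γ.scan N q).Cheap := by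
    induction q with
    | zero => exact ⟨le_rfl, trivial⟩
    | succ q ih =>
      refine ⟨?_, ⟨⟨Prog.cheap_ofList fun i hi => ?_, trivial, trivial⟩, ih.2⟩⟩
      · have h1 := h.length_cand N
        have h2 := ih.1
        simp only [Strategy.scan, Strategy.scanStep, Prog.size, Prog.size_ofList, testCode,
          List.length_append, List.length_cons, List.length_nil]
        omega
      · simp only [testCode, List.mem_append, List.mem_cons, List.not_mem_nil, or_false] at hi
        rcases hi with (rfl | rfl) | hi | rfl | rfl
        · trivial
        · trivial
        · exact h.cheap_cand N i hi
        · trivial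
        · trivial
  refine ⟨?_, trivial, hscan.2, Prog.cheap_ofList fun i hi => ?_, Prog.cheap_ofList fun i hi => ?_,
    Prog.cheap_ofList fun i hi => ?_⟩
  · have h1 := hscan.1
    simp only [Strategy.final, Prog.size, Prog.size_ofList, testCode, foundCode, divideCode,
      List.length_append, List.length_cons, List.length_nil, length_hornerCode]
    omega
  · simp only [testCode, List.mem_cons, List.not_mem_nil, or_false] at hi
    rcases hi with rfl | rfl <;> trivial
  · simp only [foundCode, List.mem_cons, List.not_mem_nil, or_false] at hi
    rcases hi with rfl | rfl | rfl <;> trivial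
  · simp only [divideCode, List.mem_append] at hi
    rcases hi with hi | hi | hi
    · simp only [List.mem_cons, List.not_mem_nil, or_false] at hi
      rcases hi with rfl | rfl | rfl | rfl | rfl | rfl <;> trivial
    · exact cheap_hornerCode _ _ _ i hi
    · simp only [List.mem_cons, List.not_mem_nil, or_false] at hi
      rcases hi with rfl | rfl | rfl | rfl | rfl | rfl <;> trivial

/-- The simulation of an attack in time `t` takes time `t + O(q² M)`. -/
theorem sim_time {Γ : 𝓟.Strategy} (hΓ : Γ.Light) {M : ℕ} (h1 : 1 ≤ M)
    (hM : ∀ i : Instr p G₁ G₂, i.Cheap → 𝓟.cost i ≤ M) (N q : ℕ) (b : ZMod p)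
    (c₀ c₁ c₂ : ℕ → ZMod p) (c : ZMod p → ℕ → ZMod p) (ws : List (ZMod p))
    (hws : ws.length < q) (A B : Prog p G₁ G₂) {t t' : ℕ} (hAB : A.size + B.size ≤ t)
    (ht : t + 250 * (q ^ 2 * M) ≤ t') :
    (Γ.sim N (q + 1) b c₀ c₁ c₂ c ws A B).size ≤ t' ∧
    t - (A.size + B.size) + 𝓟.worstTime (Prog.ofList (initCode N (q + 1) c₀ c₁ c₂ c ws)) +
      ((ws.length + 1) * (1 + 𝓟.worstTime (Γ.step N)) + 1 +
        (𝓟.worstTime (Prog.ofList (restoreCode N)) +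
          𝓟.worstTime (Γ.final N (q + 1) ws.length b c₀))) ≤
      t' - (Γ.sim N (q + 1) b c₀ c₁ c₂ c ws A B).size := by
  set I : Prog p G₁ G₂ := Prog.ofList (initCode N (q + 1) c₀ c₁ c₂ c ws) with hI
  set R : Prog p G₁ G₂ := Prog.ofList (restoreCode N) with hR
  set K : Prog p G₁ G₂ := Γ.final N (q + 1) ws.length b c₀ with hK
  have hIsize : I.size ≤ 47 * q ^ 2 := by
    rw [hI, Prog.size_ofList, length_initCode]
    nlinarith [Nat.mul_le_mul_right (3 * (q + 1) + 7) (show ws.length + 1 ≤ q by omega)]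
  have hRsize : R.size = 6 := by rw [hR, Prog.size_ofList]; rfl
  have hKsize : K.size ≤ 41 * q ^ 2 := by
    refine (hΓ.final N (q + 1) ws.length b c₀).1.trans ?_
    nlinarith
  have hsize : (Γ.sim N (q + 1) b c₀ c₁ c₂ c ws A B).size =
      I.size + (B.size + (Γ.step N).size + 1) + (R.size + (A.size + K.size)) := by
    simp only [Strategy.sim, Strategy.round, Prog.size, hI, hR, hK]
    omega
  obtain ⟨hs1, hs2⟩ := hΓ.step N
  have wI : 𝓟.worstTime I ≤ M * I.size :=
    𝓟.worstTime_le_of_cheap h1 hM _ (Prog.cheap_ofList (cheap_initCode _ _ _ _ _ _ _))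
  have wR : 𝓟.worstTime R ≤ M * R.size := by
    refine 𝓟.worstTime_le_of_cheap h1 hM _ (Prog.cheap_ofList fun i hi => ?_)
    simp only [restoreCode, List.mem_cons, List.not_mem_nil, or_false] at hi
    rcases hi with rfl | rfl | rfl | rfl | rfl | rfl <;> trivial
  have wK : 𝓟.worstTime K ≤ M * K.size :=
    𝓟.worstTime_le_of_cheap h1 hM _ (hΓ.final _ _ _ _ _).2
  have wS : 𝓟.worstTime (Γ.step N) ≤ M * (Γ.step N).size :=
    𝓟.worstTime_le_of_cheap h1 hM _ hs2
  have hq1 : 1 ≤ q := by omega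
  have hqq : q ≤ q ^ 2 := by nlinarith
  have hq2 : q ^ 2 ≤ q ^ 2 * M := Nat.le_mul_of_pos_right _ h1
  have hM2 : M ≤ q ^ 2 * M := Nat.le_mul_of_pos_left _ (by positivity)
  have b1 : 𝓟.worstTime I ≤ 47 * (q ^ 2 * M) := by
    refine wI.trans ((Nat.mul_le_mul_left M hIsize).trans (le_of_eq ?_)); ring
  have b2 : 𝓟.worstTime R ≤ 6 * M := by rw [hRsize] at wR; omega
  have b3 : 𝓟.worstTime K ≤ 41 * (q ^ 2 * M) := by
    refine wK.trans ((Nat.mul_le_mul_left M hKsize).trans (le_of_eq ?_)); ring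
  have b4 : (ws.length + 1) * (1 + 𝓟.worstTime (Γ.step N)) ≤ 16 * (q ^ 2 * M) := by
    have h5 : 1 + 𝓟.worstTime (Γ.step N) ≤ 16 * M := by
      have := wS.trans (Nat.mul_le_mul_left M hs1)
      omega
    calc (ws.length + 1) * (1 + 𝓟.worstTime (Γ.step N)) ≤ q ^ 2 * (16 * M) :=
          Nat.mul_le_mul (by omega) h5
      _ = 16 * (q ^ 2 * M) := by ring
  constructor <;> omega

end Platform

end Costs

/-! ## The reduction -/

section Reduction

theorem pexp_comm {α β : Type} (μ : PMF α) (ν : PMF β) (f : α → β → ℝ≥0∞) :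
    pexp μ (fun a => pexp ν fun b => f a b) = pexp ν fun b => pexp μ fun a => f a b := by
  unfold pexp
  simp only [← ENNReal.tsum_mul_left]
  rw [ENNReal.tsum_comm]
  exact tsum_congr fun b => tsum_congr fun a => by ring

variable {p : ℕ} [Fact p.Prime] {G₁ G₂ : Type} [CommGroup G₁] [CommGroup G₂]

theorem pexp_units_mono {f f' : ZMod p → ℝ≥0∞} (h : ∀ a, a ≠ 0 → f a ≤ f' a) :
    pexp (uniformOn {a : ZMod p | a ≠ 0} 0) f ≤ pexp (uniformOn {a : ZMod p | a ≠ 0} 0) f' := by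
  rw [Platform.pexp_units, Platform.pexp_units]
  exact mul_le_mul_right (Finset.sum_le_sum fun a ha => h a (by simpa using ha)) _

theorem pexp_randomGenerator [IsCyclic G₁] (hG₁ : Nat.card G₁ = p) (f : G₁ → ℝ≥0∞) :
    pexp (Platform.randomGenerator G₁) f = ((generators_finite hG₁).toFinset.card : ℝ≥0∞)⁻¹ *
      ∑ g ∈ (generators_finite hG₁).toFinset, f g := by
  classical
  exact pexp_uniformOn 1 _ (by simp) (by simpa using generators_nonempty) f

theorem pexp_randomGenerator_mono [IsCyclic G₁] (hG₁ : Nat.card G₁ = p) {f f' : G₁ → ℝ≥0∞}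
    (h : ∀ g, IsGenerator g → f g ≤ f' g) :
    pexp (Platform.randomGenerator G₁) f ≤ pexp (Platform.randomGenerator G₁) f' := by
  rw [pexp_randomGenerator hG₁, pexp_randomGenerator hG₁]
  exact mul_le_mul_right (Finset.sum_le_sum fun g hg => h g (by simpa using hg)) _

theorem pexp_randomGenerator_zp [IsCyclic G₁] (hG₁ : Nat.card G₁ = p) {a : ZMod p} (ha : a ≠ 0)
    (f : G₁ → ℝ≥0∞) : pexp (Platform.randomGenerator G₁) (fun g => f (zp g a)) =
      pexp (Platform.randomGenerator G₁) f := by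
  rw [pexp_randomGenerator hG₁, pexp_randomGenerator hG₁]
  congr 1
  refine Finset.sum_nbij' (fun g => zp g a) (fun g => zp g a⁻¹) ?_ ?_ ?_ ?_ ?_
  · intro g hg
    simp only [Set.Finite.mem_toFinset] at hg ⊢
    exact isGenerator_zp hG₁ hg ha
  · intro g hg
    simp only [Set.Finite.mem_toFinset] at hg ⊢
    exact isGenerator_zp hG₁ hg (inv_ne_zero ha)
  · intro g _
    rw [zp_mul hG₁, mul_inv_cancel₀ ha, zp_one]
  · intro g _
    rw [zp_mul hG₁, inv_mul_cancel₀ ha, zp_one]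
  · intro g _; rfl

namespace Platform

variable (𝓟 : Platform p G₁ G₂)

theorem expect_sdhExperiment (q t : ℕ) (C : Prog p G₁ G₂) (hC : C.size ≤ t) :
    expect (𝓟.sdhExperiment q t C) (fun b => indic (b = true)) =
      pexp (randomGenerator G₁) fun g => pexp (uniformOn {a : ZMod p | a ≠ 0} 0) fun a =>
        expect (𝓟.exec C (t - C.size) (sdhInput q g a)) fun e => indic (Solved g a e.2) := by
  simp only [sdhExperiment, expect_bind, expect_lift, expect_run, if_pos hC, expect_pure,
    decide_eq_true_eq]
  rfl

theorem expect_sdh_le {q t : ℕ} {ε : ℝ} (h : 𝓟.SDHAssumption t q ε) (C : Prog p G₁ G₂) :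
    expect (𝓟.sdhExperiment q t C) (fun b => indic (b = true)) ≤ ENNReal.ofReal ε := by
  have h1 : prob (𝓟.sdhExperiment q t C) < ε := by
    by_contra h2
    exact h ⟨C, not_lt.1 h2⟩
  rw [prob_eq] at h1
  refine ENNReal.le_ofReal_iff_toReal_le ?_ ?_ |>.2 h1.le
  · exact ((expect_le_const fun b => indic_le_one _).trans_lt ENNReal.one_lt_top).ne
  · exact ENNReal.toReal_nonneg.trans h1.le

theorem finish_eq_zero {g : G₁} {x y : ZMod p} {A : Prog p G₁ G₂}
    {W : List (ZMod p × ZMod p) → ZMod p → G₁ → ZMod p → Prop} {h : List (ZMod p × ZMod p)}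
    (hW : ∀ m s r, ¬W h m s r) (n : ℕ) (β : Store p G₁ G₂) : 𝓟.finish g x y A W n β h = 0 := by
  simp only [finish, indic_of_not (hW _ _ _), expect_zero, pexp_const]

open Polynomial in
/-- The monic polynomial with the roots `-w`, for `w` in the list. -/
noncomputable def rootPoly (ws : List (ZMod p)) : (ZMod p)[X] :=
  (ws.map fun w => X + C w).prod

open Polynomial in
theorem eval_rootPoly (ws : List (ZMod p)) (a : ZMod p) :
    (rootPoly ws).eval a = (ws.map fun w => a + w).prod := by
  rw [rootPoly, eval_list_prod, List.map_map]
  congr 1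
  exact List.map_congr_left fun w _ => by simp

open Polynomial in
theorem natDegree_rootPoly_le (ws : List (ZMod p)) : (rootPoly ws).natDegree ≤ ws.length := by
  induction ws with
  | nil => simp [rootPoly]
  | cons w ws ih =>
    rw [rootPoly, List.map_cons, List.prod_cons, List.length_cons]
    refine natDegree_mul_le.trans ?_
    rw [natDegree_X_add_C]
    have : (ws.map fun w => X + C w).prod.natDegree ≤ ws.length := ih
    omega

open Polynomial in
theorem eval_divByMonic_rootPoly {ws : List (ZMod p)} {w : ZMod p} (hw : w ∈ ws) {a : ZMod p}
    (ha : a + w ≠ 0) : (rootPoly ws /ₘ (X - C (-w))).eval a =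
      (rootPoly ws).eval a * (a + w)⁻¹ := by
  have hroot : (rootPoly ws).IsRoot (-w) := by
    rw [IsRoot.def, eval_rootPoly]
    exact List.prod_eq_zero (List.mem_map.2 ⟨w, hw, by ring⟩)
  have h := congrArg (eval a) (mul_divByMonic_eq_iff_isRoot.2 hroot)
  simp only [eval_mul, eval_sub, eval_X, eval_C, sub_neg_eq_add] at h
  rw [← h]
  field_simp

variable {𝓟}

open Polynomial in
/-- The reduction of attacks to the Strong Diffie-Hellman problem. -/
theorem pexp_gameSum_le [IsCyclic G₁] (hG₁ : Nat.card G₁ = p) {q' t' : ℕ} {ε' : ℝ}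
    (hSDH : 𝓟.SDHAssumption t' q' ε') (Γ : 𝓟.Strategy) (hΓ : Γ.Light) {M : ℕ} (hM1 : 1 ≤ M)
    (hM : ∀ i : Instr p G₁ G₂, i.Cheap → 𝓟.cost i ≤ M) (A B : Prog p G₁ G₂) {q t : ℕ}
    (hq : q < q') (hAB : A.size + B.size ≤ t) (ht : t + 250 * (q' ^ 2 * M) ≤ t') (b : ZMod p)
    (P₁ P₂ : (ZMod p)[X]) (hP₁ : P₁.natDegree ≤ 1) (hP₂ : P₂.natDegree ≤ 1)
    {V : ZMod p → ZMod p → ZMod p → Prop} {φ : ZMod p → ZMod p → ZMod p} {bad : ZMod p → Prop}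
    {W : G₁ → ZMod p → List (ZMod p × ZMod p) → ZMod p → G₁ → ZMod p → Prop}
    (hbad : ∀ g a h, (∃ e ∈ h, bad e.1) → ∀ m s r, ¬W g a h m s r)
    (hgood : ∀ a m r, ¬bad m → r ∈ goodResp (P₁.eval a) (P₂.eval a) m →
      V a m (φ m r) ∧ Γ.ρ m (φ m r) = r)
    (hφ : ∀ a m w, V a m w → φ m (Γ.ρ m w) = w)
    (hV0 : ∀ a m w, V a m w → a + w ≠ 0)
    (hV : ∀ g a m w, V a m w → Γ.sf m w (zp g (a + w)⁻¹) =
      zp g (P₁.eval a + (m + P₂.eval a * Γ.ρ m w))⁻¹)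
    (hW : ∀ g a h m s r, IsGenerator g → W g a h m s r → (∃ e ∈ h, Γ.cf e.1 e.2 m r = a) ∨
      (s = zp g (a + (m + b * r))⁻¹ ∧ a + (m + b * r) ≠ 0 ∧
        ∀ e ∈ h, φ e.1 e.2 ≠ m + b * r)) :
    (pexp (randomGenerator G₁) fun g => pexp (uniformOn {a : ZMod p | a ≠ 0} 0) fun a =>
      𝓟.gameSum g (P₁.eval a) (P₂.eval a) B (𝓟.finish g (P₁.eval a) (P₂.eval a) A (W g a)) q
        (t - (A.size + B.size)) (𝓟.pubStore g (P₁.eval a) (P₂.eval a)) []) ≤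
      (p : ℝ≥0∞) ^ q * ENNReal.ofReal ε' := by
  set n := t - (A.size + B.size) with hn
  set gl : List (ZMod p) → G₁ → ZMod p → ℝ≥0∞ := fun ws g a =>
    𝓟.gameList g (P₁.eval a) (P₂.eval a) Γ.ρ (V a) B
      (𝓟.finish g (P₁.eval a) (P₂.eval a) A (W g a)) ws n
      (𝓟.pubStore g (P₁.eval a) (P₂.eval a)) [] with hgl
  have step1 : (pexp (randomGenerator G₁) fun g => pexp (uniformOn {a : ZMod p | a ≠ 0} 0) fun a =>
      𝓟.gameSum g (P₁.eval a) (P₂.eval a) B (𝓟.finish g (P₁.eval a) (P₂.eval a) A (W g a)) q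
        n (𝓟.pubStore g (P₁.eval a) (P₂.eval a)) []) ≤
      sumList q fun ws => pexp (randomGenerator G₁) fun g =>
        pexp (uniformOn {a : ZMod p | a ≠ 0} 0) fun a => gl ws g a := by
    simp only [← pexp_sumList]
    refine pexp_mono fun g => pexp_mono fun a => ?_
    exact 𝓟.gameSum_le_sumList (bad := bad)
      (fun n β h hb => 𝓟.finish_eq_zero (hbad g a h hb) n β) φ (hgood a) q _ _ _
  refine step1.trans (sumList_le q _ _ fun ws hws => ?_)
  obtain ⟨NA, hNA⟩ := A.exists_below
  obtain ⟨NB, hNB⟩ := B.exists_below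
  set N := NA + NB + q' + 7 with hN
  set c₀ : ℕ → ZMod p := (rootPoly ws).coeff with hc₀
  set c₁ : ℕ → ZMod p := (rootPoly ws * P₁).coeff with hc₁
  set c₂ : ℕ → ZMod p := (rootPoly ws * P₂).coeff with hc₂
  set c : ZMod p → ℕ → ZMod p := fun w => (rootPoly ws /ₘ (X - C (-w))).coeff with hc
  set S : Prog p G₁ G₂ := Γ.sim N (q' + 1) b c₀ c₁ c₂ c ws A B with hS
  have hdeg := natDegree_rootPoly_le ws
  obtain ⟨hsize, htime⟩ := sim_time hΓ hM1 hM N q' b c₀ c₁ c₂ c ws (by omega) A B hAB ht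
  refine le_trans ?_ (𝓟.expect_sdh_le hSDH S)
  rw [𝓟.expect_sdhExperiment q' t' S hsize, pexp_comm, pexp_comm (randomGenerator G₁)]
  refine pexp_units_mono fun a ha => ?_
  by_cases hfa : (rootPoly ws).eval a = 0
  · rw [eval_rootPoly, List.prod_eq_zero_iff] at hfa
    obtain ⟨w, hw, haw⟩ := List.mem_map.1 hfa
    have : ∀ g, gl ws g a = 0 := fun g =>
      𝓟.gameList_eq_zero _ (fun m hv => hV0 a m w hv haw) ws _ _ _ hw
    simp only [this, pexp_const]
    exact zero_le
  rw [← pexp_randomGenerator_zp hG₁ hfa]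
  refine pexp_randomGenerator_mono hG₁ fun g₀ hg₀ => ?_
  have e₀ : ∑ k ∈ Finset.range (q' + 1), c₀ k * a ^ k = (rootPoly ws).eval a :=
    (eval_eq_sum_range' (by omega) a).symm
  have e₀' : ∀ z, ∑ k ∈ Finset.range (q' + 1), c₀ k * z ^ k = (rootPoly ws).eval z :=
    fun z => (eval_eq_sum_range' (by omega) z).symm
  have e₁ : ∑ k ∈ Finset.range (q' + 1), c₁ k * a ^ k = (rootPoly ws).eval a * P₁.eval a := by
    rw [← eval_mul]
    refine (eval_eq_sum_range' (natDegree_mul_le.trans_lt ?_) a).symm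
    omega
  have e₂ : ∑ k ∈ Finset.range (q' + 1), c₂ k * a ^ k = (rootPoly ws).eval a * P₂.eval a := by
    rw [← eval_mul]
    refine (eval_eq_sum_range' (natDegree_mul_le.trans_lt ?_) a).symm
    omega
  have e : ∀ w, ∑ k ∈ Finset.range (q' + 1), c w k * a ^ k =
      (rootPoly ws /ₘ (X - C (-w))).eval a := fun w => by
    refine (eval_eq_sum_range' ?_ a).symm
    rw [natDegree_divByMonic _ (monic_X_sub_C _)]
    omega
  refine gameList_le_expect_sim hG₁ Γ (by omega) (by omega) (by omega) hg₀ ha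
    (hNA.mono (by omega)) (hNB.mono (by omega)) c₀ c₁ c₂ c ws (φ := φ) ?_ ?_ ?_ ?_ (hφ a) ?_ htime
  · rw [e₀]
  · rw [e₁, zp_mul hG₁]
  · rw [e₂, zp_mul hG₁]
  · intro w hw m hv
    rw [e, eval_divByMonic_rootPoly hw (hV0 a m w hv), ← zp_mul hG₁]
    exact hV _ a m w hv
  · intro h hperm m s r hw
    rcases hW _ a h m s r (isGenerator_zp hG₁ hg₀ hfa) hw with hw | ⟨hw1, hw2, hw3⟩
    · exact Or.inl hw
    · refine Or.inr ⟨?_, hw2, ?_⟩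
      · rw [hw1, e₀, zp_mul hG₁]
      · rw [e₀', eval_rootPoly, Ne, List.prod_eq_zero_iff, List.mem_map]
        rintro ⟨w, hw, hz⟩
        obtain ⟨e, he, rfl⟩ := List.mem_map.1 (hperm.symm.subset hw)
        exact hw3 e he (by linear_combination hz)

end Platform

end Reduction

/-! ## Two simulations -/

section Strategies

variable {p : ℕ} [Fact p.Prime] {G₁ G₂ : Type} [CommGroup G₁] [CommGroup G₂]

namespace Platform

variable {𝓟 : Platform p G₁ G₂}

variable (𝓟)

/-- The simulation for the unknown exponent `x` and the known exponent `b = y`: a response is the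
next entry `(w, g^(1/(x+w)))` of the queue, where `w = m + b r`. -/
def queueStrategy (b : ZMod p) : 𝓟.Strategy where
  resp N := [.neg (N + 1) 2, .add (N + 1) (N + 2) (N + 1), .const .scalar N (b⁻¹ : ZMod p),
    .mul 3 N (N + 1), .copy .src 3 (N + 2)]
  cand N := [.neg (N + 6) (N + 3)]
  ρ m w := b⁻¹ * (w + -m)
  sf _ _ s := s
  cf m _ _ _ := -m
  leads_resp N σ hN := by
    have h : 3 ≠ N ∧ 3 ≠ N + 1 ∧ 2 ≠ N ∧ 2 ≠ N + 1 := by omega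
    refine leads_cons rfl (leads_cons rfl (leads_cons rfl (leads_cons rfl (leads_cons rfl
      (leads_nil ⟨?_, ?_, ?_⟩)))))
    · intro k i hki
      simp only [List.mem_cons, not_or, List.not_mem_nil, not_false_eq_true, and_true] at hki
      rw [Store.set_ne _ _ hki.1, Store.set_ne _ _ hki.2.1, Store.set_ne _ _ hki.2.2.1,
        Store.set_ne _ _ hki.2.2.2, Store.set_ne _ _ hki.2.2.2]
    · simp [Store.set_same, Store.set_ne, Store.get_set_ne]
    · simp [Store.set_same, Store.set_ne, Store.get_set_ne, Store.get_set_same, h]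
  leads_cand N σ hN := by
    refine leads_cons rfl (leads_nil ⟨?_, ?_⟩)
    · intro k i hki
      simp only [List.mem_cons, not_or, List.not_mem_nil, not_false_eq_true, and_true] at hki
      rw [Store.set_ne _ _ hki.2.2]
    · rw [Store.get_set_same]

theorem queueStrategy_light (b : ZMod p) : (𝓟.queueStrategy b).Light where
  length_resp N := by simp [queueStrategy]
  length_cand N := by simp [queueStrategy]
  cheap_resp N i hi := by
    simp only [queueStrategy, List.mem_cons, List.not_mem_nil, or_false] at hi
    rcases hi with rfl | rfl | rfl | rfl | rfl <;> trivial
  cheap_cand N i hi := by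
    simp only [queueStrategy, List.mem_cons, List.not_mem_nil, or_false] at hi
    rcases hi with rfl
    trivial

/-- The simulation for the unknown exponent `y` and the known exponent `b = x`: a response is
`s^(1/r)` for the next entry `(w, s)` of the queue, where `w = (b + m) / r`. -/
def ratioStrategy (b : ZMod p) : 𝓟.Strategy where
  resp N := [.const .scalar N b, .add N N 2, .inv (N + 1) (N + 2), .mul 3 N (N + 1),
    .inv (N + 1) 3, .exp₁ 3 (N + 2) (N + 1)]
  cand N := [.neg (N + 1) (N + 5), .add (N + 1) (N + 3) (N + 1), .neg N (N + 4), .add N 3 N,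
    .inv N N, .mul (N + 6) (N + 1) N]
  ρ m w := (b + m) * w⁻¹
  sf m w s := zp s ((b + m) * w⁻¹)⁻¹
  cf m r m' r' := (m + -m') * (r' + -r)⁻¹
  leads_resp N σ hN := by
    have h : 3 ≠ N ∧ 3 ≠ N + 1 ∧ 2 ≠ N ∧ 2 ≠ N + 1 := by omega
    refine leads_cons rfl (leads_cons rfl (leads_cons rfl (leads_cons rfl (leads_cons rfl
      (leads_cons rfl (leads_nil ⟨?_, ?_, ?_⟩))))))
    · intro k i hki
      simp only [List.mem_cons, not_or, List.not_mem_nil, not_false_eq_true, and_true] at hki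
      rw [Store.set_ne _ _ hki.1, Store.set_ne _ _ hki.2.2.2, Store.set_ne _ _ hki.2.1,
        Store.set_ne _ _ hki.2.2.2, Store.set_ne _ _ hki.2.2.1, Store.set_ne _ _ hki.2.2.1]
    · simp [Store.set_same, Store.set_ne, Store.get_set_ne, Store.get_set_same, h, zp]
    · simp [Store.set_same, Store.set_ne, Store.get_set_ne, Store.get_set_same, h]
  leads_cand N σ hN := by
    have h : 3 ≠ N ∧ 3 ≠ N + 1 ∧ 2 ≠ N ∧ 2 ≠ N + 1 := by omega
    refine leads_cons rfl (leads_cons rfl (leads_cons rfl (leads_cons rfl (leads_cons rfl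
      (leads_cons rfl (leads_nil ⟨?_, ?_⟩))))))
    · intro k i hki
      simp only [List.mem_cons, not_or, List.not_mem_nil, not_false_eq_true, and_true] at hki
      rw [Store.set_ne _ _ hki.2.2, Store.set_ne _ _ hki.1, Store.set_ne _ _ hki.1,
        Store.set_ne _ _ hki.1, Store.set_ne _ _ hki.2.1, Store.set_ne _ _ hki.2.1]
    · simp [Store.get_set_ne, Store.get_set_same, h]

theorem ratioStrategy_light (b : ZMod p) : (𝓟.ratioStrategy b).Light where
  length_resp N := by simp [ratioStrategy]
  length_cand N := by simp [ratioStrategy]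
  cheap_resp N i hi := by
    simp only [ratioStrategy, List.mem_cons, List.not_mem_nil, or_false] at hi
    rcases hi with rfl | rfl | rfl | rfl | rfl | rfl <;> trivial
  cheap_cand N i hi := by
    simp only [ratioStrategy, List.mem_cons, List.not_mem_nil, or_false] at hi
    rcases hi with rfl | rfl | rfl | rfl | rfl | rfl <;> trivial

/-- Successful attacks in which `m + y r` is new, or which contain the challenge `-x`. -/
def WinsNew (g : G₁) (x y : ZMod p) (h : List (ZMod p × ZMod p)) (m : ZMod p) (s : G₁)
    (r : ZMod p) : Prop :=
  Accepts g x y m s r ∧ ((∃ e ∈ h, e.1 = -x) ∨ ∀ e ∈ h, e.1 + y * e.2 ≠ m + y * r)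

/-- Successful attacks in which `m + y r` is not new, although `m` is. -/
def WinsOld (g : G₁) (x y : ZMod p) (h : List (ZMod p × ZMod p)) (m : ZMod p) (s : G₁)
    (r : ZMod p) : Prop :=
  Accepts g x y m s r ∧ (∀ e ∈ h, e.1 ≠ -x) ∧ ∃ e ∈ h, e.1 + y * e.2 = m + y * r ∧ e.1 ≠ m

variable {𝓟}

open Polynomial in
theorem pexp_winsNew_le [IsCyclic G₁] (hG₁ : Nat.card G₁ = p) {q' t' : ℕ} {ε' : ℝ}
    (hSDH : 𝓟.SDHAssumption t' q' ε') {M : ℕ} (hM1 : 1 ≤ M)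
    (hM : ∀ i : Instr p G₁ G₂, i.Cheap → 𝓟.cost i ≤ M) (A B : Prog p G₁ G₂) {q t : ℕ}
    (hq : q < q') (hAB : A.size + B.size ≤ t) (ht : t + 250 * (q' ^ 2 * M) ≤ t') {y : ZMod p}
    (hy : y ≠ 0) :
    (pexp (randomGenerator G₁) fun g => pexp (uniformOn {a : ZMod p | a ≠ 0} 0) fun x =>
      𝓟.gameSum g x y B (𝓟.finish g x y A (WinsNew g x y)) q
        (t - (A.size + B.size)) (𝓟.pubStore g x y) []) ≤
      (p : ℝ≥0∞) ^ q * ENNReal.ofReal ε' := by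
  have h := pexp_gameSum_le hG₁ hSDH (𝓟.queueStrategy y) (𝓟.queueStrategy_light y) hM1 hM A B hq
    hAB ht y X (C y) natDegree_X_le (by simp) (V := fun a m w => w ≠ m ∧ a + w ≠ 0)
    (φ := fun m r => m + y * r) (bad := fun _ => False) (W := fun g x => WinsNew g x y)
    (fun g a h ⟨_, _, he⟩ => he.elim) ?_ ?_ ?_ ?_ ?_
  · simpa only [eval_X, eval_C] using h
  · intro a m r _ hr
    rw [mem_goodResp, eval_X, eval_C] at hr
    refine ⟨⟨fun h => mul_ne_zero hy hr.1 (by linear_combination h), hr.2⟩, ?_⟩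
    simp only [queueStrategy]
    field_simp
    ring
  · intro a m w _
    simp only [queueStrategy]
    field_simp
    ring
  · exact fun a m w h => h.2
  · intro g a m w _
    simp only [queueStrategy, eval_X, eval_C]
    congr 2
    field_simp
    ring
  · rintro g a h m s r _ ⟨⟨h1, h2⟩, ⟨e, he, h3⟩ | h3⟩
    · exact Or.inl ⟨e, he, by simp only [queueStrategy, h3, neg_neg]⟩
    · exact Or.inr ⟨h2, h1, h3⟩

open Polynomial in
theorem pexp_winsOld_le [IsCyclic G₁] (hG₁ : Nat.card G₁ = p) {q' t' : ℕ} {ε' : ℝ}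
    (hSDH : 𝓟.SDHAssumption t' q' ε') {M : ℕ} (hM1 : 1 ≤ M)
    (hM : ∀ i : Instr p G₁ G₂, i.Cheap → 𝓟.cost i ≤ M) (A B : Prog p G₁ G₂) {q t : ℕ}
    (hq : q < q') (hAB : A.size + B.size ≤ t) (ht : t + 250 * (q' ^ 2 * M) ≤ t') (x : ZMod p) :
    (pexp (randomGenerator G₁) fun g => pexp (uniformOn {a : ZMod p | a ≠ 0} 0) fun y =>
      𝓟.gameSum g x y B (𝓟.finish g x y A (WinsOld g x y)) q
        (t - (A.size + B.size)) (𝓟.pubStore g x y) []) ≤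
      (p : ℝ≥0∞) ^ q * ENNReal.ofReal ε' := by
  have h := pexp_gameSum_le hG₁ hSDH (𝓟.ratioStrategy x) (𝓟.ratioStrategy_light x) hM1 hM A B hq
    hAB ht x (C x) X (by simp) natDegree_X_le
    (V := fun a m w => w ≠ 0 ∧ a + w ≠ 0 ∧ x + m ≠ 0)
    (φ := fun m r => (x + m) * r⁻¹) (bad := fun m => x + m = 0) (W := fun g y => WinsOld g x y)
    ?_ ?_ ?_ ?_ ?_ ?_
  · simpa only [eval_X, eval_C] using h
  · rintro g a h ⟨e, he, h1⟩ m s r ⟨_, h2, _⟩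
    exact h2 e he (by linear_combination h1)
  · intro a m r hm hr
    rw [mem_goodResp, eval_X, eval_C] at hr
    have hr0 := hr.1
    refine ⟨⟨mul_ne_zero hm (inv_ne_zero hr0), fun h => hr.2 ?_, hm⟩, ?_⟩
    · field_simp at h
      linear_combination h
    · simp only [ratioStrategy]
      field_simp
  · rintro a m w ⟨hw, _, hm⟩
    simp only [ratioStrategy]
    field_simp
  · exact fun a m w h => h.2.1
  · rintro g a m w ⟨hw, ha, hm⟩
    simp only [ratioStrategy, eval_X, eval_C]
    rw [zp_mul hG₁, ← mul_inv]
    congr 2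
    field_simp
    ring
  · rintro g a h m s r _ ⟨_, _, e, he, h2, h3⟩
    refine Or.inl ⟨e, he, ?_⟩
    simp only [ratioStrategy]
    have hr : r + -e.2 ≠ 0 := fun hr => h3 (by linear_combination h2 + a * hr)
    field_simp
    linear_combination h2

end Platform

end Strategies

/-! ## Security -/

section Security

/-- The numerical estimate in the proof of security. -/
theorem security_bound {p q : ℕ} {ε ε' : ℝ} (hε' : 0 < ε') (hq1 : 1 ≤ q) (hqp : q < p)
    (hε1 : ε ≤ 1)
    (hε : 2 * ε' * ((p : ℝ) / ((p : ℝ) - (q : ℝ))) + 2 * (q : ℝ) / ((p : ℝ) - (q : ℝ)) ≤ ε) :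
    3 * q < p ∧ 2 * (((p : ℝ) - 2)⁻¹ ^ q * ((p : ℝ) ^ q * ε')) + ((p : ℝ) - 1)⁻¹ * q < ε := by
  have hq0 : (1 : ℝ) ≤ q := by exact_mod_cast hq1
  have hpq : (0 : ℝ) < p - q := by
    have : (q : ℝ) < p := by exact_mod_cast hqp
    linarith
  have hp0 : (0 : ℝ) < p := by linarith
  set a : ℝ := 2 * ε' * p with ha
  have ha0 : 0 < a := by positivity
  have hsum : (a + 2 * q) / (p - q) ≤ ε := by
    rw [add_div]; simpa only [ha, mul_div_assoc] using hε
  have h3 : a + 2 * q ≤ p - q := by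
    have := (div_le_iff₀ hpq).1 (hsum.trans hε1)
    linarith
  have h3q : (3 : ℝ) * q < p := by linarith
  refine ⟨by exact_mod_cast h3q, lt_of_lt_of_le ?_ hsum⟩
  have hp2 : (0 : ℝ) < p - 2 := by linarith
  have h2q : (0 : ℝ) < p - 2 * q := by linarith
  have hpow : ((p : ℝ) - 2)⁻¹ ^ q * (p : ℝ) ^ q ≤ p / (p - 2 * q) := by
    have hb := one_add_mul_le_pow (a := -(2 / (p : ℝ))) (by
      have : 2 / (p : ℝ) ≤ 2 := div_le_self zero_le_two (by linarith)
      linarith) q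
    have e1 : 1 + (q : ℝ) * -(2 / (p : ℝ)) = (p - 2 * q) / p := by field_simp; ring
    have e2 : 1 + -(2 / (p : ℝ)) = (p - 2) / p := by field_simp; ring
    rw [e1, e2] at hb
    have e3 : ((p : ℝ) - 2)⁻¹ ^ q * (p : ℝ) ^ q = ((((p : ℝ) - 2) / p) ^ q)⁻¹ := by
      rw [← mul_pow, ← inv_pow, inv_div, div_eq_inv_mul]
    rw [e3, ← inv_div (_ - _)]
    exact inv_anti₀ (by positivity) hb
  have h1 : 2 * (((p : ℝ) - 2)⁻¹ ^ q * ((p : ℝ) ^ q * ε')) ≤ a / (p - 2 * q) := by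
    have := mul_le_mul_of_nonneg_left hpow (by positivity : 0 ≤ 2 * ε')
    calc _ = 2 * ε' * (((p : ℝ) - 2)⁻¹ ^ q * (p : ℝ) ^ q) := by ring
      _ ≤ _ := this
      _ = _ := by rw [ha]; ring
  have h2 : ((p : ℝ) - 1)⁻¹ * q ≤ q / (p - q) := by
    rw [← div_eq_inv_mul]
    exact div_le_div_of_nonneg_left (by linarith) hpq (by linarith)
  have h4 : a / (p - 2 * q) < (a + q) / (p - q) := by
    rw [div_lt_div_iff₀ h2q hpq]
    nlinarith
  calc _ ≤ a / (p - 2 * q) + q / (p - q) := add_le_add h1 h2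
    _ < (a + q) / (p - q) + q / (p - q) := by linarith
    _ = _ := by ring

variable {p : ℕ} [Fact p.Prime] {G₁ G₂ : Type} [CommGroup G₁] [CommGroup G₂]

namespace Platform

variable {𝓟 : Platform p G₁ G₂}

theorem SDHAssumption.pos {t q : ℕ} {ε : ℝ} (h : 𝓟.SDHAssumption t q ε) : 0 < ε := by
  by_contra h'
  exact h ⟨.skip, (not_lt.1 h').trans ENNReal.toReal_nonneg⟩

variable (𝓟)

theorem finish_repeated_le (g : G₁) (x y : ZMod p) (A : Prog p G₁ G₂) (n : ℕ)
    (β : Store p G₁ G₂) (h : List (ZMod p × ZMod p)) :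
    𝓟.finish g x y A (fun h m _ _ => ∃ e ∈ h, e.1 = m) n β h ≤
      ((p - 1 : ℕ) : ℝ≥0∞)⁻¹ * h.length := by
  classical
  refine (pexp_mono (g := fun m => indic (∃ e ∈ h, e.1 = m)) fun m =>
    expect_le_const fun e => le_rfl).trans ?_
  rw [pexp_units]
  refine mul_le_mul_right ?_ _
  have hsub : ((Finset.univ.filter fun a : ZMod p => a ≠ 0).filter fun m => ∃ e ∈ h, e.1 = m) ⊆
      (h.map Prod.fst).toFinset := by
    intro m hm
    simpa using (Finset.mem_filter.1 hm).2
  refine le_of_eq_of_le (b := ((((Finset.univ.filter fun a : ZMod p => a ≠ 0).filter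
    fun m => ∃ e ∈ h, e.1 = m).card : ℕ) : ℝ≥0∞)) ?_ ?_
  · rw [Finset.card_filter, Nat.cast_sum]
    refine Finset.sum_congr rfl fun m _ => ?_
    by_cases hm : ∃ e ∈ h, e.1 = m
    · rw [indic_of hm, if_pos hm, Nat.cast_one]
    · rw [indic_of_not hm, if_neg hm, Nat.cast_zero]
  · exact_mod_cast (Finset.card_le_card hsub).trans
      ((List.toFinset_card_le _).trans (List.length_map _).le)

theorem finish_accepts_le (g : G₁) (x y : ZMod p) (A : Prog p G₁ G₂) (n : ℕ)
    (β : Store p G₁ G₂) (h : List (ZMod p × ZMod p)) :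
    𝓟.finish g x y A (fun _ m s r => Accepts g x y m s r) n β h ≤
      𝓟.finish g x y A (WinsNew g x y) n β h + (𝓟.finish g x y A (WinsOld g x y) n β h +
        𝓟.finish g x y A (fun h m _ _ => ∃ e ∈ h, e.1 = m) n β h) := by
  simp only [finish, ← pexp_add, ← expect_add]
  refine pexp_mono fun m => expect_mono fun e => ?_
  generalize e.2.get .src 3 = s
  generalize e.2.get .scalar 3 = r
  by_cases h0 : Accepts g x y m s r
  swap
  · rw [indic_of_not h0]; exact zero_le
  rw [indic_of h0]
  by_cases h1 : WinsNew g x y h m s r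
  · rw [indic_of h1]; exact le_self_add
  by_cases h2 : ∃ e ∈ h, e.1 = m
  · rw [indic_of h2]; exact le_add_self.trans le_add_self
  have h3 : WinsOld g x y h m s r := by
    by_contra h3
    unfold WinsNew at h1
    unfold WinsOld at h3
    push Not at h1 h2 h3
    obtain ⟨h4, e, he, h5⟩ := h1 h0
    exact h2 e he (h3 h0 h4 e he h5)
  rw [indic_of h3]; exact le_self_add.trans le_add_self

theorem finish_winsOld_nil (g : G₁) (x y : ZMod p) (A : Prog p G₁ G₂) (n : ℕ)
    (β : Store p G₁ G₂) : 𝓟.finish g x y A (WinsOld g x y) n β [] = 0 :=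
  𝓟.finish_eq_zero (by simp [WinsOld]) n β

variable {𝓟}

theorem pexp_game_winsNew_le [IsCyclic G₁] (hG₁ : Nat.card G₁ = p) {q' t' : ℕ} {ε' : ℝ}
    (hSDH : 𝓟.SDHAssumption t' q' ε') {M : ℕ} (hM1 : 1 ≤ M)
    (hM : ∀ i : Instr p G₁ G₂, i.Cheap → 𝓟.cost i ≤ M) (A B : Prog p G₁ G₂) {q t : ℕ}
    (hq : q < q') (hAB : A.size + B.size ≤ t) (ht : t + 250 * (q' ^ 2 * M) ≤ t')
    (hp : 0 < q → 3 ≤ p) :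
    (pexp (randomGenerator G₁) fun g => pexp (uniformOn {a : ZMod p | a ≠ 0} 0) fun x =>
      pexp (uniformOn {a : ZMod p | a ≠ 0} 0) fun y =>
        𝓟.game g x y B (𝓟.finish g x y A (WinsNew g x y)) q
          (t - (A.size + B.size)) (𝓟.pubStore g x y) []) ≤
      (((p - 2 : ℕ) : ℝ≥0∞)⁻¹) ^ q * ((p : ℝ≥0∞) ^ q * ENNReal.ofReal ε') := by
  have hc : ∀ g, _ = _ := fun g => pexp_comm (uniformOn {a : ZMod p | a ≠ 0} 0)
    (uniformOn {a : ZMod p | a ≠ 0} 0) (fun x y => 𝓟.game g x y B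
      (𝓟.finish g x y A (WinsNew g x y)) q (t - (A.size + B.size)) (𝓟.pubStore g x y) [])
  simp only [hc]
  rw [pexp_comm]
  refine (pexp_units_mono fun y hy => ?_).trans (pexp_const _ _).le
  refine (pexp_mono fun g => pexp_mono fun x => 𝓟.game_le_gameSum hy _ q hp _ _ _).trans ?_
  simp only [pexp_const_mul]
  exact mul_le_mul_right (pexp_winsNew_le hG₁ hSDH hM1 hM A B hq hAB ht hy) _

theorem pexp_game_winsOld_le [IsCyclic G₁] (hG₁ : Nat.card G₁ = p) {q' t' : ℕ} {ε' : ℝ}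
    (hSDH : 𝓟.SDHAssumption t' q' ε') {M : ℕ} (hM1 : 1 ≤ M)
    (hM : ∀ i : Instr p G₁ G₂, i.Cheap → 𝓟.cost i ≤ M) (A B : Prog p G₁ G₂) {q t : ℕ}
    (hq : q < q') (hAB : A.size + B.size ≤ t) (ht : t + 250 * (q' ^ 2 * M) ≤ t')
    (hp : 0 < q → 3 ≤ p) :
    (pexp (randomGenerator G₁) fun g => pexp (uniformOn {a : ZMod p | a ≠ 0} 0) fun x =>
      pexp (uniformOn {a : ZMod p | a ≠ 0} 0) fun y =>
        𝓟.game g x y B (𝓟.finish g x y A (WinsOld g x y)) q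
          (t - (A.size + B.size)) (𝓟.pubStore g x y) []) ≤
      (((p - 2 : ℕ) : ℝ≥0∞)⁻¹) ^ q * ((p : ℝ≥0∞) ^ q * ENNReal.ofReal ε') := by
  rw [pexp_comm]
  refine (pexp_mono fun x => ?_).trans (pexp_const _ _).le
  refine (pexp_mono fun g => pexp_units_mono fun y hy =>
    𝓟.game_le_gameSum hy _ q hp _ _ _).trans ?_
  simp only [pexp_const_mul]
  exact mul_le_mul_right (pexp_winsOld_le hG₁ hSDH hM1 hM A B hq hAB ht x) _

theorem expect_attack_le [IsCyclic G₁] (hG₁ : Nat.card G₁ = p) (hG₂ : Nat.card G₂ = p)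
    {q' t' : ℕ} {ε' : ℝ} (hSDH : 𝓟.SDHAssumption t' q' ε') {M : ℕ} (hM1 : 1 ≤ M)
    (hM : ∀ i : Instr p G₁ G₂, i.Cheap → 𝓟.cost i ≤ M) (A B : Prog p G₁ G₂) {q t : ℕ}
    (hq : q < q') (ht : t + 250 * (q' ^ 2 * M) ≤ t') (hp : 0 < q → 3 ≤ p)
    (hP : 𝓟.sdhProverTime ≤ t) (hV : 𝓟.sdhVerifierTime ≤ t) :
    expect ((sdhScheme p G₁ G₂).attack 𝓟 𝓟.sdhKeygenTime t q A B) (fun b => indic (b = true)) ≤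
      (((p - 2 : ℕ) : ℝ≥0∞)⁻¹) ^ q * ((p : ℝ≥0∞) ^ q * ENNReal.ofReal ε') +
      ((if q = 0 then 0 else
        (((p - 2 : ℕ) : ℝ≥0∞)⁻¹) ^ q * ((p : ℝ≥0∞) ^ q * ENNReal.ofReal ε')) +
        ((p - 1 : ℕ) : ℝ≥0∞)⁻¹ * q) := by
  rw [𝓟.expect_attack hG₁ hG₂ q hP hV]
  split_ifs with hAB hq0
  · subst hq0
    refine le_trans (pexp_mono fun g => pexp_mono fun x => pexp_mono fun y =>
      𝓟.game_mono (fun n β h => 𝓟.finish_accepts_le g x y A n β h) 0 _ _ _) ?_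
    simp only [game_add, pexp_add]
    refine add_le_add (pexp_game_winsNew_le hG₁ hSDH hM1 hM A B hq hAB ht hp) (add_le_add ?_ ?_)
    · simp only [game, finish_winsOld_nil, expect_zero, pexp_const, le_refl]
    · refine (pexp_mono fun g => pexp_mono fun x => pexp_mono fun y => 𝓟.game_le_const 0
        (fun n β h hl => hl ▸ 𝓟.finish_repeated_le g x y A n β h) 0 _ _ [] rfl).trans ?_
      simp only [pexp_const, le_refl]
  · refine le_trans (pexp_mono fun g => pexp_mono fun x => pexp_mono fun y =>
      𝓟.game_mono (fun n β h => 𝓟.finish_accepts_le g x y A n β h) q _ _ _) ?_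
    simp only [game_add, pexp_add]
    refine add_le_add (pexp_game_winsNew_le hG₁ hSDH hM1 hM A B hq hAB ht hp) (add_le_add
      (pexp_game_winsOld_le hG₁ hSDH hM1 hM A B hq hAB ht hp) ?_)
    refine (pexp_mono fun g => pexp_mono fun x => pexp_mono fun y => 𝓟.game_le_const q
      (fun n β h hl => hl ▸ 𝓟.finish_repeated_le g x y A n β h) q _ _ [] (by simp)).trans ?_
    simp only [pexp_const, le_refl]
  · exact zero_le
  · exact zero_le

theorem attack_lt [IsCyclic G₁] (hG₁ : Nat.card G₁ = p) (hG₂ : Nat.card G₂ = p)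
    {q' t' : ℕ} {ε ε' : ℝ} (hSDH : 𝓟.SDHAssumption t' q' ε') {M : ℕ} (hM1 : 1 ≤ M)
    (hM : ∀ i : Instr p G₁ G₂, i.Cheap → 𝓟.cost i ≤ M) (A B : Prog p G₁ G₂) {q t : ℕ}
    (hq : q < q') (hqp : q < p)
    (hε : 2 * ε' * ((p : ℝ) / ((p : ℝ) - (q : ℝ))) + 2 * (q : ℝ) / ((p : ℝ) - (q : ℝ)) ≤ ε)
    (ht : t + 250 * (q' ^ 2 * M) ≤ t')
    (hP : 𝓟.sdhProverTime ≤ t) (hV : 𝓟.sdhVerifierTime ≤ t) :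
    prob ((sdhScheme p G₁ G₂).attack 𝓟 𝓟.sdhKeygenTime t q A B) < ε := by
  have hε' := hSDH.pos
  have hp1 : 1 < p := (Fact.out : p.Prime).one_lt
  rw [prob_eq]
  rcases Nat.eq_zero_or_pos q with rfl | hq1
  · have h := expect_attack_le hG₁ hG₂ hSDH hM1 hM A B hq ht (fun h => absurd h (lt_irrefl 0)) hP hV
    simp only [pow_zero, one_mul, if_true, Nat.cast_zero, mul_zero, add_zero] at h
    have hp0 : (p : ℝ) ≠ 0 := by positivity
    simp only [Nat.cast_zero, sub_zero, div_self hp0, mul_one, mul_zero, zero_div, add_zero] at hε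
    have := ENNReal.toReal_le_of_le_ofReal hε'.le h
    linarith
  rcases lt_or_ge 1 ε with hε1 | hε1
  · refine lt_of_le_of_lt ?_ hε1
    rw [← ENNReal.toReal_one]
    exact ENNReal.toReal_mono ENNReal.one_ne_top (expect_le_const fun b => indic_le_one _)
  obtain ⟨h3q, hlt⟩ := security_bound hε' hq1 hqp hε1 hε
  have h := expect_attack_le hG₁ hG₂ hSDH hM1 hM A B hq ht (fun _ => by omega) hP hV
  rw [if_neg hq1.ne'] at h
  refine lt_of_le_of_lt ?_ hlt
  have e2 : (((p - 2 : ℕ) : ℝ≥0∞)⁻¹) = ENNReal.ofReal ((p : ℝ) - 2)⁻¹ := by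
    rw [ENNReal.ofReal_inv_of_pos (by rw [sub_pos]; exact_mod_cast (by omega : 2 < p)),
      ← ENNReal.ofReal_natCast, Nat.cast_sub (by omega)]
    rfl
  have e1 : (((p - 1 : ℕ) : ℝ≥0∞)⁻¹) = ENNReal.ofReal ((p : ℝ) - 1)⁻¹ := by
    rw [ENNReal.ofReal_inv_of_pos (by rw [sub_pos]; exact_mod_cast hp1),
      ← ENNReal.ofReal_natCast, Nat.cast_sub (by omega), Nat.cast_one]
  have h2 : (0 : ℝ) ≤ ((p : ℝ) - 2)⁻¹ := by
    rw [inv_nonneg, sub_nonneg]; exact_mod_cast (by omega : 2 ≤ p)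
  have h1 : (0 : ℝ) ≤ ((p : ℝ) - 1)⁻¹ := by
    rw [inv_nonneg, sub_nonneg]; exact_mod_cast hp1.le
  refine ENNReal.toReal_le_of_le_ofReal (by positivity) (h.trans (le_of_eq ?_))
  rw [e1, e2, ← ENNReal.ofReal_natCast p, ← ENNReal.ofReal_natCast q, ← ENNReal.ofReal_pow h2,
    ← ENNReal.ofReal_pow (by positivity), ← ENNReal.ofReal_mul (by positivity),
    ← ENNReal.ofReal_mul (by positivity), ← ENNReal.ofReal_mul h1,
    ← ENNReal.ofReal_add (by positivity) (by positivity),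
    ← ENNReal.ofReal_add (by positivity) (by positivity)]
  congr 1
  ring

end Platform

end Security

theorem mainTheorem5 :
    ∀ κ : ℕ, ∃ c : ℕ,
      ∀ (p : ℕ) [Fact p.Prime] (G₁ G₂ : Type) [CommGroup G₁] [CommGroup G₂]
        [IsCyclic G₁] [IsCyclic G₂] (_hG₁ : Nat.card G₁ = p) (_hG₂ : Nat.card G₂ = p)
        (𝓟 : Platform p G₁ G₂)
        -- the costs of the elementary operations are at most proportional to `T = 𝓟.expTime₁`
        (_hT : 1 ≤ 𝓟.expTime₁) (_hscalar : 𝓟.scalarTime ≤ κ * 𝓟.expTime₁)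
        (_hmul : 𝓟.mulTime₁ ≤ κ * 𝓟.expTime₁) (_hpair : 𝓟.pairTime ≤ κ * 𝓟.expTime₁)
        (q q' t t' : ℕ) (ε ε' : ℝ)
        (_hSDH : 𝓟.SDHAssumption t' q' ε')
        (_hq : q < q') (_hqp : q < p)
        (_hε : 2 * ε' * ((p : ℝ) / ((p : ℝ) - (q : ℝ))) + 2 * (q : ℝ) / ((p : ℝ) - (q : ℝ)) ≤ ε)
        (_ht : t + c * (q' ^ 2 * 𝓟.expTime₁) ≤ t')
        -- there is enough time for the honest prover and the honest verifier
        (_hP : 𝓟.sdhProverTime ≤ t) (_hV : 𝓟.sdhVerifierTime ≤ t),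
        (sdhScheme p G₁ G₂).IsIdentificationScheme 𝓟 𝓟.sdhKeygenTime t q ε := by
  intro κ
  refine ⟨250 * (κ + 1), ?_⟩
  intro p _ G₁ G₂ _ _ _ _ hG₁ hG₂ 𝓟 hT hscalar hmul hpair q q' t t' ε ε' hSDH hq hqp hε ht hP hV
  have hM1 : 1 ≤ (κ + 1) * 𝓟.expTime₁ := Nat.mul_pos κ.succ_pos hT
  have hle : ∀ {d : ℕ}, d ≤ κ * 𝓟.expTime₁ → d ≤ (κ + 1) * 𝓟.expTime₁ := fun h =>
    h.trans (Nat.mul_le_mul_right _ κ.le_succ)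
  have hM : ∀ i : Instr p G₁ G₂, i.Cheap → 𝓟.cost i ≤ (κ + 1) * 𝓟.expTime₁ := fun i hi =>
    𝓟.cost_le_of_cheap hM1 (hle hscalar) (hle hmul) (Nat.le_mul_of_pos_left _ κ.succ_pos)
      (hle hpair) hi
  have hverify := 𝓟.verify_time
  refine ⟨?_, ?_, ⟨𝓟.scalarTime + 1, _, ?_, ?_,
    𝓟.runsIn_of_loopFree Platform.verify_loopFree le_rfl⟩, 𝓟.viability hG₁ hG₂ hP hV,
    fun A B => Platform.attack_lt hG₁ hG₂ hSDH hM1 hM A B hq hqp hε ?_ hP hV⟩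
  · refine 𝓟.runsIn_of_loopFree ?_ ?_
    · simp [sdhScheme, Prog.ofList, Prog.LoopFree]
    · simp [sdhScheme, Prog.ofList, Prog.size, Platform.worstTime, Platform.cost,
        Platform.sdhKeygenTime]
      omega
  · exact 𝓟.runsIn_of_loopFree Platform.prover_loopFree (𝓟.prover_time.trans hP)
  · omega
  · refine 𝓟.runsIn_of_loopFree ?_ ?_
    · simp [sdhScheme, Prog.LoopFree]
    · simp [sdhScheme, Prog.size, Platform.worstTime, Platform.cost]
      omega
  · refine le_trans (le_of_eq ?_) ht
    ring
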